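/- **Formulas, proofdoors, resolution.** A CNF formula is a finite set of clauses, a clause a finite set of literals; the size of a resolution refutation is its number of clauses. The pathwidth of a CNF formula is the pathwidth of its clause–variable incidence graph (vertices: its variables and its clauses; a variable is adjacent to each clause containing it). An interpolant from $A$ to $B$ is a CNF formula $I$ over variables common to $A$ and $B$ with $A\models I$ and $I\wedge B$ unsatisfiable. An unsatisfiable CNF formula $F$ *admits a proofdoor with parameters* $(c,w,s)$ ($c,w,s\ge 1$ integers) if for some $k\ge 1$ its clause set can be partitioned into chunks, $F=A_1\wedge\dots\wedge A_k$, and there are CNF formulas $I_1,\dots,I_{k-1}$ (put $I_0=\emptyset$) such that each $I_j$ is an interpolant from $I_{j-1}\wedge A_j$ to $A_{j+1}\wedge\dots\wedge A_k$; each $I_j$ has at most $c$ clauses; for every clause $C\in I_j$ there is $S(C)\subseteq I_{j-1}$ with $|S(C)|\le s$ and $A_j\wedge S(C)\models C$; $I_{k-1}$ has at most $s$ clauses; and every $A_j$ has pathwidth at most $w$. A family of formulas admits *small proofdoors* if its members, with $N$ variables, admit proofdoors with $c=O(N)$, $w=O(\log N)$, $s=O(\log N)$. **The adder.** For $m,n\ge1$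 let $\mathrm{add}_{m,n}(a,b)$ be the following circuit on $a=(E_a,M_a)$, $b=(E_b,M_b)$ with $m$-bit exponents and $n$-bit significands (positive normalized numbers; no NaNs, infinities, subnormals, signed zeros). Here $\mathrm{MUX}(s;t,e)$ is $t$ if $s=1$ and $e$ otherwise, and bit $0$ is least significant. 1. Comparison: $eq_i=(E_{a,i}\leftrightarrow E_{b,i})$, $p_{m-1}=1$, $p_i=p_{i+1}\wedge eq_{i+1}$, $GT_i=p_i\wedge E_{a,i}\wedge\neg E_{b,i}$, $LT_i=p_i\wedge\neg E_{a,i}\wedge E_{b,i}$, $GT=\bigvee_i GT_i$, $LT=\bigvee_i LT_i$, $EQ=\bigwedge_i eq_i$. 2. Selection, bitwise: $E_{large}=\mathrm{MUX}(GT;E_a,E_b)$, $E_{small}=\mathrm{MUX}(LT;E_a,E_b)$, $M_{large}=\mathrm{MUX}(GT;M_a,M_b)$, $M_{small}=\mathrm{MUX}(GT;M_b,M_a)$. 3. $\mathrm{Diff}=E_{large}-E_{small}$ by a ripple-borrow subtractor. 4. Alignment: an $m$-stage barrel shifter, stage $j$ shifting right (filling with zeros) by $2^j$ if $\mathrm{Diff}_j=1$,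 applied to the $(n+2)$-bit word consisting of $M_{small}$ followed by a guard bit $G$ and a round bit $R$, both initially $0$; the bits shifted out of this word are ORed, by chains of binary OR gates, into a sticky bit $S$, initially $0$. The result is $M'_{small},G,R,S$. 5. $\Sigma=M_{large}+M'_{small}$ by an $n$-bit ripple-carry adder, with carry-out $c$. 6. Normalization: $\Sigma_{norm}[n-1]=\mathrm{MUX}(c;1,\Sigma[n-1])$, $\Sigma_{norm}[i]=\mathrm{MUX}(c;\Sigma[i+1],\Sigma[i])$ for $i\le n-2$, $G_{norm}=\mathrm{MUX}(c;\Sigma[0],G)$, $R_{norm}=\mathrm{MUX}(c;G,R)$, $S_{norm}=\mathrm{MUX}(c;R\vee S,S)$; and $E_{out}=E_{large}+c$ by an $m$-bit ripple incrementer. 7. Rounding (to nearest, ties to even): $inc=R_{norm}\wedge(\Sigma_{norm}[0]\vee S_{norm})$; $\Sigma_{rnd}=\Sigma_{norm}+inc$ by an $n$-bit ripple incrementer, with carry-out $\kappa$. 8. Output: $\Sigma_{final}[n-1]=\mathrm{MUX}(\kappa;1,\Sigma_{rnd}[n-1])$, $\Sigma_{final}[i]=\mathrm{MUX}(\kappa;\Sigma_{rnd}[i+1],\Sigma_{rnd}[i])$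 for $i\le n-2$; $E_{final}=E_{out}+\kappa$ by an $m$-bit ripple incrementer. Every gate (binary and multi-input AND/OR, XOR, equality, MUX, three-input XOR and majority in full adders and subtractors) is encoded by its usual (Tseitin) clauses. Let $F_{m,n}$ be the CNF miter formula consisting of the encodings of two copies of this circuit, $L=\mathrm{add}_{m,n}(a,b)$ and $R=\mathrm{add}_{m,n}(b,a)$, with common input variables, clauses defining error variables $e^M_i\leftrightarrow(\Sigma_{final,L}[i]\oplus\Sigma_{final,R}[i])$ $(i<n)$ and $e^E_i\leftrightarrow(E_{final,L}[i]\oplus E_{final,R}[i])$ $(i<m)$, and the clause $\bigvee_{i<n}e^M_i\vee\bigvee_{i<m}e^E_i$. **Theorem (FP Small Proofdoor Theorem).** The family $(F_{m,n})_{m,n\ge1}$ of miter formulas for commutativity of floating-point addition has the following properties. * It admits small proofdoors (in particular every $F_{m,n}$ is unsatisfiable). More precisely, there is a constant $K$ such that for all $m,n\ge1$ the formula $F_{m,n}$ admits a proofdoor with parameters $(c,w,s)$ with $c\le K(m+n)$, $w\le K$ and $s\le K$; that is, $(c,w,s)=(O(m+n),O(1),O(1))$. * The formulas $F_{m,n}$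 have resolution refutations of size polynomial in their number of variables. * The formulas nevertheless have large pathwidth: there is a constant $\kappa_0>0$ such that for all $m,n\ge1$ with $n\le 2^m$ the pathwidth of $F_{m,n}$ is at least $\kappa_0\, n/\log(n+1)$. -/

import Mathlib

namespace FPMiter

/-! ### Clauses, CNF formulas and their semantics -/

/-- A literal: a variable together with a sign (`true` for `x`, `false` for `¬ x`). -/
abbrev Literal (V : Type*) := V × Bool

/-- A clause: a finite set of literals, read as their disjunction. -/
abbrev Clause (V : Type*) := Finset (Literal V)

/-- A CNF formula: a finite set of clauses, read as their conjunction. -/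
abbrev CNF (V : Type*) := Finset (Clause V)

/-- The assignment `σ` satisfies the formula `F`. -/
def Satisfies {V : Type*} (σ : V → Bool) (F : CNF V) : Prop :=
  ∀ C ∈ F, ∃ l ∈ C, σ l.1 = l.2

/-- The formula has no satisfying assignment. -/
def Unsat {V : Type*} (F : CNF V) : Prop :=
  ∀ σ : V → Bool, ¬ Satisfies σ F

/-- `F ⊨ G`. -/
def Entails {V : Type*} (F G : CNF V) : Prop :=
  ∀ σ : V → Bool, Satisfies σ F → Satisfies σ G

/-- The set of variables that occur in `F`. -/
def vars {V : Type*} [DecidableEq V] (F : CNF V) : Finset V :=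
  F.biUnion fun C => C.image Prod.fst

/-- The number of variables that occur in `F`. -/
def numVars {V : Type*} [DecidableEq V] (F : CNF V) : ℕ := (vars F).card

/-! ### Resolution -/

/-- `D` is the resolvent of `C₁` and `C₂` on some variable `x`, with `x ∈ C₁` and `¬ x ∈ C₂`. -/
def IsResolvent {V : Type*} [DecidableEq V] (C₁ C₂ D : Clause V) : Prop :=
  ∃ x : V, (x, true) ∈ C₁ ∧ (x, false) ∈ C₂ ∧
    D = C₁.erase (x, true) ∪ C₂.erase (x, false)

/-- `π` is a resolution refutation of `F`: a sequence of clauses that ends in the empty clause, in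
which every clause is a clause of `F` or a resolvent of two earlier clauses. Its size is the number
of its clauses, `π.length`. -/
def IsRefutation {V : Type*} [DecidableEq V] (F : CNF V) (π : List (Clause V)) : Prop :=
  π.getLast? = some ∅ ∧
    ∀ i : Fin π.length, π.get i ∈ F ∨
      ∃ j k : Fin π.length, j < i ∧ k < i ∧ IsResolvent (π.get j) (π.get k) (π.get i)

/-! ### Pathwidth -/

/-- The bags `B 0, …, B (r - 1)` form a path decomposition of the graph `G`. -/
structure IsPathDecomposition {U : Type*} (G : SimpleGraph U) (r : ℕ) (B : Fin r → Finset U) :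
    Prop where
  cover : ∀ v, ∃ i, v ∈ B i
  edge : ∀ u v, G.Adj u v → ∃ i, u ∈ B i ∧ v ∈ B i
  interval : ∀ v i j k, i ≤ j → j ≤ k → v ∈ B i → v ∈ B k → v ∈ B j

/-- The pathwidth of a finite graph: the least `w` such that some path decomposition has all its
bags of size at most `w + 1`. -/
noncomputable def graphPathwidth {U : Type*} [Finite U] (G : SimpleGraph U) : ℕ :=
  sInf {w : ℕ | ∃ (r : ℕ) (B : Fin r → Finset U),
    IsPathDecomposition G r B ∧ ∀ i, (B i).card ≤ w + 1}

/-- The clause-variable incidence graph of `F`: its vertices are the variables and the clauses of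
`F`, and a variable is adjacent to the clauses in which it occurs. -/
def incidenceGraph {V : Type*} [DecidableEq V] (F : CNF V) :
    SimpleGraph ({x // x ∈ vars F} ⊕ {C // C ∈ F}) where
  Adj u v := match u, v with
    | .inl x, .inr C => ∃ b, (x.1, b) ∈ C.1
    | .inr C, .inl x => ∃ b, (x.1, b) ∈ C.1
    | _, _ => False
  symm := ⟨by rintro (x | C) (y | D) h <;> exact h⟩
  loopless := ⟨by rintro (x | C) h <;> exact h⟩

/-- The pathwidth of a CNF formula, that of its clause-variable incidence graph. -/
noncomputable def pathwidth {V : Type*} [DecidableEq V] (F : CNF V) : ℕ :=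
  graphPathwidth (incidenceGraph F)

/-! ### Proofdoors -/

/-- `I` is a (CNF) interpolant from `A` to `B`. -/
structure IsInterpolant {V : Type*} [DecidableEq V] (A B I : CNF V) : Prop where
  entails : Entails A I
  unsat : Unsat (I ∪ B)
  shared : vars I ⊆ vars A ∩ vars B

/-- The chunks `A 1, …, A k` and the interpolants `I 1, …, I (k - 1)` form a proofdoor decomposition
of the unsatisfiable formula `F`. By convention `I 0` is the empty formula; values of `A` and `I` at
other indices play no role. -/
structure IsProofdoorDecomposition {V : Type*} [DecidableEq V] (F : CNF V) (k : ℕ)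
    (A I : ℕ → CNF V) : Prop where
  unsat : Unsat F
  pos : 1 ≤ k
  union : F = (Finset.Icc 1 k).biUnion A
  disjoint : ∀ i ∈ Finset.Icc 1 k, ∀ j ∈ Finset.Icc 1 k, i ≠ j → Disjoint (A i) (A j)
  init : I 0 = ∅
  interpolant : ∀ j, 1 ≤ j → j < k →
    IsInterpolant (I (j - 1) ∪ A j) ((Finset.Icc (j + 1) k).biUnion A) (I j)

/-- `F` admits a proofdoor with parameters `(c, w, s)`. -/
def AdmitsProofdoor {V : Type*} [DecidableEq V] (F : CNF V) (c w s : ℕ) : Prop :=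
  1 ≤ c ∧ 1 ≤ w ∧ 1 ≤ s ∧
    ∃ (k : ℕ) (A I : ℕ → CNF V), IsProofdoorDecomposition F k A I ∧
      (∀ j, 1 ≤ j → j < k → (I j).card ≤ c) ∧
      (∀ j, 1 ≤ j → j < k → ∀ C ∈ I j, ∃ S ⊆ I (j - 1), S.card ≤ s ∧ Entails (A j ∪ S) {C}) ∧
      (1 < k → (I (k - 1)).card ≤ s) ∧
      (∀ j, 1 ≤ j → j ≤ k → pathwidth (A j) ≤ w)

/-- A family of formulas admits small proofdoors: its members, with `N` variables, have proofdoors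
with `c = O(N)`, `w = O(log N)` and `s = O(log N)`. -/
def AdmitSmallProofdoors {ι V : Type*} [DecidableEq V] (F : ι → CNF V) : Prop :=
  ∃ K : ℝ, ∀ i, ∃ c w s : ℕ, AdmitsProofdoor (F i) c w s ∧
    (c : ℝ) ≤ K * numVars (F i) ∧
    (w : ℝ) ≤ K * Real.log (numVars (F i)) ∧
    (s : ℝ) ≤ K * Real.log (numVars (F i))

/-! ### Clausal encodings of gates -/

section Gates

variable {V : Type*} [DecidableEq V]

/-- The complementary literal. -/
def neg (l : Literal V) : Literal V := (l.1, !l.2)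

/-- The formula with the listed clauses. -/
def ofLists (L : List (List (Literal V))) : CNF V := (L.map List.toFinset).toFinset

/-- `o ↔ ⋀ S`. -/
def andGate (o : Literal V) (S : List (Literal V)) : CNF V :=
  ofLists ((o :: S.map neg) :: S.map fun a => [neg o, a])

/-- `o ↔ ⋁ S`. -/
def orGate (o : Literal V) (S : List (Literal V)) : CNF V :=
  ofLists ((neg o :: S) :: S.map fun a => [o, neg a])

/-- `o ↔ a ⊕ b`. -/
def xorGate (o a b : Literal V) : CNF V :=
  ofLists [[neg o, a, b], [neg o, neg a, neg b], [o, neg a, b], [o, a, neg b]]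

/-- `o ↔ (a ↔ b)`. -/
def eqGate (o a b : Literal V) : CNF V := xorGate (neg o) a b

/-- `o ↔ a ⊕ b ⊕ c`. -/
def xor3Gate (o a b c : Literal V) : CNF V :=
  ofLists [[neg o, a, b, c], [neg o, a, neg b, neg c], [neg o, neg a, b, neg c],
    [neg o, neg a, neg b, c], [o, neg a, neg b, neg c], [o, neg a, b, c], [o, a, neg b, c],
    [o, a, b, neg c]]

/-- `o` is the majority of `a`, `b`, `c`. -/
def majGate (o a b c : Literal V) : CNF V :=
  ofLists [[o, neg a, neg b], [o, neg a, neg c], [o, neg b, neg c],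
    [neg o, a, b], [neg o, a, c], [neg o, b, c]]

/-- `o = MUX(s; t, e)`, that is, `o = t` if `s`, and `o = e` otherwise. -/
def muxGate (o s t e : Literal V) : CNF V :=
  ofLists [[neg s, neg t, o], [neg s, t, neg o], [s, neg e, o], [s, e, neg o]]

/-- `o = MUX(s; 0, e)`. -/
def muxZeroGate (o s e : Literal V) : CNF V :=
  ofLists [[neg s, neg o], [s, neg e, o], [s, e, neg o]]

/-- `o = MUX(s; 1, e)`. -/
def muxOneGate (o s e : Literal V) : CNF V :=
  ofLists [[neg s, o], [s, neg e, o], [s, e, neg o]]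

/-- The unit clause that sets `o` to `b`. -/
def constGate (o : Literal V) (b : Bool) : CNF V := ofLists [[bif b then o else neg o]]

/-- Ripple-carry adder `out = x + y` on `k` bits; `cy 0` is the carry-in, `cy k` the carry-out. -/
def rippleAdder (k : ℕ) (x y cy out : ℕ → Literal V) : CNF V :=
  (Finset.range k).biUnion fun i =>
    xor3Gate (out i) (x i) (y i) (cy i) ∪ majGate (cy (i + 1)) (x i) (y i) (cy i)

/-- Ripple-borrow subtractor `out = x - y` on `k` bits; `bw 0` is the borrow-in, `bw k` the
borrow-out. -/
def rippleSubtractor (k : ℕ) (x y bw out : ℕ → Literal V) : CNF V :=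
  (Finset.range k).biUnion fun i =>
    xor3Gate (out i) (x i) (y i) (bw i) ∪ majGate (bw (i + 1)) (neg (x i)) (y i) (bw i)

/-- Incrementer `out = x + cy 0` on `k` bits, with carry-out `cy k`. -/
def incrementer (k : ℕ) (x cy out : ℕ → Literal V) : CNF V :=
  (Finset.range k).biUnion fun i =>
    xorGate (out i) (x i) (cy i) ∪ andGate (cy (i + 1)) [x i, cy i]

/-- Conditional right shift of a `k`-bit word by one position, filling the top bit with `1`:
`out i = MUX(s; x (i + 1), x i)` for `i + 1 < k`, and `out (k - 1) = MUX(s; 1, x (k - 1))`. -/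
def shiftOne (k : ℕ) (s : Literal V) (x out : ℕ → Literal V) : CNF V :=
  (Finset.range k).biUnion fun i =>
    if i + 1 < k then muxGate (out i) s (x (i + 1)) (x i) else muxOneGate (out i) s (x i)

end Gates

/-! ### The floating-point adder -/

/-- The internal wires of one adder. Bit `0` of a word is its least significant bit. -/
inductive Wire : Type
  /-- exponent comparator -/
  | eqBit (i : ℕ) | pre (i : ℕ) | gtBit (i : ℕ) | ltBit (i : ℕ) | gt | lt | eq
  /-- selected exponents and mantissas -/
  | eLarge (i : ℕ) | eSmall (i : ℕ) | mLarge (i : ℕ) | mSmall (i : ℕ)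
  /-- exponent difference -/
  | borrow (i : ℕ) | diff (i : ℕ)
  /-- alignment: words of the barrel shifter, and the computation of the sticky bit -/
  | align (j i : ℕ) | lost (j i : ℕ) | lostNow (j : ℕ) | sticky (j : ℕ)
  /-- significand addition -/
  | carry (i : ℕ) | sum (i : ℕ)
  /-- normalization -/
  | norm (i : ℕ) | gNorm | rNorm | rOrS | sNorm
  /-- exponent update -/
  | outCarry (i : ℕ) | eOut (i : ℕ)
  /-- rounding -/
  | lsbOrS | inc | rndCarry (i : ℕ) | rnd (i : ℕ)
  /-- final shift and exponent update -/
  | mFinal (i : ℕ) | finCarry (i : ℕ) | eFinal (i : ℕ)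
  deriving DecidableEq

/-- The variables of the miter: exponent and mantissa bits of the inputs `a` and `b`, the internal
wires of the left copy (`wire false`) and the right copy (`wire true`) of the adder, and the error
bits of the outputs. -/
inductive Var : Type
  | ea (i : ℕ) | eb (i : ℕ) | ma (i : ℕ) | mb (i : ℕ)
  | wire (side : Bool) (w : Wire)
  | errE (i : ℕ) | errM (i : ℕ)
  deriving DecidableEq

/-- Bit `i` of the word of the barrel shifter before stage `j`. The word has two bits below the
mantissa: bit `0` is the round bit, bit `1` the guard bit, and bit `i + 2` is mantissa bit `i`; the
mantissa bits of the word before stage `0` are those of the smaller operand. -/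
def alignBit : ℕ → ℕ → Wire
  | 0, i + 2 => .mSmall i
  | j, i => .align j i

/-- The carry chain of the first exponent update: its carry-in is the carry-out of the significand
addition. -/
def outCarryBit (n : ℕ) : ℕ → Wire
  | 0 => .carry n
  | i + 1 => .outCarry (i + 1)

/-- The carry chain of the rounding incrementer: its carry-in is the rounding increment. -/
def rndCarryBit : ℕ → Wire
  | 0 => .inc
  | i + 1 => .rndCarry (i + 1)

/-- The carry chain of the final exponent update: its carry-in is the carry-out of the rounding
incrementer. -/
def finCarryBit (n : ℕ) : ℕ → Wire
  | 0 => rndCarryBit n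
  | i + 1 => .finCarry (i + 1)

section Adder

/-- The literal `x`. -/
def lit (x : Var) : Literal Var := (x, true)

/-! The parameters: `m` exponent bits, `n` mantissa bits, a naming `v` of the wires, the exponents
`x`, `y` and the mantissas `p`, `q` of the first and the second operand. -/

variable (m n : ℕ) (v : Wire → Literal Var) (x y p q : ℕ → Literal Var)

/-- Exponent comparison. -/
def comparator : CNF Var :=
  ((Finset.range m).biUnion fun i =>
    eqGate (v (.eqBit i)) (x i) (y i) ∪
    (if i + 1 < m then andGate (v (.pre i)) [v (.pre (i + 1)), v (.eqBit (i + 1))]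
      else constGate (v (.pre i)) true) ∪
    andGate (v (.gtBit i)) [v (.pre i), x i, neg (y i)] ∪
    andGate (v (.ltBit i)) [v (.pre i), neg (x i), y i]) ∪
  orGate (v .gt) ((List.range m).map fun i => v (.gtBit i)) ∪
  orGate (v .lt) ((List.range m).map fun i => v (.ltBit i)) ∪
  andGate (v .eq) ((List.range m).map fun i => v (.eqBit i))

/-- Selection of the larger and the smaller exponent and of the corresponding mantissas. -/
def selection : CNF Var :=
  ((Finset.range m).biUnion fun i =>
    muxGate (v (.eLarge i)) (v .gt) (x i) (y i) ∪ muxGate (v (.eSmall i)) (v .lt) (x i) (y i)) ∪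
  (Finset.range n).biUnion fun i =>
    muxGate (v (.mLarge i)) (v .gt) (p i) (q i) ∪ muxGate (v (.mSmall i)) (v .gt) (q i) (p i)

/-- Exponent difference. -/
def difference : CNF Var :=
  constGate (v (.borrow 0)) false ∪
  rippleSubtractor m (fun i => v (.eLarge i)) (fun i => v (.eSmall i)) (fun i => v (.borrow i))
    (fun i => v (.diff i))

/-- Stage `j` of the barrel shifter: a right shift by `2 ^ j` positions if bit `j` of the exponent
difference is set. The bits that are shifted out of the word are accumulated in the sticky bit. -/
def alignStage (j : ℕ) : CNF Var :=
  ((Finset.range (n + 2)).biUnion fun i =>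
    if i + 2 ^ j < n + 2 then
      muxGate (v (alignBit (j + 1) i)) (v (.diff j)) (v (alignBit j (i + 2 ^ j))) (v (alignBit j i))
    else muxZeroGate (v (alignBit (j + 1) i)) (v (.diff j)) (v (alignBit j i))) ∪
  constGate (v (.lost j 0)) false ∪
  ((Finset.range (min (2 ^ j) (n + 2))).biUnion fun i =>
    orGate (v (.lost j (i + 1))) [v (.lost j i), v (alignBit j i)]) ∪
  andGate (v (.lostNow j)) [v (.diff j), v (.lost j (min (2 ^ j) (n + 2)))] ∪
  orGate (v (.sticky (j + 1))) [v (.sticky j), v (.lostNow j)]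

/-- Alignment of the smaller mantissa, with guard, round and sticky bits. -/
def alignment : CNF Var :=
  constGate (v (alignBit 0 0)) false ∪ constGate (v (alignBit 0 1)) false ∪
  constGate (v (.sticky 0)) false ∪
  (Finset.range m).biUnion fun j => alignStage n v j

/-- Significand addition. The guard, round and sticky bits of the larger operand are zero, so those
of the sum are the ones produced by the alignment. -/
def significandAddition : CNF Var :=
  constGate (v (.carry 0)) false ∪
  rippleAdder n (fun i => v (.mLarge i)) (fun i => v (alignBit m (i + 2))) (fun i => v (.carry i))
    (fun i => v (.sum i))

/-- Normalization, controlled by the carry-out of the significand addition. -/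
def normalization : CNF Var :=
  shiftOne n (v (.carry n)) (fun i => v (.sum i)) (fun i => v (.norm i)) ∪
  muxGate (v .gNorm) (v (.carry n)) (v (.sum 0)) (v (alignBit m 1)) ∪
  muxGate (v .rNorm) (v (.carry n)) (v (alignBit m 1)) (v (alignBit m 0)) ∪
  orGate (v .rOrS) [v (alignBit m 0), v (.sticky m)] ∪
  muxGate (v .sNorm) (v (.carry n)) (v .rOrS) (v (.sticky m))

/-- Exponent update after normalization. -/
def exponentUpdate : CNF Var :=
  incrementer m (fun i => v (.eLarge i)) (fun i => v (outCarryBit n i)) (fun i => v (.eOut i))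

/-- Rounding to nearest, ties to even. -/
def rounding : CNF Var :=
  orGate (v .lsbOrS) [v (.norm 0), v .sNorm] ∪
  andGate (v .inc) [v .rNorm, v .lsbOrS] ∪
  incrementer n (fun i => v (.norm i)) (fun i => v (rndCarryBit i)) (fun i => v (.rnd i))

/-- Final conditional shift and final exponent update, controlled by the carry-out of the rounding
incrementer. -/
def finalShift : CNF Var :=
  shiftOne n (v (rndCarryBit n)) (fun i => v (.rnd i)) (fun i => v (.mFinal i)) ∪
  incrementer m (fun i => v (.eOut i)) (fun i => v (finCarryBit n i)) (fun i => v (.eFinal i))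

/-- The encoding of the floating-point adder; its outputs are the words `mFinal` and `eFinal`. -/
def fpAdder : CNF Var :=
  comparator m v x y ∪ selection m n v x y p q ∪ difference m v ∪ alignment m n v ∪
  significandAddition m n v ∪ normalization m n v ∪ exponentUpdate m n v ∪ rounding n v ∪
  finalShift m n v

end Adder

/-- The error bits of the outputs and the clause that asserts that some output bit differs. -/
def disagreement (m n : ℕ) : CNF Var :=
  ((Finset.range n).biUnion fun i => xorGate (lit (.errM i))
    (lit (.wire false (.mFinal i))) (lit (.wire true (.mFinal i)))) ∪
  ((Finset.range m).biUnion fun i => xorGate (lit (.errE i))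
    (lit (.wire false (.eFinal i))) (lit (.wire true (.eFinal i)))) ∪
  {(Finset.range n).image (fun i => lit (.errM i)) ∪
    (Finset.range m).image (fun i => lit (.errE i))}

/-- The miter for commutativity of floating-point addition with `m` exponent bits and `n` mantissa
bits: the adders for `a + b` (left) and `b + a` (right) on common inputs disagree in some output
bit. -/
def commMiter (m n : ℕ) : CNF Var :=
  fpAdder m n (fun w => lit (.wire false w))
    (fun i => lit (.ea i)) (fun i => lit (.eb i)) (fun i => lit (.ma i)) (fun i => lit (.mb i)) ∪
  fpAdder m n (fun w => lit (.wire true w))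
    (fun i => lit (.eb i)) (fun i => lit (.ea i)) (fun i => lit (.mb i)) (fun i => lit (.ma i)) ∪
  disagreement m n

end FPMiter

/-!
Commutativity of the floating-point adder has a proof that reads the circuit gate by gate and
remembers little. The clauses of the miter are cut into chunks of bounded size, `chunk`, which are
read in the order `rank` of the computation, both copies of the adder in parallel. From each chunk
boundedly many `facts` are derived, each from the chunk and boundedly many earlier facts.

* While the exponents are compared, the wide clauses that define `gt` and `lt` are shortened bit by
  bit, until `gt` in one copy is known to be `lt` in the other, and not both to hold (`step_cmp`).
* If the exponents differ, the two copies select the same operand as the larger one, and all wires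
  agree from then on. If they are equal, the copies select different mantissas, but the exponent
  difference is zero, so that the barrel shifter moves nothing, and the two copies add the same two
  mantissas in opposite order. Facts about the alignment carry this case distinction as literals on
  `gt`; after the significand addition all wires agree unconditionally.
* Finally the agreement of the outputs removes the literals of the disagreement clause one by one.

`IsLocalRefutation` isolates what is needed of such a proof. The interpolant after a chunk consists
of the facts known so far all of whose variables occur later. Words of the barrel shifter die one
stage after they are computed, so that only `O(m + n)` facts are alive at any time, although the
formula has about `m * n` chunks (`card_liveFacts_le`). This gives the proofdoors, by
`IsLocalRefutation.admitsProofdoor`; a chunk with boundedly many clauses has bounded pathwidth. The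
inferences also mention boundedly many variables besides those of the derived clause; therefore
branching on these variables simulates an inference by boundedly many resolution steps, which gives
the short refutations, by `IsLocalRefutation.exists_isRefutation`.

The lower bound for the pathwidth uses the left barrel shifter only. If `2 ^ (J + 1) ≤ n`, its first
`J + 1` stages contain, for each position `x` in the upper half of a word of `2 ^ (J + 1)` bits and
each `y` in the lower half, the path in the incidence graph that a bit takes from `x` to `y` when
the word is shifted by `x - y`. Paths for the same distance are disjoint, so each vertex lies on at
most `2 ^ (J + 1)` of these paths. In a path decomposition, the bag up to which half of the sources
`x` have occurred meets a constant fraction of the `4 ^ J` paths, hence has at least a constant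
times `2 ^ J` vertices (`card_mul_card_le_of_routing`). The bound obtained is linear in `n`.
-/

namespace FPMiter

/-! ### Resolution derivations -/

section Resolution

variable {V : Type*}

/-- Some clause of `π` subsumes `C`. -/
def Subsumes (π : List (Clause V)) (C : Clause V) : Prop := ∃ D ∈ π, D ⊆ C

/-- The clause contains a variable together with its negation. -/
def IsTaut (C : Clause V) : Prop := ∃ x, (x, true) ∈ C ∧ (x, false) ∈ C

lemma Subsumes.mono {π ρ : List (Clause V)} {C : Clause V} (h : Subsumes π C) (hπ : π ⊆ ρ) :
    Subsumes ρ C := by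
  obtain ⟨D, hD, hDC⟩ := h
  exact ⟨D, hπ hD, hDC⟩

variable [DecidableEq V]

/-- The variables of a clause. -/
def clauseVars (C : Clause V) : Finset V := C.image Prod.fst

/-- A resolution derivation from `F`: every clause is a clause of `F` or a resolvent of two earlier
clauses. -/
def IsDerivation (F : CNF V) (π : List (Clause V)) : Prop :=
  ∀ i : Fin π.length, π.get i ∈ F ∨
    ∃ j k : Fin π.length, j < i ∧ k < i ∧ IsResolvent (π.get j) (π.get k) (π.get i)

lemma isDerivation_nil (F : CNF V) : IsDerivation F [] := fun i => i.elim0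

lemma IsDerivation.snoc {F : CNF V} {π : List (Clause V)} (h : IsDerivation F π) {C : Clause V}
    (hC : C ∈ F ∨ ∃ C₁ ∈ π, ∃ C₂ ∈ π, IsResolvent C₁ C₂ C) : IsDerivation F (π ++ [C]) := by
  have key : ∀ i (hi : i < (π ++ [C]).length), (π ++ [C])[i] ∈ F ∨
      ∃ j k, ∃ (hj : j < (π ++ [C]).length) (hk : k < (π ++ [C]).length), j < i ∧ k < i ∧
        IsResolvent (π ++ [C])[j] (π ++ [C])[k] (π ++ [C])[i] := by
    intro i hi
    rcases Nat.lt_or_ge i π.length with hlt | hge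
    · rcases h ⟨i, hlt⟩ with h1 | ⟨j, k, hj, hk, hr⟩
      · left; simpa [List.getElem_append_left hlt] using h1
      · right
        refine ⟨j, k, by rw [List.length_append]; exact Nat.lt_add_right _ j.2,
          by rw [List.length_append]; exact Nat.lt_add_right _ k.2, hj, hk, ?_⟩
        simpa [List.getElem_append_left hlt, List.getElem_append_left j.2,
          List.getElem_append_left k.2] using hr
    · have hi' : i = π.length := by simp at hi; omega
      subst hi'
      rcases hC with h1 | ⟨C₁, h1, C₂, h2, hr⟩
      · left; simpa using h1
      · right
        obtain ⟨j, hj, rfl⟩ := List.getElem_of_mem h1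
        obtain ⟨k, hk, rfl⟩ := List.getElem_of_mem h2
        refine ⟨j, k, by simp; omega, by simp; omega, hj, hk, ?_⟩
        simpa [List.getElem_append_left hj, List.getElem_append_left hk] using hr
  intro i
  rcases key i i.2 with h1 | ⟨j, k, hj, hk, hji, hki, hr⟩
  · exact Or.inl h1
  · exact Or.inr ⟨⟨j, hj⟩, ⟨k, hk⟩, hji, hki, hr⟩

/-- A derivation that contains the empty clause yields a refutation. -/
lemma IsDerivation.isRefutation {F : CNF V} {π : List (Clause V)} (h : IsDerivation F π)
    (h0 : ∅ ∈ π) : IsRefutation F (π ++ [∅]) := by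
  refine ⟨by simp, h.snoc ?_⟩
  obtain ⟨i, hi, h0⟩ := List.getElem_of_mem h0
  rcases h ⟨i, hi⟩ with h1 | ⟨j, k, -, -, hr⟩
  · left; simpa [h0] using h1
  · right
    refine ⟨_, π.get_mem j, _, π.get_mem k, ?_⟩
    simpa [h0] using hr

/-- All clauses of a formula can be listed first. -/
lemma exists_isDerivation_subset (F G : CNF V) (hG : G ⊆ F) :
    ∃ π, IsDerivation F π ∧ π.length = G.card ∧ ∀ C ∈ G, C ∈ π := by
  induction G using Finset.induction_on with
  | empty => exact ⟨[], isDerivation_nil F, rfl, by simp⟩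
  | insert C G hC ih =>
    obtain ⟨π, h1, h2, h3⟩ := ih fun D hD => hG (Finset.mem_insert_of_mem hD)
    refine ⟨π ++ [C], h1.snoc (Or.inl (hG (Finset.mem_insert_self _ _))), ?_, ?_⟩
    · simp [h2, Finset.card_insert_of_notMem hC]
    · intro D hD
      rcases Finset.mem_insert.1 hD with rfl | hD
      · simp
      · simp [h3 D hD]

/-- Implicational completeness of resolution, with the size bound given by branching on the
variables outside the clause to be derived. The weakening rule is not available, so that only a
subclause is derived, and tautological clauses play no role. -/
lemma exists_isDerivation_of_entails {F S : CNF V} {X : Finset V} :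
    ∀ {C : Clause V} {π : List (Clause V)}, IsDerivation F π →
      (∀ D ∈ S, ¬ IsTaut D → Subsumes π D) → Entails S {C} → ¬ IsTaut C →
      vars S ⊆ clauseVars C ∪ X →
      ∃ ρ, IsDerivation F ρ ∧ π ⊆ ρ ∧ ρ.length + 1 ≤ π.length + 2 ^ X.card ∧ Subsumes ρ C := by
  classical
  induction X using Finset.induction_on with
  | empty =>
    intro C π hπ hS hent hC hvars
    -- the assignment that falsifies `C`
    let σ : V → Bool := fun x => decide ((x, false) ∈ C)
    have hσ : ∀ l ∈ C, σ l.1 ≠ l.2 := by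
      rintro ⟨x, b⟩ hl
      cases b
      · simpa [σ] using hl
      · have : (x, false) ∉ C := fun h => hC ⟨x, hl, h⟩
        simp [σ, this]
    have hns : ¬ Satisfies σ S := by
      intro h
      obtain ⟨l, hl, hl'⟩ := hent σ h C (by simp)
      exact hσ l hl hl'
    simp only [Satisfies, not_forall] at hns
    obtain ⟨D, hD, hDσ⟩ := hns
    push Not at hDσ
    have hDC : D ⊆ C := by
      rintro ⟨x, b⟩ hl
      have hx : x ∈ clauseVars C := by
        have : x ∈ vars S := Finset.mem_biUnion.2 ⟨D, hD, Finset.mem_image.2 ⟨_, hl, rfl⟩⟩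
        simpa using hvars this
      obtain ⟨⟨y, b'⟩, hl', rfl⟩ := Finset.mem_image.1 hx
      have h1 := hDσ _ hl
      have h2 := hσ _ hl'
      have : b = b' := by
        revert h1 h2; simp only; cases σ y <;> cases b <;> cases b' <;> simp
      exact this ▸ hl'
    have hDt : ¬ IsTaut D := fun ⟨x, h1, h2⟩ => hC ⟨x, hDC h1, hDC h2⟩
    obtain ⟨E, hE, hED⟩ := hS D hD hDt
    exact ⟨π, hπ, fun _ h => h, by simp, E, hE, hED.trans hDC⟩
  | insert x X hx ih =>
    intro C π hπ hS hent hC hvars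
    have h2 : 2 ^ (insert x X).card = 2 ^ X.card + 2 ^ X.card := by
      rw [Finset.card_insert_of_notMem hx, pow_succ]; ring
    have h2' : 0 < 2 ^ X.card := Nat.two_pow_pos _
    by_cases hxC : x ∈ clauseVars C
    · obtain ⟨ρ, h1, h3, h4, h5⟩ := ih hπ hS hent hC (by
        intro y hy
        rcases Finset.mem_union.1 (hvars hy) with h | h
        · exact Finset.mem_union_left _ h
        · rcases Finset.mem_insert.1 h with rfl | h
          · exact Finset.mem_union_left _ hxC
          · exact Finset.mem_union_right _ h)
      exact ⟨ρ, h1, h3, by omega, h5⟩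
    · have hxb : ∀ b, (x, b) ∉ C := fun b hb => hxC (Finset.mem_image.2 ⟨_, hb, rfl⟩)
      have hent' : ∀ b, Entails S {insert (x, b) C} := by
        intro b σ h D hD
        obtain ⟨l, hl, hl'⟩ := hent σ h C (by simp)
        rw [Finset.mem_singleton.1 hD]
        exact ⟨l, Finset.mem_insert_of_mem hl, hl'⟩
      have htaut' : ∀ b, ¬ IsTaut (insert (x, b) C) := by
        rintro b ⟨y, h1, h2⟩
        simp only [Finset.mem_insert, Prod.mk.injEq] at h1 h2
        rcases h1 with ⟨rfl, rfl⟩ | h1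
        · rcases h2 with ⟨-, h⟩ | h2
          · cases h
          · exact hxb _ h2
        · rcases h2 with ⟨rfl, -⟩ | h2
          · exact hxb _ h1
          · exact hC ⟨y, h1, h2⟩
      have hvars' : ∀ b, vars S ⊆ clauseVars (insert (x, b) C) ∪ X := by
        intro b y hy
        have := hvars hy
        simp only [clauseVars, Finset.image_insert, Finset.mem_union, Finset.mem_insert] at this ⊢
        tauto
      obtain ⟨ρ, r1, r2, r3, E, hE, hEC⟩ := ih hπ hS (hent' true) (htaut' true) (hvars' true)
      obtain ⟨ρ', s1, s2, s3, E', hE', hEC'⟩ := ih r1 (fun D hD hDt => (hS D hD hDt).mono r2)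
        (hent' false) (htaut' false) (hvars' false)
      by_cases hxE : (x, true) ∈ E
      · by_cases hxE' : (x, false) ∈ E'
        · refine ⟨ρ' ++ [E.erase (x, true) ∪ E'.erase (x, false)],
            s1.snoc (Or.inr ⟨E, s2 hE, E', hE', x, hxE, hxE', rfl⟩), ?_, ?_, _,
            List.mem_append_right _ (List.mem_singleton.2 rfl), ?_⟩
          · exact fun D hD => List.mem_append_left _ (s2 (r2 hD))
          · simp only [List.length_append, List.length_singleton]; omega
          · intro l hl
            simp only [Finset.mem_union, Finset.mem_erase] at hl
            rcases hl with ⟨h, hl⟩ | ⟨h, hl⟩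
            · exact (Finset.mem_insert.1 (hEC hl)).resolve_left h
            · exact (Finset.mem_insert.1 (hEC' hl)).resolve_left h
        · exact ⟨ρ', s1, fun D hD => s2 (r2 hD), by omega, E', hE', fun l hl =>
            (Finset.mem_insert.1 (hEC' hl)).resolve_left (fun h => hxE' (h ▸ hl))⟩
      · exact ⟨ρ, r1, r2, by omega, E, hE, fun l hl =>
          (Finset.mem_insert.1 (hEC hl)).resolve_left (fun h => hxE (h ▸ hl))⟩

end Resolution

/-! ### An upper bound for the pathwidth -/

section Pathwidth

variable {V : Type*} [DecidableEq V]

/-- The pathwidth is at most the number of clauses: every bag contains all of them, and the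
variables are visited one at a time. -/
lemma pathwidth_le_card (F : CNF V) : pathwidth F ≤ F.card := by
  classical
  apply Nat.sInf_le
  let r := (vars F).card
  let e := (vars F).equivFin
  let cl : Finset ({x // x ∈ vars F} ⊕ {C // C ∈ F}) := Finset.univ.image Sum.inr
  refine ⟨r + 1, fun i => cl ∪ (if h : (i : ℕ) < r then {Sum.inl (e.symm ⟨i, h⟩)} else ∅), ?_, ?_⟩
  · have hv : ∀ x : {x // x ∈ vars F}, (Sum.inl x : _ ⊕ {C // C ∈ F}) ∈ cl ∪
        (if h : ((Fin.castSucc (e x) : Fin (r + 1)) : ℕ) < r then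
          {Sum.inl (e.symm ⟨(Fin.castSucc (e x) : Fin (r + 1)), h⟩)} else ∅) := by
      intro x
      have : ((Fin.castSucc (e x) : Fin (r + 1)) : ℕ) < r := (e x).2
      rw [dif_pos this]
      simp
    have hc : ∀ C : {C // C ∈ F}, (Sum.inr C : {x // x ∈ vars F} ⊕ _) ∈ cl := by
      intro C; simp [cl]
    refine ⟨?_, ?_, ?_⟩
    · rintro (x | C)
      · exact ⟨_, hv x⟩
      · exact ⟨0, Finset.mem_union_left _ (hc C)⟩
    · rintro (x | C) (y | D) hadj
      · exact hadj.elim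
      · exact ⟨_, hv x, Finset.mem_union_left _ (hc D)⟩
      · exact ⟨_, Finset.mem_union_left _ (hc C), hv y⟩
      · exact hadj.elim
    · rintro (x | C) i j k hij hjk hi hk
      · have key : ∀ i : Fin (r + 1), (Sum.inl x : _ ⊕ {C // C ∈ F}) ∈ cl ∪
            (if h : (i : ℕ) < r then {Sum.inl (e.symm ⟨i, h⟩)} else ∅) → (i : ℕ) = e x := by
          intro i hi
          rcases Finset.mem_union.1 hi with hi | hi
          · simp [cl] at hi
          · split_ifs at hi with h
            · have : x = e.symm ⟨i, h⟩ := by simpa using hi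
              rw [this]; simp
            · simp at hi
        have h1 := key i hi
        have h2 := key k hk
        have : j = i := by
          apply Fin.ext
          have : (i : ℕ) ≤ j := hij
          have : (j : ℕ) ≤ k := hjk
          omega
        rw [this]; exact hi
      · exact Finset.mem_union_left _ (hc C)
  · intro i
    refine (Finset.card_union_le _ _).trans (add_le_add ?_ ?_)
    · exact Finset.card_image_le.trans (by simp)
    · split_ifs <;> simp

end Pathwidth

/-! ### Local refutations -/

section LocalRefutation

variable {V : Type*} [DecidableEq V] {κ : Type*} {α : Type*} [LinearOrder α]

lemma mem_vars {F : CNF V} {x : V} : x ∈ vars F ↔ ∃ C ∈ F, x ∈ clauseVars C := by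
  simp [vars, clauseVars]

lemma clauseVars_subset_vars {F : CNF V} {C : Clause V} (h : C ∈ F) : clauseVars C ⊆ vars F :=
  fun _ hx => mem_vars.2 ⟨C, h, hx⟩

lemma vars_union (F G : CNF V) : vars (F ∪ G) = vars F ∪ vars G := by
  simp [vars, Finset.union_biUnion]

lemma satisfies_union {σ : V → Bool} {F G : CNF V} :
    Satisfies σ (F ∪ G) ↔ Satisfies σ F ∧ Satisfies σ G := by
  simp only [Satisfies, Finset.mem_union]
  exact ⟨fun h => ⟨fun C hC => h C (Or.inl hC), fun C hC => h C (Or.inr hC)⟩,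
    fun h C hC => hC.elim (h.1 C) (h.2 C)⟩

/-- The variable `x` occurs in the chunk of `u` or in a later one. -/
def Alive (T : Finset κ) (rank : κ → α) (A : κ → CNF V) (u : κ) (x : V) : Prop :=
  ∃ v ∈ T, rank u ≤ rank v ∧ x ∈ vars (A v)

/-- The clauses of `S` have been derived before time `u`, and none of their variables has
disappeared yet. -/
def Available (T : Finset κ) (rank : κ → α) (A B : κ → CNF V) (u : κ) (S : CNF V) : Prop :=
  (∀ D ∈ S, ∃ t ∈ T, rank t < rank u ∧ D ∈ B t) ∧ ∀ x ∈ vars S, Alive T rank A u x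

/-- A local inference of the clause `C` at time `u`: it uses the chunk of `u` and at most `s`
available clauses, and these mention at most `b` variables outside `C`. The variables of `C` occur
in the chunk of `u` or in available clauses. -/
def LocalStep (T : Finset κ) (rank : κ → α) (A B : κ → CNF V) (s b : ℕ) (u : κ)
    (C : Clause V) : Prop :=
  ∃ S : CNF V, S.card ≤ s ∧ Available T rank A B u S ∧ Entails (A u ∪ S) {C} ∧
    (∃ S', Available T rank A B u S' ∧ clauseVars C ⊆ vars (A u ∪ S')) ∧
    (vars (A u ∪ S) \ clauseVars C).card ≤ b

/-- A local refutation of `F`: the clauses of `F` are partitioned into chunks `A u`, read in the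
order of `rank`, and each chunk contributes the clauses `B u`, inferred locally; the last chunk
contributes the empty clause. Proofdoors and short resolution refutations both arise in this way. -/
structure IsLocalRefutation (F : CNF V) (T : Finset κ) (rank : κ → α) (A B : κ → CNF V)
    (last : κ) (s b : ℕ) : Prop where
  cover : ∀ C, C ∈ F ↔ ∃ u ∈ T, C ∈ A u
  disjoint : ∀ u ∈ T, ∀ v ∈ T, u ≠ v → Disjoint (A u) (A v)
  rank_inj : ∀ u ∈ T, ∀ v ∈ T, rank u = rank v → u = v
  card_chunk : ∀ u ∈ T, (A u).card ≤ s
  card_facts : ∀ u ∈ T, (B u).card ≤ s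
  step : ∀ u ∈ T, ∀ C ∈ B u, C ∈ A u ∨ LocalStep T rank A B s b u C
  last_mem : last ∈ T
  le_last : ∀ u ∈ T, rank u ≤ rank last
  empty_mem : ∅ ∈ B last
  card_vars_last : (vars (A last)).card ≤ b

/-- A finite set with an injective rank function can be listed in increasing order. -/
lemma exists_enumeration {T : Finset κ} {rank : κ → α}
    (h : ∀ u ∈ T, ∀ v ∈ T, rank u = rank v → u = v) (hT : T.Nonempty) :
    ∃ g : ℕ → κ, (∀ j, 1 ≤ j → j ≤ T.card → g j ∈ T) ∧
      (∀ u ∈ T, ∃ j, 1 ≤ j ∧ j ≤ T.card ∧ g j = u) ∧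
      (∀ i j, 1 ≤ i → i < j → j ≤ T.card → rank (g i) < rank (g j)) := by
  classical
  have hcard : (T.image rank).card = T.card :=
    Finset.card_image_of_injOn fun u hu v hv => h u hu v hv
  let o := (T.image rank).orderEmbOfFin hcard
  have ho : ∀ i, ∃ u ∈ T, rank u = o i := fun i =>
    Finset.mem_image.1 ((T.image rank).orderEmbOfFin_mem hcard i)
  choose f hf hfo using ho
  obtain ⟨u₀, hu₀⟩ := hT
  refine ⟨fun j => if hj : 1 ≤ j ∧ j ≤ T.card then f ⟨j - 1, by omega⟩ else u₀, ?_, ?_, ?_⟩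
  · intro j h1 h2
    simp only [h1, h2, and_self, dif_pos]
    exact hf _
  · intro u hu
    have : rank u ∈ Set.range o := by
      rw [Finset.range_orderEmbOfFin]; exact Finset.mem_coe.2 (Finset.mem_image_of_mem _ hu)
    obtain ⟨i, hi⟩ := this
    refine ⟨i + 1, by omega, by omega, ?_⟩
    have h1 : 1 ≤ (i : ℕ) + 1 ∧ (i : ℕ) + 1 ≤ T.card := ⟨by omega, by omega⟩
    simp only [dif_pos h1]
    exact h _ (hf _) _ hu (by rw [hfo, ← hi]; rfl)
  · intro i j hi hij hj
    have h1 : 1 ≤ i ∧ i ≤ T.card := ⟨hi, by omega⟩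
    have h2 : 1 ≤ j ∧ j ≤ T.card := ⟨by omega, hj⟩
    simp only [dif_pos h1, dif_pos h2, hfo]
    exact o.strictMono (by simp [Fin.lt_def]; omega)

/-- The clauses known after time `u` whose variables all occur in later chunks. -/
noncomputable def liveFacts [DecidableEq κ] (T : Finset κ) (rank : κ → α) (A B : κ → CNF V)
    (u : κ) : CNF V :=
  open Classical in
  ((T.filter fun t => rank t ≤ rank u).biUnion B).filter fun C =>
    ∀ x ∈ clauseVars C, ∃ v ∈ T, rank u < rank v ∧ x ∈ vars (A v)

variable {F : CNF V} {T : Finset κ} {rank : κ → α} {A B : κ → CNF V} {last : κ} {s b : ℕ}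

lemma mem_liveFacts [DecidableEq κ] {u : κ} {C : Clause V} : C ∈ liveFacts T rank A B u ↔
    (∃ t ∈ T, rank t ≤ rank u ∧ C ∈ B t) ∧
      ∀ x ∈ clauseVars C, ∃ v ∈ T, rank u < rank v ∧ x ∈ vars (A v) := by
  simp only [liveFacts, Finset.mem_filter, Finset.mem_biUnion]
  exact and_congr_left' ⟨fun ⟨t, h, hC⟩ => ⟨t, h.1, h.2, hC⟩,
    fun ⟨t, h, h', hC⟩ => ⟨t, ⟨h, h'⟩, hC⟩⟩

lemma pos_of_isLocalRefutation (h : IsLocalRefutation F T rank A B last s b) : 1 ≤ s :=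
  (Nat.succ_le_of_lt (Finset.card_pos.2 ⟨_, h.empty_mem⟩)).trans (h.card_facts _ h.last_mem)

/-- A short resolution refutation from a local one: all clauses of `F` are listed, and then each
inference is simulated by branching on the at most `b` variables outside its conclusion. -/
theorem IsLocalRefutation.exists_isRefutation [DecidableEq κ]
    (h : IsLocalRefutation F T rank A B last s b) :
    ∃ π, IsRefutation F π ∧ π.length ≤ T.card * s + T.card * s * 2 ^ b + 1 := by
  obtain ⟨g, hgT, hgs, hgm⟩ := exists_enumeration h.rank_inj ⟨_, h.last_mem⟩
  have hF : F.card ≤ T.card * s := by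
    have : F = T.biUnion A := by ext C; simp [h.cover]
    rw [this]
    exact Finset.card_biUnion_le_card_mul _ _ _ h.card_chunk
  have main : ∀ k, k ≤ T.card → ∃ π, IsDerivation F π ∧ (∀ C ∈ F, C ∈ π) ∧
      (∀ j, 1 ≤ j → j ≤ k → ∀ C ∈ B (g j), ¬ IsTaut C → Subsumes π C) ∧
      π.length ≤ F.card + k * s * 2 ^ b := by
    intro k
    induction k with
    | zero =>
      intro _
      obtain ⟨π, h1, h2, h3⟩ := exists_isDerivation_subset F F subset_rfl
      exact ⟨π, h1, h3, fun j h1 h2 => by omega, by omega⟩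
    | succ k ih =>
      intro hk
      obtain ⟨π, h1, h2, h3, h4⟩ := ih (by omega)
      have inner : ∀ Q ⊆ B (g (k + 1)), ∃ ρ, IsDerivation F ρ ∧ π ⊆ ρ ∧
          (∀ C ∈ Q, ¬ IsTaut C → Subsumes ρ C) ∧ ρ.length ≤ π.length + Q.card * 2 ^ b := by
        intro Q
        induction Q using Finset.induction_on with
        | empty => exact fun _ => ⟨π, h1, fun _ h => h, by simp, by simp⟩
        | insert C Q hC ihQ =>
          intro hQ
          obtain ⟨ρ, r1, r2, r3, r4⟩ := ihQ fun D hD => hQ (Finset.mem_insert_of_mem hD)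
          rw [Finset.card_insert_of_notMem hC]
          by_cases hCt : IsTaut C
          · refine ⟨ρ, r1, r2, ?_, by nlinarith [Nat.two_pow_pos b]⟩
            intro D hD hDt
            rcases Finset.mem_insert.1 hD with rfl | hD
            · exact absurd hCt hDt
            · exact r3 D hD hDt
          have hu := hgT (k + 1) (by omega) hk
          rcases h.step _ hu C (hQ (Finset.mem_insert_self _ _)) with
            hCA | ⟨S, -, ⟨hS, -⟩, hent, -, hb⟩
          · refine ⟨ρ, r1, r2, ?_, by nlinarith [Nat.two_pow_pos b]⟩
            intro D hD hDt
            rcases Finset.mem_insert.1 hD with rfl | hD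
            · exact ⟨D, r2 (h2 D ((h.cover D).2 ⟨_, hu, hCA⟩)), subset_rfl⟩
            · exact r3 D hD hDt
          · obtain ⟨ρ', s1, s2, s3, s4⟩ := exists_isDerivation_of_entails
              (X := vars (A (g (k + 1)) ∪ S) \ clauseVars C) r1 (S := A (g (k + 1)) ∪ S) (by
                intro D hD hDt
                rcases Finset.mem_union.1 hD with hD | hD
                · exact ⟨D, r2 (h2 D ((h.cover D).2 ⟨_, hu, hD⟩)), subset_rfl⟩
                · obtain ⟨t, ht, htu, hDt'⟩ := hS D hD
                  obtain ⟨j, hj1, hj2, rfl⟩ := hgs t ht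
                  have hjk : j ≤ k := by
                    by_contra hjk
                    rcases (show k + 1 = j ∨ k + 1 < j by omega) with rfl | hlt
                    · exact lt_irrefl _ htu
                    · exact lt_asymm htu (hgm _ _ (by omega) hlt hj2)
                  exact (h3 j hj1 hjk D hDt' hDt).mono r2) hent hCt (by simp)
            refine ⟨ρ', s1, fun D hD => s2 (r2 hD), ?_, ?_⟩
            · intro D hD hDt
              rcases Finset.mem_insert.1 hD with rfl | hD
              · exact s4
              · exact (r3 D hD hDt).mono s2
            · have := Nat.pow_le_pow_right (n := 2) (by norm_num) hb
              nlinarith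
      obtain ⟨ρ, r1, r2, r3, r4⟩ := inner _ subset_rfl
      refine ⟨ρ, r1, fun C hC => r2 (h2 C hC), ?_, ?_⟩
      · intro j hj1 hj2 C hC hCt
        rcases Nat.lt_or_ge k j with hj | hj
        · obtain rfl : j = k + 1 := by omega
          exact r3 C hC hCt
        · exact (h3 j hj1 hj C hC hCt).mono r2
      · have h5 := h.card_facts _ (hgT (k + 1) (by omega) hk)
        have h6 : (B (g (k + 1))).card * 2 ^ b ≤ s * 2 ^ b := Nat.mul_le_mul_right _ h5
        calc ρ.length ≤ F.card + k * s * 2 ^ b + s * 2 ^ b := by omega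
          _ = F.card + (k + 1) * s * 2 ^ b := by ring
  obtain ⟨π, h1, -, h3, h4⟩ := main _ le_rfl
  obtain ⟨j, hj1, hj2, hj⟩ := hgs _ h.last_mem
  obtain ⟨D, hD, hD0⟩ := h3 j hj1 hj2 ∅ (hj ▸ h.empty_mem) (by simp [IsTaut])
  obtain rfl := Finset.subset_empty.1 hD0
  exact ⟨_, h1.isRefutation hD, by simp only [List.length_append, List.length_singleton]; omega⟩

lemma mem_powerset_of_clauseVars_subset {C : Clause V} {X : Finset V} (h : clauseVars C ⊆ X) :
    C ∈ (X ×ˢ (Finset.univ : Finset Bool)).powerset := by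
  rw [Finset.mem_powerset]
  intro l hl
  exact Finset.mem_product.2 ⟨h (Finset.mem_image_of_mem _ hl), Finset.mem_univ _⟩

/-- A proofdoor from a local refutation. The last interpolant mentions only the variables of the
last chunk, which bounds the number of its clauses. -/
theorem IsLocalRefutation.admitsProofdoor [DecidableEq κ]
    (h : IsLocalRefutation F T rank A B last s b) {c : ℕ}
    (hc : ∀ u ∈ T, (liveFacts T rank A B u).card ≤ c) :
    AdmitsProofdoor F (c + 1) (s + 1) (s + 4 ^ b) := by
  have hs := pos_of_isLocalRefutation h
  obtain ⟨g, hgT, hgs, hgm⟩ := exists_enumeration h.rank_inj ⟨_, h.last_mem⟩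
  set k := T.card with hk
  have hk1 : 1 ≤ k := Finset.card_pos.2 ⟨_, h.last_mem⟩
  have hlast : g k = last := by
    obtain ⟨j, hj1, hj2, hj⟩ := hgs _ h.last_mem
    rcases hj2.eq_or_lt with rfl | hlt
    · exact hj
    · exact absurd (hgm j k hj1 hlt le_rfl) (not_lt.2 (hj ▸ h.le_last _ (hgT k hk1 le_rfl)))
  have hlt_iff : ∀ i j, 1 ≤ i → i ≤ k → 1 ≤ j → j ≤ k → (rank (g i) < rank (g j) ↔ i < j) := by
    intro i j hi1 hi2 hj1 hj2
    refine ⟨fun hr => ?_, fun hij => hgm i j hi1 hij hj2⟩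
    by_contra hij
    rcases (show j = i ∨ j < i by omega) with rfl | hji
    · exact lt_irrefl _ hr
    · exact lt_asymm hr (hgm j i hj1 hji hi2)
  have hle_iff : ∀ i j, 1 ≤ i → i ≤ k → 1 ≤ j → j ≤ k → (rank (g i) ≤ rank (g j) ↔ i ≤ j) := by
    intro i j hi1 hi2 hj1 hj2
    rw [← not_lt, hlt_iff j i hj1 hj2 hi1 hi2, not_lt]
  let I : ℕ → CNF V := fun j => if j = 0 then ∅ else liveFacts T rank A B (g j)
  have hI : ∀ j, 1 ≤ j → j ≤ k → ∀ C, C ∈ I j ↔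
      (∃ i, 1 ≤ i ∧ i ≤ j ∧ C ∈ B (g i)) ∧
        ∀ x ∈ clauseVars C, ∃ i, j < i ∧ i ≤ k ∧ x ∈ vars (A (g i)) := by
    intro j hj1 hj2 C
    simp only [I, if_neg (show j ≠ 0 by omega), mem_liveFacts]
    refine and_congr ⟨?_, ?_⟩ (forall₂_congr fun x _ => ⟨?_, ?_⟩)
    · rintro ⟨t, ht, htr, hC⟩
      obtain ⟨i, hi1, hi2, rfl⟩ := hgs t ht
      exact ⟨i, hi1, (hle_iff _ _ hi1 hi2 hj1 hj2).1 htr, hC⟩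
    · rintro ⟨i, hi1, hi2, hC⟩
      exact ⟨g i, hgT i hi1 (hi2.trans hj2), (hle_iff _ _ hi1 (hi2.trans hj2) hj1 hj2).2 hi2, hC⟩
    · rintro ⟨v, hv, hvr, hx⟩
      obtain ⟨i, hi1, hi2, rfl⟩ := hgs v hv
      exact ⟨i, (hlt_iff _ _ hj1 hj2 hi1 hi2).1 hvr, hi2, hx⟩
    · rintro ⟨i, hi1, hi2, hx⟩
      exact ⟨g i, hgT i (by omega) hi2, (hlt_iff _ _ hj1 hj2 (by omega) hi2).2 hi1, hx⟩
  have halive : ∀ j, 1 ≤ j → j ≤ k → ∀ x, Alive T rank A (g j) x →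
      ∃ i, j ≤ i ∧ i ≤ k ∧ x ∈ vars (A (g i)) := by
    rintro j hj1 hj2 x ⟨v, hv, hvr, hx⟩
    obtain ⟨i, hi1, hi2, rfl⟩ := hgs v hv
    exact ⟨i, (hle_iff _ _ hj1 hj2 hi1 hi2).1 hvr, hi2, hx⟩
  -- available clauses belong to the preceding interpolant
  have havail : ∀ j, 1 ≤ j → j ≤ k → ∀ S, Available T rank A B (g j) S → S ⊆ I (j - 1) := by
    intro j hj1 hj2 S hS D hD
    obtain ⟨t, ht, htr, hDt⟩ := hS.1 D hD
    obtain ⟨i, hi1, hi2, rfl⟩ := hgs t ht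
    have hij := (hlt_iff _ _ hi1 hi2 hj1 hj2).1 htr
    rw [hI (j - 1) (by omega) (by omega)]
    refine ⟨⟨i, hi1, by omega, hDt⟩, fun x hx => ?_⟩
    obtain ⟨l, hl1, hl2, hl3⟩ := halive j hj1 hj2 x (hS.2 x (mem_vars.2 ⟨D, hD, hx⟩))
    exact ⟨l, by omega, hl2, hl3⟩
  -- the justification of each clause of an interpolant
  have hjust : ∀ j, 1 ≤ j → j ≤ k → ∀ C ∈ I j, ∃ S ⊆ I (j - 1), S.card ≤ s ∧
      Entails (A (g j) ∪ S) {C} ∧ ∃ S' ⊆ I (j - 1), clauseVars C ⊆ vars (A (g j) ∪ S') := by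
    intro j hj1 hj2 C hC
    obtain ⟨⟨i, hi1, hi2, hCi⟩, hCv⟩ := (hI j hj1 hj2 C).1 hC
    rcases hi2.eq_or_lt with rfl | hlt
    · rcases h.step _ (hgT i hi1 hj2) C hCi with hCA | ⟨S, h1, h2, h3, ⟨S', h4, h5⟩, -⟩
      · refine ⟨∅, by simp, by simp, fun σ hσ D hD => ?_, ∅, by simp, ?_⟩
        · rw [Finset.mem_singleton.1 hD]
          exact hσ C (Finset.mem_union_left _ hCA)
        · rw [Finset.union_empty]; exact clauseVars_subset_vars hCA
      · exact ⟨S, havail i hi1 hj2 S h2, h1, h3, S', havail i hi1 hj2 S' h4, h5⟩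
    · have hCI : C ∈ I (j - 1) := by
        rw [hI (j - 1) (by omega) (by omega)]
        refine ⟨⟨i, hi1, by omega, hCi⟩, fun x hx => ?_⟩
        obtain ⟨l, hl1, hl2, hl3⟩ := hCv x hx
        exact ⟨l, by omega, hl2, hl3⟩
      refine ⟨{C}, by simpa using hCI, by simpa using hs, fun σ hσ => (satisfies_union.1 hσ).2,
        {C}, by simpa using hCI, ?_⟩
      exact clauseVars_subset_vars (Finset.mem_union_right _ (Finset.mem_singleton_self C))
  -- an interpolant contradicts the remaining chunks
  have hunsat : ∀ j, j < k → ∀ σ, Satisfies σ (I j) → (∀ i, j < i → i ≤ k → Satisfies σ (A (g i))) →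
      False := by
    intro j hj σ hσI hσA
    have key : ∀ i, j < i → i ≤ k → Satisfies σ (B (g i)) := by
      intro i
      induction i using Nat.strong_induction_on with
      | _ i ih =>
        intro hji hik C hC
        rcases h.step _ (hgT i (by omega) hik) C hC with hCA | ⟨S, -, h2, h3, -⟩
        · exact hσA i hji hik C hCA
        · refine h3 σ (satisfies_union.2 ⟨hσA i hji hik, fun D hD => ?_⟩) C (by simp)
          obtain ⟨t, ht, htr, hDt⟩ := h2.1 D hD
          obtain ⟨l, hl1, hl2, rfl⟩ := hgs t ht
          have hli := (hlt_iff _ _ hl1 hl2 (by omega) hik).1 htr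
          rcases Nat.lt_or_ge j l with hjl | hlj
          · exact ih l hli hjl hl2 D hDt
          · refine hσI D ((hI j (by omega) hj.le D).2 ⟨⟨l, hl1, hlj, hDt⟩, fun x hx => ?_⟩)
            obtain ⟨r, hr1, hr2, hr3⟩ :=
              halive i (by omega) hik x (h2.2 x (mem_vars.2 ⟨D, hD, hx⟩))
            exact ⟨r, by omega, hr2, hr3⟩
    obtain ⟨l, hl, -⟩ := key k hj le_rfl ∅ (hlast ▸ h.empty_mem)
    simp at hl
  refine ⟨by omega, by omega, hs.trans (Nat.le_add_right _ _), k, fun j => A (g j), I,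
    ⟨?_, hk1, ?_, ?_, by simp [I], ?_⟩, ?_, ?_, ?_, ?_⟩
  · intro σ hσ
    refine hunsat 0 (by omega) σ (by simp [I, Satisfies]) fun i hi1 hi2 C hC => ?_
    exact hσ C ((h.cover C).2 ⟨_, hgT i (by omega) hi2, hC⟩)
  · ext C
    rw [h.cover, Finset.mem_biUnion]
    constructor
    · rintro ⟨u, hu, hC⟩
      obtain ⟨j, hj1, hj2, rfl⟩ := hgs u hu
      exact ⟨j, Finset.mem_Icc.2 ⟨hj1, hj2⟩, hC⟩
    · rintro ⟨j, hj, hC⟩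
      rw [Finset.mem_Icc] at hj
      exact ⟨_, hgT j hj.1 hj.2, hC⟩
  · intro i hi j hj hij
    rw [Finset.mem_Icc] at hi hj
    refine h.disjoint _ (hgT i hi.1 hi.2) _ (hgT j hj.1 hj.2) fun he => ?_
    rcases Nat.lt_or_gt_of_ne hij with hlt | hlt
    · exact (hgm i j hi.1 hlt hj.2).ne (by rw [he])
    · exact (hgm j i hj.1 hlt hi.2).ne (by rw [he])
  · intro j hj1 hjk
    refine ⟨?_, ?_, ?_⟩
    · intro σ hσ C hC
      obtain ⟨S, h1, -, h3, -⟩ := hjust j hj1 hjk.le C hC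
      refine h3 σ (fun D hD => hσ D ?_) C (by simp)
      rcases Finset.mem_union.1 hD with hD | hD
      · exact Finset.mem_union_right _ hD
      · exact Finset.mem_union_left _ (h1 hD)
    · intro σ hσ
      rw [satisfies_union] at hσ
      refine hunsat j hjk σ hσ.1 fun i hi1 hi2 C hC => hσ.2 C ?_
      exact Finset.mem_biUnion.2 ⟨i, Finset.mem_Icc.2 ⟨hi1, hi2⟩, hC⟩
    · intro x hx
      obtain ⟨C, hC, hxC⟩ := mem_vars.1 hx
      rw [Finset.mem_inter]
      constructor
      · obtain ⟨-, -, -, -, S, h1, h4⟩ := hjust j hj1 hjk.le C hC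
        have := h4 hxC
        simp only [vars_union, Finset.mem_union] at this ⊢
        rcases this with h5 | h5
        · exact Or.inr h5
        · exact Or.inl (Finset.biUnion_subset_biUnion_of_subset_left _ h1 h5)
      · obtain ⟨i, hi1, hi2, hi3⟩ := ((hI j hj1 hjk.le C).1 hC).2 x hxC
        obtain ⟨D, hD, hxD⟩ := mem_vars.1 hi3
        exact mem_vars.2 ⟨D, Finset.mem_biUnion.2 ⟨i, Finset.mem_Icc.2 ⟨hi1, hi2⟩, hD⟩, hxD⟩
  · intro j hj1 hjk
    simp only [I, if_neg (show j ≠ 0 by omega)]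
    exact (hc _ (hgT j hj1 hjk.le)).trans (by omega)
  · intro j hj1 hjk C hC
    obtain ⟨S, h1, h2, h3, -⟩ := hjust j hj1 hjk.le C hC
    exact ⟨S, h1, h2.trans (Nat.le_add_right _ _), h3⟩
  · intro h1k
    have hsub : I (k - 1) ⊆ ((vars (A last)) ×ˢ (Finset.univ : Finset Bool)).powerset := by
      intro C hC
      refine mem_powerset_of_clauseVars_subset fun x hx => ?_
      obtain ⟨i, hi1, hi2, hi3⟩ := ((hI (k - 1) (by omega) (by omega) C).1 hC).2 x hx
      obtain rfl : i = k := by omega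
      rwa [hlast] at hi3
    calc (I (k - 1)).card ≤ 2 ^ ((vars (A last)).card * 2) := by
          simpa using Finset.card_le_card hsub
      _ = 4 ^ (vars (A last)).card := by rw [mul_comm, pow_mul]; norm_num
      _ ≤ 4 ^ b := Nat.pow_le_pow_right (by norm_num) h.card_vars_last
      _ ≤ s + 4 ^ b := Nat.le_add_left _ _
  · intro j hj1 hjk
    exact (pathwidth_le_card _).trans ((h.card_chunk _ (hgT j hj1 hjk)).trans (by omega))

end LocalRefutation

/-! ### Semantics, variables and size of the gate encodings -/

section GateSemantics

variable {V : Type*}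

@[simp] lemma neg_fst (l : Literal V) : (neg l).1 = l.1 := rfl

/-- The truth value of a literal. -/
def val (σ : V → Bool) (l : Literal V) : Bool := σ l.1 == l.2

@[simp] lemma val_neg (σ : V → Bool) (l : Literal V) : val σ (neg l) = !val σ l := by
  rcases l with ⟨x, b⟩
  cases b <;> cases h : σ x <;> simp [val, neg, h]

variable [DecidableEq V]

lemma satisfies_ofLists {σ : V → Bool} {L : List (List (Literal V))} :
    Satisfies σ (ofLists L) ↔ ∀ c ∈ L, c.any (val σ) = true := by
  simp only [Satisfies, ofLists, List.mem_toFinset, List.forall_mem_map, List.any_eq_true, val,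
    beq_iff_eq]

lemma satisfies_constGate {σ : V → Bool} {o : Literal V} {b : Bool} :
    Satisfies σ (constGate o b) ↔ val σ o = b := by
  cases b <;> simp [constGate, satisfies_ofLists, -List.any_eq_true]

lemma satisfies_andGate {σ : V → Bool} {o : Literal V} {S : List (Literal V)} :
    Satisfies σ (andGate o S) ↔ val σ o = S.all (val σ) := by
  have h1 : (S.map neg).any (val σ) = !(S.all (val σ)) := by
    rw [List.any_map, List.not_all_eq_any_not]
    congr 1
    funext l
    simp
  rw [andGate, satisfies_ofLists, List.forall_mem_cons, List.forall_mem_map, List.any_cons, h1]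
  simp only [List.any_cons, List.any_nil, val_neg, Bool.or_false]
  cases ho : val σ o
  · simp
  · simp

lemma orGate_eq_andGate (o : Literal V) (S : List (Literal V)) :
    orGate o S = andGate (neg o) (S.map neg) := by
  have hn : ∀ l : Literal V, neg (neg l) = l := fun l => by simp [neg]
  simp [orGate, andGate, hn, Function.comp_def]

lemma satisfies_orGate {σ : V → Bool} {o : Literal V} {S : List (Literal V)} :
    Satisfies σ (orGate o S) ↔ val σ o = S.any (val σ) := by
  rw [orGate_eq_andGate, satisfies_andGate]
  simp only [val_neg, List.all_map, Function.comp_def]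
  rw [show (S.all fun x => !val σ x) = !(S.any (val σ)) by simp [List.not_any_eq_all_not]]
  cases val σ o <;> cases S.any (val σ) <;> simp

lemma satisfies_xorGate {σ : V → Bool} {o a b : Literal V} :
    Satisfies σ (xorGate o a b) ↔ val σ o = (val σ a ^^ val σ b) := by
  simp [xorGate, satisfies_ofLists, -List.any_eq_true]
  cases val σ o <;> cases val σ a <;> cases val σ b <;> simp

lemma satisfies_eqGate {σ : V → Bool} {o a b : Literal V} :
    Satisfies σ (eqGate o a b) ↔ val σ o = !(val σ a ^^ val σ b) := by
  rw [eqGate, satisfies_xorGate, val_neg]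
  cases val σ o <;> cases val σ a <;> cases val σ b <;> simp

lemma satisfies_xor3Gate {σ : V → Bool} {o a b c : Literal V} :
    Satisfies σ (xor3Gate o a b c) ↔ val σ o = (val σ a ^^ val σ b ^^ val σ c) := by
  simp [xor3Gate, satisfies_ofLists, -List.any_eq_true]
  cases val σ o <;> cases val σ a <;> cases val σ b <;> cases val σ c <;> simp

lemma satisfies_majGate {σ : V → Bool} {o a b c : Literal V} :
    Satisfies σ (majGate o a b c) ↔
      val σ o = (val σ a && val σ b || val σ a && val σ c || val σ b && val σ c) := by
  simp [majGate, satisfies_ofLists, -List.any_eq_true]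
  cases val σ o <;> cases val σ a <;> cases val σ b <;> cases val σ c <;> simp

lemma satisfies_muxGate {σ : V → Bool} {o s t e : Literal V} :
    Satisfies σ (muxGate o s t e) ↔ val σ o = if val σ s then val σ t else val σ e := by
  simp [muxGate, satisfies_ofLists, -List.any_eq_true]
  cases val σ o <;> cases val σ s <;> cases val σ t <;> cases val σ e <;> simp

lemma satisfies_muxZeroGate {σ : V → Bool} {o s e : Literal V} :
    Satisfies σ (muxZeroGate o s e) ↔ val σ o = if val σ s then false else val σ e := by
  simp [muxZeroGate, satisfies_ofLists, -List.any_eq_true]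
  cases val σ o <;> cases val σ s <;> cases val σ e <;> simp

lemma satisfies_muxOneGate {σ : V → Bool} {o s e : Literal V} :
    Satisfies σ (muxOneGate o s e) ↔ val σ o = if val σ s then true else val σ e := by
  simp [muxOneGate, satisfies_ofLists, -List.any_eq_true]
  cases val σ o <;> cases val σ s <;> cases val σ e <;> simp

lemma mem_vars_ofLists {L : List (List (Literal V))} {x : V} :
    x ∈ vars (ofLists L) ↔ x ∈ L.flatten.map Prod.fst := by
  simp only [vars, ofLists, Finset.mem_biUnion, List.mem_toFinset, Finset.mem_image, List.mem_map,
    List.mem_flatten]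
  constructor
  · rintro ⟨_, ⟨c, hc, rfl⟩, l, hl, rfl⟩
    exact ⟨l, ⟨c, hc, List.mem_toFinset.1 hl⟩, rfl⟩
  · rintro ⟨l, ⟨c, hc, hl⟩, rfl⟩
    exact ⟨_, ⟨c, hc, rfl⟩, l, List.mem_toFinset.2 hl, rfl⟩

lemma mem_vars_constGate {o : Literal V} {b : Bool} {x : V} :
    x ∈ vars (constGate o b) ↔ x = o.1 := by
  cases b <;> simp [constGate, mem_vars_ofLists, -List.mem_map]

lemma mem_vars_andGate {o : Literal V} {S : List (Literal V)} {x : V} :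
    x ∈ vars (andGate o S) ↔ x = o.1 ∨ x ∈ S.map Prod.fst := by
  have h : ∀ T : List (Literal V), x ∈ (T.map fun a => [neg o, a]).flatten.map Prod.fst →
      x = o.1 ∨ x ∈ T.map Prod.fst := by
    intro T
    induction T with
    | nil => simp
    | cons a T ih =>
      simp only [List.map_cons, List.flatten_cons, List.map_append, List.mem_append, List.mem_cons,
        neg_fst, List.map_nil, List.not_mem_nil, or_false]
      tauto
  have h' : (S.map neg).map Prod.fst = S.map Prod.fst := by
    rw [List.map_map]; rfl
  rw [andGate, mem_vars_ofLists, List.flatten_cons, List.map_append, List.mem_append, List.map_cons,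
    List.mem_cons, h']
  constructor
  · rintro (h1 | h1)
    · exact h1
    · exact h S h1
  · exact Or.inl

lemma mem_vars_orGate {o : Literal V} {S : List (Literal V)} {x : V} :
    x ∈ vars (orGate o S) ↔ x = o.1 ∨ x ∈ S.map Prod.fst := by
  rw [orGate_eq_andGate, mem_vars_andGate, List.map_map]
  rfl

lemma mem_vars_xorGate {o a b : Literal V} {x : V} :
    x ∈ vars (xorGate o a b) ↔ x = o.1 ∨ x = a.1 ∨ x = b.1 := by
  simp [-List.mem_map, xorGate, mem_vars_ofLists]; tauto

lemma mem_vars_eqGate {o a b : Literal V} {x : V} :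
    x ∈ vars (eqGate o a b) ↔ x = o.1 ∨ x = a.1 ∨ x = b.1 := by
  rw [eqGate, mem_vars_xorGate, neg_fst]

lemma mem_vars_xor3Gate {o a b c : Literal V} {x : V} :
    x ∈ vars (xor3Gate o a b c) ↔ x = o.1 ∨ x = a.1 ∨ x = b.1 ∨ x = c.1 := by
  simp [-List.mem_map, xor3Gate, mem_vars_ofLists]; tauto

lemma mem_vars_majGate {o a b c : Literal V} {x : V} :
    x ∈ vars (majGate o a b c) ↔ x = o.1 ∨ x = a.1 ∨ x = b.1 ∨ x = c.1 := by
  simp [-List.mem_map, majGate, mem_vars_ofLists]; tauto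

lemma mem_vars_muxGate {o s t e : Literal V} {x : V} :
    x ∈ vars (muxGate o s t e) ↔ x = o.1 ∨ x = s.1 ∨ x = t.1 ∨ x = e.1 := by
  simp [-List.mem_map, muxGate, mem_vars_ofLists]; tauto

lemma mem_vars_muxZeroGate {o s e : Literal V} {x : V} :
    x ∈ vars (muxZeroGate o s e) ↔ x = o.1 ∨ x = s.1 ∨ x = e.1 := by
  simp [-List.mem_map, muxZeroGate, mem_vars_ofLists]; tauto

lemma mem_vars_muxOneGate {o s e : Literal V} {x : V} :
    x ∈ vars (muxOneGate o s e) ↔ x = o.1 ∨ x = s.1 ∨ x = e.1 := by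
  simp [-List.mem_map, muxOneGate, mem_vars_ofLists]; tauto

/-- The formula has at most `b` clauses and at most `b` variables. -/
def IsSmall (b : ℕ) (F : CNF V) : Prop := F.card ≤ b ∧ (vars F).card ≤ b

lemma IsSmall.union {a b : ℕ} {F G : CNF V} (hF : IsSmall a F) (hG : IsSmall b G) :
    IsSmall (a + b) (F ∪ G) := by
  refine ⟨(Finset.card_union_le _ _).trans (add_le_add hF.1 hG.1), ?_⟩
  rw [vars_union]
  exact (Finset.card_union_le _ _).trans (add_le_add hF.2 hG.2)

lemma IsSmall.mono {a b : ℕ} {F : CNF V} (hF : IsSmall a F) (hab : a ≤ b) : IsSmall b F :=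
  ⟨hF.1.trans hab, hF.2.trans hab⟩

lemma isSmall_empty : IsSmall 0 (∅ : CNF V) := by simp [IsSmall, vars]

lemma isSmall_ofLists (L : List (List (Literal V))) :
    IsSmall (L.length + L.flatten.length) (ofLists L) := by
  constructor
  · exact (List.toFinset_card_le _).trans (by simp)
  · have : vars (ofLists L) ⊆ (L.flatten.map Prod.fst).toFinset := by
      intro x hx
      exact List.mem_toFinset.2 (mem_vars_ofLists.1 hx)
    refine (Finset.card_le_card this).trans ((List.toFinset_card_le _).trans ?_)
    rw [List.length_map]
    exact Nat.le_add_left _ _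

lemma isSmall_constGate (o : Literal V) (b : Bool) : IsSmall 40 (constGate o b) :=
  (isSmall_ofLists _).mono (by simp)

lemma isSmall_andGate {o : Literal V} {S : List (Literal V)} (hS : S.length ≤ 4) :
    IsSmall 40 (andGate o S) := by
  refine (isSmall_ofLists _).mono ?_
  have : ∀ T : List (Literal V), (T.map fun a => [neg o, a]).flatten.length = 2 * T.length := by
    intro T
    induction T with
    | nil => rfl
    | cons a T ih => simp at ih ⊢; omega
  simp only [List.length_cons, List.length_map, List.flatten_cons, List.length_append, this]
  omega

lemma isSmall_orGate {o : Literal V} {S : List (Literal V)} (hS : S.length ≤ 4) :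
    IsSmall 40 (orGate o S) := by
  rw [orGate_eq_andGate]
  exact isSmall_andGate (by simpa using hS)

lemma isSmall_xorGate (o a b : Literal V) : IsSmall 40 (xorGate o a b) :=
  (isSmall_ofLists _).mono (by simp)

lemma isSmall_eqGate (o a b : Literal V) : IsSmall 40 (eqGate o a b) := isSmall_xorGate _ _ _

lemma isSmall_xor3Gate (o a b c : Literal V) : IsSmall 40 (xor3Gate o a b c) :=
  (isSmall_ofLists _).mono (by simp)

lemma isSmall_majGate (o a b c : Literal V) : IsSmall 40 (majGate o a b c) :=
  (isSmall_ofLists _).mono (by simp)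

lemma isSmall_muxGate (o s t e : Literal V) : IsSmall 40 (muxGate o s t e) :=
  (isSmall_ofLists _).mono (by simp)

lemma isSmall_muxZeroGate (o s e : Literal V) : IsSmall 40 (muxZeroGate o s e) :=
  (isSmall_ofLists _).mono (by simp)

lemma isSmall_muxOneGate (o s e : Literal V) : IsSmall 40 (muxOneGate o s e) :=
  (isSmall_ofLists _).mono (by simp)

end GateSemantics

/-! ### The chunks of the miter -/

/-- The chunks into which the miter is cut. The chunk `big` holds the clauses of unbounded width;
every other chunk holds, for both copies of the adder, the gates of one iteration of one of the
loops of the circuit. The selection of the larger mantissa is read together with the significand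
addition, so that it need not be remembered during the alignment. -/
inductive Key : Type
  | big | cmp (t : ℕ) | borrow0 | eSel (i : ℕ) | sub (i : ℕ) | mSel (i : ℕ) | alignInit
  | lost0 (j : ℕ) | lost (j i : ℕ) | shift (j i : ℕ) | stick (j : ℕ)
  | carry0 | add (i : ℕ) | norm (i : ℕ) | normLow | eUpd (i : ℕ)
  | rndInit | rndInc (i : ℕ) | fShift (i : ℕ) | eFin (i : ℕ) | errM (t : ℕ) | errE (t : ℕ)
  deriving DecidableEq

/-- Points of time, ordered lexicographically. -/
abbrev Time := ℕ ×ₗ ℕ ×ₗ ℕ ×ₗ ℕ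

/-- The point of time with the given coordinates. -/
def time (a b c d : ℕ) : Time := toLex (a, toLex (b, toLex (c, d)))

@[simp] lemma time_lt {a b c d a' b' c' d' : ℕ} : time a b c d < time a' b' c' d' ↔
    a < a' ∨ a = a' ∧ (b < b' ∨ b = b' ∧ (c < c' ∨ c = c' ∧ d < d')) := by
  simp [time, Prod.Lex.toLex_lt_toLex]

@[simp] lemma time_le {a b c d a' b' c' d' : ℕ} : time a b c d ≤ time a' b' c' d' ↔
    a < a' ∨ a = a' ∧ (b < b' ∨ b = b' ∧ (c < c' ∨ c = c' ∧ d ≤ d')) := by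
  simp [time, Prod.Lex.toLex_le_toLex]

@[simp] lemma time_inj {a b c d a' b' c' d' : ℕ} : time a b c d = time a' b' c' d' ↔
    a = a' ∧ b = b' ∧ c = c' ∧ d = d' := by
  simp [time]

/-- The keys that occur for `m` exponent bits and `n` mantissa bits. -/
def ValidKey (m n : ℕ) : Key → Prop
  | .cmp t => t ≤ m
  | .eSel i | .sub i | .eUpd i | .eFin i | .errE i => i < m
  | .mSel i | .add i | .norm i | .rndInc i | .fShift i | .errM i => i < n
  | .lost0 j | .stick j => j < m
  | .lost j i => j < m ∧ i < min (2 ^ j) (n + 2)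
  | .shift j i => j < m ∧ i < n + 2
  | _ => True

/-- The order in which the chunks are read. It follows the circuit; the second coordinate is the
stage of the barrel shifter. The words of the comparison, and the error bits, are read from the most
significant bit down. -/
def rank (m n : ℕ) : Key → Time
  | .big => time 0 0 0 0
  | .cmp t => time 1 0 0 (m - t)
  | .borrow0 => time 2 0 0 0
  | .eSel i => time 3 0 0 i
  | .sub i => time 4 0 0 i
  | .mSel i => time 5 0 0 i
  | .alignInit => time 6 0 0 0
  | .lost0 j => time 7 j 0 0
  | .lost j i => time 7 j 1 i
  | .shift j i => time 7 j 2 i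
  | .stick j => time 7 j 3 0
  | .carry0 => time 8 0 0 0
  | .add i => time 9 0 0 i
  | .norm i => time 10 0 0 i
  | .normLow => time 11 0 0 0
  | .eUpd i => time 12 0 0 i
  | .rndInit => time 13 0 0 0
  | .rndInc i => time 14 0 0 i
  | .fShift i => time 15 0 0 i
  | .eFin i => time 16 0 0 i
  | .errM t => time 17 0 0 (n - t)
  | .errE t => time 18 0 0 (m - t)

lemma rank_inj {m n : ℕ} {u v : Key} (hu : ValidKey m n u) (hv : ValidKey m n v)
    (h : rank m n u = rank m n v) : u = v := by
  cases u <;> cases v <;> simp [rank, ValidKey] at h hu hv ⊢ <;> omega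

/-- The points of time with second coordinate in `J` and last coordinate below `N`; the bounds `19`
and `4` for the other coordinates are those of `rank`. -/
def timeBox (J : Finset ℕ) (N : ℕ) : Finset Time :=
  (Finset.range 19 ×ˢ J ×ˢ Finset.range 4 ×ˢ Finset.range N).image
    fun a => time a.1 a.2.1 a.2.2.1 a.2.2.2

lemma time_mem_timeBox {J : Finset ℕ} {N a b c d : ℕ} :
    time a b c d ∈ timeBox J N ↔ a < 19 ∧ b ∈ J ∧ c < 4 ∧ d < N := by
  simp only [timeBox, Finset.mem_image, Finset.mem_product, Finset.mem_range, Prod.exists, time_inj]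
  constructor
  · rintro ⟨a, b, c, d, h, rfl, rfl, rfl, rfl⟩
    exact h
  · intro h
    exact ⟨a, b, c, d, h, rfl, rfl, rfl, rfl⟩

lemma card_timeBox (J : Finset ℕ) (N : ℕ) : (timeBox J N).card ≤ 76 * J.card * N := by
  refine Finset.card_image_le.trans (le_of_eq ?_)
  simp only [Finset.card_product, Finset.card_range]
  ring

lemma rank_mem_timeBox {m n : ℕ} {k : Key} (hk : ValidKey m n k) :
    rank m n k ∈ timeBox (Finset.range (m + 1)) (m + n + 2) := by
  cases k <;> simp [ValidKey] at hk <;>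
    simp only [rank, time_mem_timeBox, Finset.mem_range] <;> omega

lemma finite_validKey (m n : ℕ) : {k | ValidKey m n k}.Finite :=
  Set.Finite.of_finite_image
    ((timeBox (Finset.range (m + 1)) (m + n + 2)).finite_toSet.subset
      (Set.image_subset_iff.2 fun _ hk => rank_mem_timeBox hk))
    fun _ hu _ hv h => rank_inj hu hv h

/-- The set of valid keys. -/
noncomputable def keys (m n : ℕ) : Finset Key := (finite_validKey m n).toFinset

lemma mem_keys {m n : ℕ} {k : Key} : k ∈ keys m n ↔ ValidKey m n k := by
  simp [keys]

lemma card_keys_le (m n : ℕ) : (keys m n).card ≤ 76 * (m + 1) * (m + n + 2) := by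
  rw [← Finset.card_image_of_injOn (s := keys m n) (f := rank m n)
    fun u hu v hv h => rank_inj (mem_keys.1 hu) (mem_keys.1 hv) h]
  refine (Finset.card_le_card (t := timeBox (Finset.range (m + 1)) (m + n + 2))
    fun a ha => ?_).trans ((card_timeBox _ _).trans (by rw [Finset.card_range]))
  obtain ⟨k, hk, rfl⟩ := Finset.mem_image.1 ha
  exact rank_mem_timeBox (mem_keys.1 hk)

section Chunks

/-- The clause with the literals `base` and `f 0, …, f (t - 1)`. -/
def wide (base : List (Literal Var)) (f : ℕ → Literal Var) (t : ℕ) : Clause Var :=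
  base.toFinset ∪ (Finset.range t).image f

variable (m n : ℕ) (v : Wire → Literal Var) (x y p q : ℕ → Literal Var)

/-- The gate that defines bit `t - 1` of the prefix of the exponent comparison. -/
def preGate : ℕ → CNF Var
  | 0 => ∅
  | t + 1 => if t + 1 < m then andGate (v (.pre t)) [v (.pre (t + 1)), v (.eqBit (t + 1))]
      else constGate (v (.pre t)) true

/-- The gates of bit `t` of the exponent comparison. -/
def cmpGates (t : ℕ) : CNF Var :=
  eqGate (v (.eqBit t)) (x t) (y t) ∪ andGate (v (.gtBit t)) [v (.pre t), x t, neg (y t)] ∪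
    andGate (v (.ltBit t)) [v (.pre t), neg (x t), y t] ∪
    ofLists [[v .gt, neg (v (.gtBit t))], [v .lt, neg (v (.ltBit t))],
      [neg (v .eq), v (.eqBit t)]]

/-- The clauses of unbounded width of the exponent comparison. -/
def topClauses : CNF Var :=
  {wide [neg (v .gt)] (fun i => v (.gtBit i)) m, wide [neg (v .lt)] (fun i => v (.ltBit i)) m,
    wide [v .eq] (fun i => neg (v (.eqBit i))) m}

/-- The clauses that one copy of the adder contributes to a chunk. -/
def gates : Key → CNF Var
  | .big => topClauses m v
  | .cmp t => (if t < m then cmpGates v x y t else ∅) ∪ preGate m v t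
  | .borrow0 => constGate (v (.borrow 0)) false
  | .eSel i => muxGate (v (.eLarge i)) (v .gt) (x i) (y i) ∪
      muxGate (v (.eSmall i)) (v .lt) (x i) (y i)
  | .sub i => xor3Gate (v (.diff i)) (v (.eLarge i)) (v (.eSmall i)) (v (.borrow i)) ∪
      majGate (v (.borrow (i + 1))) (neg (v (.eLarge i))) (v (.eSmall i)) (v (.borrow i))
  | .mSel i => muxGate (v (.mSmall i)) (v .gt) (q i) (p i)
  | .alignInit => constGate (v (alignBit 0 0)) false ∪ constGate (v (alignBit 0 1)) false ∪
      constGate (v (.sticky 0)) false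
  | .lost0 j => constGate (v (.lost j 0)) false
  | .lost j i => orGate (v (.lost j (i + 1))) [v (.lost j i), v (alignBit j i)]
  | .shift j i => if i + 2 ^ j < n + 2 then
        muxGate (v (alignBit (j + 1) i)) (v (.diff j)) (v (alignBit j (i + 2 ^ j)))
          (v (alignBit j i))
      else muxZeroGate (v (alignBit (j + 1) i)) (v (.diff j)) (v (alignBit j i))
  | .stick j => andGate (v (.lostNow j)) [v (.diff j), v (.lost j (min (2 ^ j) (n + 2)))] ∪
      orGate (v (.sticky (j + 1))) [v (.sticky j), v (.lostNow j)]
  | .carry0 => constGate (v (.carry 0)) false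
  | .add i => muxGate (v (.mLarge i)) (v .gt) (p i) (q i) ∪
      (xor3Gate (v (.sum i)) (v (.mLarge i)) (v (alignBit m (i + 2))) (v (.carry i)) ∪
      majGate (v (.carry (i + 1))) (v (.mLarge i)) (v (alignBit m (i + 2))) (v (.carry i)))
  | .norm i => if i + 1 < n then
        muxGate (v (.norm i)) (v (.carry n)) (v (.sum (i + 1))) (v (.sum i))
      else muxOneGate (v (.norm i)) (v (.carry n)) (v (.sum i))
  | .normLow => muxGate (v .gNorm) (v (.carry n)) (v (.sum 0)) (v (alignBit m 1)) ∪
      muxGate (v .rNorm) (v (.carry n)) (v (alignBit m 1)) (v (alignBit m 0)) ∪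
      orGate (v .rOrS) [v (alignBit m 0), v (.sticky m)] ∪
      muxGate (v .sNorm) (v (.carry n)) (v .rOrS) (v (.sticky m))
  | .eUpd i => xorGate (v (.eOut i)) (v (.eLarge i)) (v (outCarryBit n i)) ∪
      andGate (v (outCarryBit n (i + 1))) [v (.eLarge i), v (outCarryBit n i)]
  | .rndInit => orGate (v .lsbOrS) [v (.norm 0), v .sNorm] ∪ andGate (v .inc) [v .rNorm, v .lsbOrS]
  | .rndInc i => xorGate (v (.rnd i)) (v (.norm i)) (v (rndCarryBit i)) ∪
      andGate (v (rndCarryBit (i + 1))) [v (.norm i), v (rndCarryBit i)]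
  | .fShift i => if i + 1 < n then
        muxGate (v (.mFinal i)) (v (rndCarryBit n)) (v (.rnd (i + 1))) (v (.rnd i))
      else muxOneGate (v (.mFinal i)) (v (rndCarryBit n)) (v (.rnd i))
  | .eFin i => xorGate (v (.eFinal i)) (v (.eOut i)) (v (finCarryBit n i)) ∪
      andGate (v (finCarryBit n (i + 1))) [v (.eOut i), v (finCarryBit n i)]
  | .errM _ => ∅
  | .errE _ => ∅

/-- The literal of a wire of one of the two copies of the adder. -/
def W (s : Bool) (w : Wire) : Literal Var := lit (.wire s w)

/-- The exponent of the first operand of a copy of the adder. -/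
def expo : Bool → ℕ → Literal Var
  | false, i => lit (.ea i)
  | true, i => lit (.eb i)

/-- The mantissa of the first operand of a copy of the adder. -/
def mant : Bool → ℕ → Literal Var
  | false, i => lit (.ma i)
  | true, i => lit (.mb i)

/-- The clauses that the copy `s` of the adder contributes to a chunk. -/
def sideGates (s : Bool) (k : Key) : CNF Var :=
  gates m n (W s) (expo s) (expo (!s)) (mant s) (mant (!s)) k

/-- The clause that asserts that one of the error bits `errM i`, for `i < t`, or `errE i`, for
`i < r`, is set. -/
def errClause (t r : ℕ) : Clause Var :=
  (Finset.range t).image (fun i => lit (.errM i)) ∪ (Finset.range r).image (fun i => lit (.errE i))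

/-- The clauses of a chunk that define and use the error bits. -/
def errGates : Key → CNF Var
  | .big => {errClause n m}
  | .errM i => xorGate (lit (.errM i)) (W false (.mFinal i)) (W true (.mFinal i))
  | .errE i => xorGate (lit (.errE i)) (W false (.eFinal i)) (W true (.eFinal i))
  | _ => ∅

/-- The chunks of the miter. -/
def chunk (k : Key) : CNF Var :=
  sideGates m n false k ∪ sideGates m n true k ∪ errGates m n k

end Chunks

lemma mem_orGate_map {V : Type*} [DecidableEq V] {o : Literal V} {f : ℕ → Literal V} {m : ℕ}
    {C : Clause V} : C ∈ orGate o ((List.range m).map f) ↔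
      C = [neg o].toFinset ∪ (Finset.range m).image f ∨ ∃ i < m, C = {o, neg (f i)} := by
  have : (neg o :: (List.range m).map f).toFinset =
      [neg o].toFinset ∪ (Finset.range m).image f := by
    ext l; simp
  rw [← this]
  simp [orGate, ofLists, eq_comm]

lemma mem_andGate_map {V : Type*} [DecidableEq V] {o : Literal V} {f : ℕ → Literal V} {m : ℕ}
    {C : Clause V} : C ∈ andGate o ((List.range m).map f) ↔
      C = [o].toFinset ∪ (Finset.range m).image (fun i => neg (f i)) ∨
        ∃ i < m, C = {neg o, f i} := by
  have : (o :: ((List.range m).map f).map neg).toFinset =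
      [o].toFinset ∪ (Finset.range m).image (fun i => neg (f i)) := by
    ext l; simp
  rw [← this]
  simp [andGate, ofLists, eq_comm]

section Cover

variable {m n : ℕ} {v : Wire → Literal Var} {x y p q : ℕ → Literal Var} {C : Clause Var}

lemma mem_comparator : C ∈ comparator m v x y ↔
    C ∈ topClauses m v ∨ ∃ t ≤ m, C ∈ gates m n v x y p q (.cmp t) := by
  simp only [comparator, Finset.mem_union, Finset.mem_biUnion, Finset.mem_range, mem_orGate_map,
    mem_andGate_map, topClauses, Finset.mem_insert, Finset.mem_singleton, wide, gates]
  constructor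
  · rintro (((⟨i, hi, ((h | h) | h) | h⟩ | (h | ⟨i, hi, h⟩)) | (h | ⟨i, hi, h⟩)) | (h | ⟨i, hi, h⟩))
    · exact Or.inr ⟨i, hi.le, Or.inl (by simp [hi, cmpGates, h])⟩
    · exact Or.inr ⟨i + 1, hi, Or.inr h⟩
    · exact Or.inr ⟨i, hi.le, Or.inl (by simp [hi, cmpGates, h])⟩
    · exact Or.inr ⟨i, hi.le, Or.inl (by simp [hi, cmpGates, h])⟩
    · exact Or.inl (Or.inl h)
    · exact Or.inr ⟨i, hi.le, Or.inl (by simp [hi, cmpGates, h, ofLists])⟩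
    · exact Or.inl (Or.inr (Or.inl h))
    · exact Or.inr ⟨i, hi.le, Or.inl (by simp [hi, cmpGates, h, ofLists])⟩
    · exact Or.inl (Or.inr (Or.inr h))
    · exact Or.inr ⟨i, hi.le, Or.inl (by simp [hi, cmpGates, h, ofLists])⟩
  · rintro ((h | h | h) | ⟨t, ht, h | h⟩)
    · simp [h]
    · simp [h]
    · simp [h]
    · split_ifs at h with htm
      · simp only [cmpGates, Finset.mem_union, ofLists, List.mem_toFinset, List.map_cons,
          List.map_nil, List.mem_cons, List.not_mem_nil, or_false] at h
        rcases h with ((h | h) | h) | h | h | h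
        · exact Or.inl (Or.inl (Or.inl ⟨t, htm, Or.inl (Or.inl (Or.inl h))⟩))
        · exact Or.inl (Or.inl (Or.inl ⟨t, htm, Or.inl (Or.inr h)⟩))
        · exact Or.inl (Or.inl (Or.inl ⟨t, htm, Or.inr h⟩))
        · exact Or.inl (Or.inl (Or.inr (Or.inr ⟨t, htm, by rw [h]; simp⟩)))
        · exact Or.inl (Or.inr (Or.inr ⟨t, htm, by rw [h]; simp⟩))
        · exact Or.inr (Or.inr ⟨t, htm, by rw [h]; simp⟩)
      · simp at h
    · cases t with
      | zero => simp [preGate] at h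
      | succ t =>
        exact Or.inl (Or.inl (Or.inl ⟨t, ht, Or.inl (Or.inl (Or.inr h))⟩))

lemma mem_fpAdder : C ∈ fpAdder m n v x y p q ↔
    ∃ k, ValidKey m n k ∧ C ∈ gates m n v x y p q k := by
  constructor
  · intro h
    simp only [fpAdder, Finset.mem_union, mem_comparator (n := n) (p := p) (q := q)] at h
    rcases h with (((((((h | h) | h) | h) | h) | h) | h) | h) | h
    · rcases h with h | ⟨t, ht, h⟩
      · exact ⟨.big, trivial, h⟩
      · exact ⟨.cmp t, ht, h⟩
    · simp only [selection, Finset.mem_union, Finset.mem_biUnion, Finset.mem_range] at h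
      rcases h with ⟨i, hi, h⟩ | ⟨i, hi, h | h⟩
      · exact ⟨.eSel i, hi, by simpa [gates] using h⟩
      · exact ⟨.add i, hi, by simp [gates, h]⟩
      · exact ⟨.mSel i, hi, by simpa [gates] using h⟩
    · simp only [difference, rippleSubtractor, Finset.mem_union, Finset.mem_biUnion,
        Finset.mem_range] at h
      rcases h with h | ⟨i, hi, h⟩
      · exact ⟨.borrow0, trivial, h⟩
      · exact ⟨.sub i, hi, by simpa [gates] using h⟩
    · simp only [alignment, alignStage, Finset.mem_union, Finset.mem_biUnion, Finset.mem_range] at h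
      rcases h with h | ⟨j, hj, (((⟨i, hi, h⟩ | h) | ⟨i, hi, h⟩) | h) | h⟩
      · exact ⟨.alignInit, trivial, by simpa [gates, or_assoc] using h⟩
      · exact ⟨.shift j i, ⟨hj, hi⟩, h⟩
      · exact ⟨.lost0 j, hj, h⟩
      · exact ⟨.lost j i, ⟨hj, hi⟩, h⟩
      · exact ⟨.stick j, hj, by simp [gates, h]⟩
      · exact ⟨.stick j, hj, by simp [gates, h]⟩
    · simp only [significandAddition, rippleAdder, Finset.mem_union, Finset.mem_biUnion,
        Finset.mem_range] at h
      rcases h with h | ⟨i, hi, h⟩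
      · exact ⟨.carry0, trivial, h⟩
      · exact ⟨.add i, hi, by simp only [gates, Finset.mem_union]; exact Or.inr h⟩
    · simp only [normalization, shiftOne, Finset.mem_union, Finset.mem_biUnion,
        Finset.mem_range] at h
      rcases h with (((⟨i, hi, h⟩ | h) | h) | h) | h
      · exact ⟨.norm i, hi, h⟩
      all_goals exact ⟨.normLow, trivial, by simp [gates, h]⟩
    · simp only [exponentUpdate, incrementer, Finset.mem_biUnion, Finset.mem_range] at h
      obtain ⟨i, hi, h⟩ := h
      exact ⟨.eUpd i, hi, h⟩
    · simp only [rounding, incrementer, Finset.mem_union, Finset.mem_biUnion, Finset.mem_range] at h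
      rcases h with (h | h) | ⟨i, hi, h⟩
      · exact ⟨.rndInit, trivial, by simp [gates, h]⟩
      · exact ⟨.rndInit, trivial, by simp [gates, h]⟩
      · exact ⟨.rndInc i, hi, by simpa [gates] using h⟩
    · simp only [finalShift, shiftOne, incrementer, Finset.mem_union, Finset.mem_biUnion,
        Finset.mem_range] at h
      rcases h with ⟨i, hi, h⟩ | ⟨i, hi, h⟩
      · exact ⟨.fShift i, hi, h⟩
      · exact ⟨.eFin i, hi, by simpa [gates] using h⟩
  · rintro ⟨k, hk, h⟩
    simp only [fpAdder, Finset.mem_union, mem_comparator (n := n) (p := p) (q := q)]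
    cases k with
    | big =>
      have : C ∈ topClauses m v := h
      simp only [this, true_or]
    | cmp t =>
      have : ∃ t ≤ m, C ∈ gates m n v x y p q (.cmp t) := ⟨t, hk, h⟩
      simp only [this, true_or, or_true]
    | borrow0 =>
      have : C ∈ difference m v := by simp only [difference, Finset.mem_union]; exact Or.inl h
      simp only [this, true_or, or_true]
    | eSel i =>
      have : C ∈ selection m n v x y p q := by
        simp only [selection, Finset.mem_union, Finset.mem_biUnion, Finset.mem_range]
        exact Or.inl ⟨i, hk, by simpa [gates] using h⟩
      simp only [this, true_or, or_true]
    | sub i =>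
      have : C ∈ difference m v := by
        simp only [difference, rippleSubtractor, Finset.mem_union, Finset.mem_biUnion,
          Finset.mem_range]
        exact Or.inr ⟨i, hk, by simpa [gates] using h⟩
      simp only [this, true_or, or_true]
    | mSel i =>
      have : C ∈ selection m n v x y p q := by
        simp only [selection, Finset.mem_union, Finset.mem_biUnion, Finset.mem_range]
        exact Or.inr ⟨i, hk, Or.inr h⟩
      simp only [this, true_or, or_true]
    | alignInit =>
      have : C ∈ alignment m n v := by
        simp only [alignment, Finset.mem_union, gates] at h ⊢
        exact Or.inl h
      simp only [this, true_or, or_true]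
    | lost0 j =>
      have : C ∈ alignment m n v := by
        simp only [alignment, alignStage, Finset.mem_union, Finset.mem_biUnion, Finset.mem_range]
        exact Or.inr ⟨j, hk, Or.inl (Or.inl (Or.inl (Or.inr h)))⟩
      simp only [this, true_or, or_true]
    | lost j i =>
      have : C ∈ alignment m n v := by
        simp only [alignment, alignStage, Finset.mem_union, Finset.mem_biUnion, Finset.mem_range]
        exact Or.inr ⟨j, hk.1, Or.inl (Or.inl (Or.inr ⟨i, hk.2, h⟩))⟩
      simp only [this, true_or, or_true]
    | shift j i =>
      have : C ∈ alignment m n v := by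
        simp only [alignment, alignStage, Finset.mem_union, Finset.mem_biUnion, Finset.mem_range]
        exact Or.inr ⟨j, hk.1, Or.inl (Or.inl (Or.inl (Or.inl ⟨i, hk.2, h⟩)))⟩
      simp only [this, true_or, or_true]
    | stick j =>
      have : C ∈ alignment m n v := by
        simp only [alignment, alignStage, Finset.mem_union, Finset.mem_biUnion, Finset.mem_range,
          gates] at h ⊢
        exact Or.inr ⟨j, hk, h.elim (fun h => Or.inl (Or.inr h)) Or.inr⟩
      simp only [this, true_or, or_true]
    | carry0 =>
      have : C ∈ significandAddition m n v := by
        simp only [significandAddition, Finset.mem_union]; exact Or.inl h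
      simp only [this, true_or, or_true]
    | add i =>
      simp only [gates, Finset.mem_union] at h
      rcases h with h | h
      · have : C ∈ selection m n v x y p q := by
          simp only [selection, Finset.mem_union, Finset.mem_biUnion, Finset.mem_range]
          exact Or.inr ⟨i, hk, Or.inl h⟩
        simp only [this, true_or, or_true]
      · have : C ∈ significandAddition m n v := by
          simp only [significandAddition, rippleAdder, Finset.mem_union, Finset.mem_biUnion,
            Finset.mem_range]
          exact Or.inr ⟨i, hk, h⟩
        simp only [this, true_or, or_true]
    | norm i =>
      have : C ∈ normalization m n v := by
        simp only [normalization, shiftOne, Finset.mem_union, Finset.mem_biUnion, Finset.mem_range]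
        exact Or.inl (Or.inl (Or.inl (Or.inl ⟨i, hk, h⟩)))
      simp only [this, true_or, or_true]
    | normLow =>
      have : C ∈ normalization m n v := by
        simp only [normalization, Finset.mem_union, gates] at h ⊢
        rcases h with ((h | h) | h) | h <;> simp only [h, true_or, or_true]
      simp only [this, true_or, or_true]
    | eUpd i =>
      have : C ∈ exponentUpdate m n v := by
        simp only [exponentUpdate, incrementer, Finset.mem_biUnion, Finset.mem_range]
        exact ⟨i, hk, h⟩
      simp only [this, true_or, or_true]
    | rndInit =>
      have : C ∈ rounding n v := by
        simp only [rounding, Finset.mem_union, gates] at h ⊢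
        exact Or.inl h
      simp only [this, true_or, or_true]
    | rndInc i =>
      have : C ∈ rounding n v := by
        simp only [rounding, incrementer, Finset.mem_union, Finset.mem_biUnion, Finset.mem_range]
        exact Or.inr ⟨i, hk, by simpa [gates] using h⟩
      simp only [this, true_or, or_true]
    | fShift i =>
      have : C ∈ finalShift m n v := by
        simp only [finalShift, shiftOne, Finset.mem_union, Finset.mem_biUnion, Finset.mem_range]
        exact Or.inl ⟨i, hk, h⟩
      simp only [this, or_true]
    | eFin i =>
      have : C ∈ finalShift m n v := by
        simp only [finalShift, incrementer, Finset.mem_union, Finset.mem_biUnion, Finset.mem_range]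
        exact Or.inr ⟨i, hk, by simpa [gates] using h⟩
      simp only [this, or_true]
    | errM i => simp [gates] at h
    | errE i => simp [gates] at h

lemma mem_commMiter : C ∈ commMiter m n ↔ ∃ k ∈ keys m n, C ∈ chunk m n k := by
  have hL : C ∈ fpAdder m n (fun w => lit (.wire false w)) (fun i => lit (.ea i))
      (fun i => lit (.eb i)) (fun i => lit (.ma i)) (fun i => lit (.mb i)) ↔
      ∃ k, ValidKey m n k ∧ C ∈ sideGates m n false k := mem_fpAdder
  have hR : C ∈ fpAdder m n (fun w => lit (.wire true w)) (fun i => lit (.eb i))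
      (fun i => lit (.ea i)) (fun i => lit (.mb i)) (fun i => lit (.ma i)) ↔
      ∃ k, ValidKey m n k ∧ C ∈ sideGates m n true k := mem_fpAdder
  have hE : C ∈ disagreement m n ↔ ∃ k, ValidKey m n k ∧ C ∈ errGates m n k := by
    simp only [disagreement, Finset.mem_union, Finset.mem_biUnion, Finset.mem_range]
    constructor
    · rintro ((⟨i, hi, h⟩ | ⟨i, hi, h⟩) | h)
      · exact ⟨.errM i, hi, h⟩
      · exact ⟨.errE i, hi, h⟩
      · exact ⟨.big, trivial, h⟩
    · rintro ⟨k, hk, h⟩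
      cases k with
      | big => exact Or.inr h
      | errM i => exact Or.inl (Or.inl ⟨i, hk, h⟩)
      | errE i => exact Or.inl (Or.inr ⟨i, hk, h⟩)
      | _ => simp [errGates] at h
  simp only [commMiter, Finset.mem_union, hL, hR, hE, chunk, mem_keys]
  constructor
  · rintro ((⟨k, hk, h⟩ | ⟨k, hk, h⟩) | ⟨k, hk, h⟩) <;> exact ⟨k, hk, by simp [h]⟩
  · rintro ⟨k, hk, (h | h) | h⟩
    · exact Or.inl (Or.inl ⟨k, hk, h⟩)
    · exact Or.inl (Or.inr ⟨k, hk, h⟩)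
    · exact Or.inr ⟨k, hk, h⟩

end Cover

/-! ### Variables, disjointness and size of the chunks -/

section GateClauses

variable {V : Type*} [DecidableEq V] {C : Clause V} {z : V}

lemma mem_clauseVars_of_mem_ofLists {L : List (List (Literal V))} (h : C ∈ ofLists L)
    (hz : ∀ l ∈ L, z ∈ l.map Prod.fst) : z ∈ clauseVars C := by
  simp only [ofLists, List.mem_toFinset, List.mem_map] at h
  obtain ⟨l, hl, rfl⟩ := h
  obtain ⟨a, ha, rfl⟩ := List.mem_map.1 (hz l hl)
  exact Finset.mem_image_of_mem _ (List.mem_toFinset.2 ha)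

lemma out_mem_constGate {o : Literal V} {b : Bool} (h : C ∈ constGate o b) :
    o.1 ∈ clauseVars C :=
  mem_clauseVars_of_mem_ofLists h (by cases b <;> simp [-List.mem_map])

lemma out_mem_andGate {o : Literal V} {S : List (Literal V)} (h : C ∈ andGate o S) :
    o.1 ∈ clauseVars C := by
  refine mem_clauseVars_of_mem_ofLists h ?_
  rw [List.forall_mem_cons, List.forall_mem_map]
  exact ⟨by rw [List.map_cons]; exact List.mem_cons_self,
    fun a _ => by simp only [List.map_cons, neg_fst]; exact List.mem_cons_self⟩

lemma out_mem_orGate {o : Literal V} {S : List (Literal V)} (h : C ∈ orGate o S) :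
    o.1 ∈ clauseVars C := by
  rw [orGate_eq_andGate] at h
  exact out_mem_andGate (o := neg o) h

lemma mem_xorGate_vars {o a b : Literal V} (h : C ∈ xorGate o a b) :
    o.1 ∈ clauseVars C ∧ a.1 ∈ clauseVars C := by
  constructor <;> exact mem_clauseVars_of_mem_ofLists h (by simp [-List.mem_map])

lemma out_mem_xorGate {o a b : Literal V} (h : C ∈ xorGate o a b) : o.1 ∈ clauseVars C :=
  (mem_xorGate_vars h).1

lemma out_mem_eqGate {o a b : Literal V} (h : C ∈ eqGate o a b) : o.1 ∈ clauseVars C :=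
  out_mem_xorGate (o := neg o) h

lemma out_mem_xor3Gate {o a b c : Literal V} (h : C ∈ xor3Gate o a b c) : o.1 ∈ clauseVars C :=
  mem_clauseVars_of_mem_ofLists h (by simp [-List.mem_map])

lemma out_mem_majGate {o a b c : Literal V} (h : C ∈ majGate o a b c) : o.1 ∈ clauseVars C :=
  mem_clauseVars_of_mem_ofLists h (by simp [-List.mem_map])

lemma out_mem_muxGate {o s t e : Literal V} (h : C ∈ muxGate o s t e) : o.1 ∈ clauseVars C :=
  mem_clauseVars_of_mem_ofLists h (by simp [-List.mem_map])

lemma out_mem_muxZeroGate {o s e : Literal V} (h : C ∈ muxZeroGate o s e) : o.1 ∈ clauseVars C :=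
  mem_clauseVars_of_mem_ofLists h (by simp [-List.mem_map])

lemma out_mem_muxOneGate {o s e : Literal V} (h : C ∈ muxOneGate o s e) : o.1 ∈ clauseVars C :=
  mem_clauseVars_of_mem_ofLists h (by simp [-List.mem_map])

end GateClauses

/-- The chunk that holds the gate with output `w`. -/
def wireKey : Wire → Key
  | .eqBit t | .gtBit t | .ltBit t => .cmp t
  | .pre t => .cmp (t + 1)
  | .gt | .lt | .eq => .big
  | .eLarge i | .eSmall i => .eSel i
  | .mLarge i => .add i
  | .mSmall i => .mSel i
  | .borrow 0 => .borrow0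
  | .borrow (i + 1) => .sub i
  | .diff i => .sub i
  | .align 0 _ => .alignInit
  | .align (j + 1) i => .shift j i
  | .lost j 0 => .lost0 j
  | .lost j (i + 1) => .lost j i
  | .lostNow j => .stick j
  | .sticky 0 => .alignInit
  | .sticky (j + 1) => .stick j
  | .carry 0 => .carry0
  | .carry (i + 1) => .add i
  | .sum i => .add i
  | .norm i => .norm i
  | .gNorm | .rNorm | .rOrS | .sNorm => .normLow
  | .outCarry 0 => .big
  | .outCarry (i + 1) => .eUpd i
  | .eOut i => .eUpd i
  | .lsbOrS | .inc => .rndInit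
  | .rndCarry 0 => .big
  | .rndCarry (i + 1) => .rndInc i
  | .rnd i => .rndInc i
  | .mFinal i => .fShift i
  | .finCarry 0 => .big
  | .finCarry (i + 1) => .eFin i
  | .eFinal i => .eFin i

/-- The chunk in which a variable is defined. -/
def keyOf : Var → Key
  | .wire _ w => wireKey w
  | .errM i => .errM i
  | .errE i => .errE i
  | _ => .big

/-- A point of time after which the variables defined in the chunk no longer occur. Only the wires
of the barrel shifter are short-lived: they expire with the end of the next stage. The point
`time 100 0 0 0` is later than every chunk. -/
def dead (m : ℕ) : Key → Time
  | .lost0 j | .lost j _ | .shift j _ | .stick j =>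
      if j + 1 < m then time 7 (j + 1) 4 0 else time 100 0 0 0
  | _ => time 100 0 0 0

@[simp] lemma W_fst (s : Bool) (w : Wire) : (W s w).1 = .wire s w := rfl

@[simp] lemma keyOf_expo (s : Bool) (i : ℕ) : keyOf (expo s i).1 = .big := by cases s <;> rfl

@[simp] lemma keyOf_mant (s : Bool) (i : ℕ) : keyOf (mant s i).1 = .big := by cases s <;> rfl

/-- The chunk `k` is read neither before the chunk in which the variable `x` is defined nor after
the expiry of `x`. -/
structure InTime (m n : ℕ) (k : Key) (x : Var) : Prop where
  rank_keyOf_le : rank m n (keyOf x) ≤ rank m n k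
  rank_le_dead : rank m n k ≤ dead m (keyOf x)

section ChunkVars

variable {m n : ℕ}

lemma rank_le_top (k : Key) : rank m n k ≤ time 100 0 0 0 := by
  cases k <;> simp [rank]

lemma rank_big_le (k : Key) : rank m n .big ≤ rank m n k := by
  cases k <;> simp [rank]

lemma inTime_of_big {k : Key} {x : Var} (h : keyOf x = .big) : InTime m n k x := by
  constructor <;> rw [h]
  exacts [rank_big_le _, rank_le_top _]

lemma inTime_expo (k : Key) (s : Bool) (i : ℕ) : InTime m n k (expo s i).1 :=
  inTime_of_big (by simp)

lemma inTime_mant (k : Key) (s : Bool) (i : ℕ) : InTime m n k (mant s i).1 :=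
  inTime_of_big (by simp)

lemma inTime_alignBit {k : Key} {s : Bool} {j i : ℕ} (hj : j < m) (h1 : time 7 j 0 0 ≤ rank m n k)
    (h2 : rank m n k ≤ time 7 j 4 0) : InTime m n k (.wire s (alignBit j i)) := by
  constructor
  · refine le_trans ?_ h1
    rcases j with _ | j
    · rcases i with _ | _ | i <;> simp [alignBit, keyOf, wireKey, rank]
    · simp [alignBit, keyOf, wireKey, rank]
  · refine h2.trans ?_
    rcases j with _ | j
    · rcases i with _ | _ | i <;> simp [alignBit, keyOf, wireKey, dead]
    · simp [alignBit, keyOf, wireKey, dead, hj]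

lemma inTime_alignBit_last {k : Key} {s : Bool} {i : ℕ} (h1 : time 8 0 0 0 ≤ rank m n k) :
    InTime m n k (.wire s (alignBit m i)) := by
  constructor
  · refine le_trans ?_ h1
    rcases m with _ | j
    · rcases i with _ | _ | i <;> simp [alignBit, keyOf, wireKey, rank]
    · simp [alignBit, keyOf, wireKey, rank]
  · refine (rank_le_top k).trans ?_
    rcases m with _ | j
    · rcases i with _ | _ | i <;> simp [alignBit, keyOf, wireKey, dead]
    · simp [alignBit, keyOf, wireKey, dead]

lemma inTime_carry {k : Key} {s : Bool} (i : ℕ) (h1 : time 9 0 0 i ≤ rank m n k) :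
    InTime m n k (.wire s (.carry i)) := by
  refine ⟨le_trans ?_ h1, (rank_le_top k).trans ?_⟩ <;> cases i <;>
    simp [keyOf, wireKey, rank, dead]

lemma inTime_borrow {k : Key} {s : Bool} (i : ℕ) (h1 : time 4 0 0 i ≤ rank m n k) :
    InTime m n k (.wire s (.borrow i)) := by
  refine ⟨le_trans ?_ h1, (rank_le_top k).trans ?_⟩ <;> cases i <;>
    simp [keyOf, wireKey, rank, dead]

lemma inTime_sticky {k : Key} {s : Bool} (j : ℕ) (h1 : time 7 j 0 0 ≤ rank m n k) (hj : j < m)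
    (h2 : rank m n k ≤ time 7 j 4 0) : InTime m n k (.wire s (.sticky j)) := by
  refine ⟨le_trans ?_ h1, h2.trans ?_⟩ <;> cases j <;>
    simp [keyOf, wireKey, rank, dead, hj]

lemma inTime_sticky_last {k : Key} {s : Bool} (h1 : time 8 0 0 0 ≤ rank m n k) :
    InTime m n k (.wire s (.sticky m)) := by
  refine ⟨le_trans ?_ h1, (rank_le_top k).trans ?_⟩ <;> cases m <;>
    simp [keyOf, wireKey, rank, dead]

lemma inTime_lost {k : Key} {s : Bool} (j i : ℕ) (h1 : time 7 j 1 i ≤ rank m n k)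
    (h2 : rank m n k ≤ time 7 j 4 0) : InTime m n k (.wire s (.lost j i)) := by
  refine ⟨le_trans ?_ h1, h2.trans ?_⟩ <;> cases i <;>
    simp [keyOf, wireKey, rank, dead] <;> split_ifs <;> simp

lemma inTime_outCarryBit {k : Key} {s : Bool} (i : ℕ) (h1 : time 12 0 0 i ≤ rank m n k) :
    InTime m n k (.wire s (outCarryBit n i)) := by
  cases i with
  | zero => exact inTime_carry _ (le_trans (by simp) h1)
  | succ i =>
    refine ⟨le_trans ?_ h1, (rank_le_top k).trans ?_⟩ <;>
      simp [outCarryBit, keyOf, wireKey, rank, dead]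

lemma inTime_rndCarryBit {k : Key} {s : Bool} (i : ℕ) (h1 : time 14 0 0 i ≤ rank m n k) :
    InTime m n k (.wire s (rndCarryBit i)) := by
  refine ⟨le_trans ?_ h1, (rank_le_top k).trans ?_⟩ <;> cases i <;>
      simp [rndCarryBit, keyOf, wireKey, rank, dead]

lemma inTime_finCarryBit {k : Key} {s : Bool} (i : ℕ) (h1 : time 16 0 0 i ≤ rank m n k) :
    InTime m n k (.wire s (finCarryBit n i)) := by
  cases i with
  | zero => exact inTime_rndCarryBit _ (le_trans (by simp) h1)
  | succ i =>
    refine ⟨le_trans ?_ h1, (rank_le_top k).trans ?_⟩ <;>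
      simp [finCarryBit, keyOf, wireKey, rank, dead]

/-- A variable whose defining chunk is not one of the barrel shifter never expires. -/
lemma inTime_of_le {k : Key} {x : Var} (h : rank m n (keyOf x) ≤ rank m n k)
    (hd : dead m (keyOf x) = time 100 0 0 0) : InTime m n k x :=
  ⟨h, hd ▸ rank_le_top _⟩

set_option linter.unusedTactic false in
set_option linter.unreachableTactic false in
set_option linter.unnecessarySeqFocus false in
lemma inTime_sideGates {k : Key} (hk : ValidKey m n k) (hb : k ≠ .big) {s : Bool} :
    ∀ x ∈ vars (sideGates m n s k), InTime m n k x := by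
  have hpre : ∀ t, t ≤ m → ∀ x ∈ vars (preGate m (W s) t), InTime m n (.cmp t) x := by
    intro t ht
    rcases t with _ | t
    · simp [preGate, vars]
    · simp only [preGate]
      split_ifs <;>
      simp only [mem_vars_andGate, mem_vars_constGate, List.map_cons, List.map_nil, List.mem_cons,
        W_fst, List.not_mem_nil, or_false, or_imp, forall_and, forall_eq]
      · refine ⟨?_, ?_, ?_⟩ <;> refine inTime_of_le ?_ rfl <;>
          simp [keyOf, wireKey, rank] <;> omega
      · exact inTime_of_le le_rfl rfl
  cases k with
  | big => exact absurd rfl hb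
  | errM | errE => simp [sideGates, gates, vars]
  | cmp t =>
    simp only [sideGates, gates, vars_union, Finset.mem_union, or_imp, forall_and]
    refine ⟨?_, hpre t hk⟩
    split_ifs
    · simp only [cmpGates, vars_union, Finset.mem_union, or_imp, forall_and, mem_vars_eqGate,
        mem_vars_andGate, mem_vars_ofLists, List.map_cons, List.map_nil, List.mem_cons, W_fst,
        List.not_mem_nil, forall_eq, neg_fst, List.flatten_cons, List.flatten_nil, List.append_nil,
        List.cons_append, List.nil_append, inTime_expo, IsEmpty.forall_iff, and_true]
      repeat' apply And.intro
      all_goals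
        refine inTime_of_le ?_ rfl
        simp [keyOf, wireKey, rank]
        try omega
    · simp [vars]
  | _ =>
    simp only [ValidKey] at hk
    simp only [sideGates, gates] <;> (try split_ifs) <;>
    simp only [vars_union, Finset.mem_union, or_imp, forall_and, mem_vars_andGate,
      mem_vars_orGate, mem_vars_xorGate, mem_vars_xor3Gate, mem_vars_majGate, mem_vars_muxGate,
      mem_vars_muxZeroGate, mem_vars_muxOneGate, mem_vars_constGate, List.map_cons,
      List.map_nil, List.mem_cons, W_fst, List.not_mem_nil, forall_eq, neg_fst, or_false,
      inTime_expo, inTime_mant, and_true]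
    all_goals (try repeat' apply And.intro)
    all_goals first
      | exact inTime_of_big rfl
      | (refine inTime_carry _ ?_; simp [rank]; done)
      | (refine inTime_sticky_last ?_; simp [rank]; done)
      | (refine inTime_outCarryBit _ ?_; simp [rank]; done)
      | (refine inTime_rndCarryBit _ ?_; simp [rank]; done)
      | (refine inTime_finCarryBit _ ?_; simp [rank]; done)
      | (refine inTime_borrow _ ?_; simp [rank]; done)
      | (refine inTime_sticky _ ?_ hk ?_ <;> simp [rank] <;> done)
      | (refine inTime_lost _ _ ?_ ?_ <;> simp [rank] <;> done)
      | (refine inTime_alignBit hk.1 ?_ ?_ <;> simp [rank] <;> done)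
      | (refine inTime_alignBit_last ?_; simp [rank]; done)
      | exact inTime_of_le le_rfl rfl
      | (refine inTime_of_le ?_ rfl; simp [keyOf, wireKey, rank]; done)
      | (refine ⟨le_rfl, ?_⟩; simp [keyOf, wireKey, dead, rank, alignBit] <;> split_ifs <;>
          simp; done)

lemma inTime_chunk {k : Key} (hk : ValidKey m n k) (hb : k ≠ .big) :
    ∀ x ∈ vars (chunk m n k), InTime m n k x := by
  intro x hx
  simp only [chunk, vars_union, Finset.mem_union] at hx
  rcases hx with (hx | hx) | hx
  · exact inTime_sideGates hk hb x hx
  · exact inTime_sideGates hk hb x hx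
  · cases k <;> simp only [errGates] at hx
    case big => exact absurd rfl hb
    case errM i =>
      rw [mem_vars_xorGate] at hx
      rcases hx with rfl | rfl | rfl
      · exact inTime_of_le le_rfl rfl
      all_goals
        refine inTime_of_le ?_ rfl
        simp [keyOf, wireKey, rank]
    case errE i =>
      rw [mem_vars_xorGate] at hx
      rcases hx with rfl | rfl | rfl
      · exact inTime_of_le le_rfl rfl
      all_goals
        refine inTime_of_le ?_ rfl
        simp [keyOf, wireKey, rank]
    all_goals simp [vars] at hx

lemma rank_le_dead {k : Key} (hk : ValidKey m n k) {x : Var} (hx : x ∈ vars (chunk m n k)) :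
    rank m n k ≤ dead m (keyOf x) := by
  by_cases hb : k = .big
  · subst hb
    refine le_trans (b := time 0 0 0 0) le_rfl ?_
    cases keyOf x <;> simp [dead] <;> split_ifs <;> simp
  · exact (inTime_chunk hk hb x hx).rank_le_dead

/-- Every clause of a chunk contains the output of a gate of that chunk. -/
lemma exists_keyOf_eq {k : Key} (hb : k ≠ .big) {C : Clause Var} (hC : C ∈ chunk m n k) :
    ∃ x ∈ clauseVars C, keyOf x = k := by
  have key : ∀ s, C ∈ sideGates m n s k → ∃ x ∈ clauseVars C, keyOf x = k := by
    intro s h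
    cases k with
    | big => exact absurd rfl hb
    | errM | errE => simp [sideGates, gates] at h
    | cmp t =>
      simp only [sideGates, gates, Finset.mem_union] at h
      rcases h with h | h
      · split_ifs at h
        · simp only [cmpGates, Finset.mem_union] at h
          rcases h with ((h | h) | h) | h
          · exact ⟨_, out_mem_eqGate h, rfl⟩
          · exact ⟨_, out_mem_andGate h, rfl⟩
          · exact ⟨_, out_mem_andGate h, rfl⟩
          · simp only [ofLists, List.mem_toFinset, List.map_cons, List.map_nil, List.mem_cons,
              List.not_mem_nil, or_false] at h
            rcases h with rfl | rfl | rfl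
            · exact ⟨.wire s (.gtBit t), by simp [clauseVars], rfl⟩
            · exact ⟨.wire s (.ltBit t), by simp [clauseVars], rfl⟩
            · exact ⟨.wire s (.eqBit t), by simp [clauseVars], rfl⟩
        · simp at h
      · rcases t with _ | t
        · simp [preGate] at h
        · simp only [preGate] at h
          split_ifs at h
          · exact ⟨_, out_mem_andGate h, rfl⟩
          · exact ⟨_, out_mem_constGate h, rfl⟩
    | borrow0 => exact ⟨_, out_mem_constGate h, rfl⟩
    | eSel i =>
      simp only [sideGates, gates, Finset.mem_union] at h
      rcases h with h | h
      · exact ⟨_, out_mem_muxGate h, rfl⟩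
      · exact ⟨_, out_mem_muxGate h, rfl⟩
    | sub i =>
      simp only [sideGates, gates, Finset.mem_union] at h
      rcases h with h | h
      · exact ⟨_, out_mem_xor3Gate h, rfl⟩
      · exact ⟨_, out_mem_majGate h, rfl⟩
    | mSel i => exact ⟨_, out_mem_muxGate h, rfl⟩
    | alignInit =>
      simp only [sideGates, gates, Finset.mem_union] at h
      rcases h with (h | h) | h
      · exact ⟨_, out_mem_constGate h, rfl⟩
      · exact ⟨_, out_mem_constGate h, rfl⟩
      · exact ⟨_, out_mem_constGate h, rfl⟩
    | lost0 j => exact ⟨_, out_mem_constGate h, rfl⟩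
    | lost j i => exact ⟨_, out_mem_orGate h, rfl⟩
    | shift j i =>
      simp only [sideGates, gates] at h
      split_ifs at h
      · exact ⟨_, out_mem_muxGate h, rfl⟩
      · exact ⟨_, out_mem_muxZeroGate h, rfl⟩
    | stick j =>
      simp only [sideGates, gates, Finset.mem_union] at h
      rcases h with h | h
      · exact ⟨_, out_mem_andGate h, rfl⟩
      · exact ⟨_, out_mem_orGate h, rfl⟩
    | carry0 => exact ⟨_, out_mem_constGate h, rfl⟩
    | add i =>
      simp only [sideGates, gates, Finset.mem_union] at h
      rcases h with h | h | h
      · exact ⟨_, out_mem_muxGate h, rfl⟩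
      · exact ⟨_, out_mem_xor3Gate h, rfl⟩
      · exact ⟨_, out_mem_majGate h, rfl⟩
    | norm i =>
      simp only [sideGates, gates] at h
      split_ifs at h
      · exact ⟨_, out_mem_muxGate h, rfl⟩
      · exact ⟨_, out_mem_muxOneGate h, rfl⟩
    | normLow =>
      simp only [sideGates, gates, Finset.mem_union] at h
      rcases h with ((h | h) | h) | h
      · exact ⟨_, out_mem_muxGate h, rfl⟩
      · exact ⟨_, out_mem_muxGate h, rfl⟩
      · exact ⟨_, out_mem_orGate h, rfl⟩
      · exact ⟨_, out_mem_muxGate h, rfl⟩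
    | eUpd i =>
      simp only [sideGates, gates, Finset.mem_union] at h
      rcases h with h | h
      · exact ⟨_, out_mem_xorGate h, rfl⟩
      · exact ⟨_, out_mem_andGate h, rfl⟩
    | rndInit =>
      simp only [sideGates, gates, Finset.mem_union] at h
      rcases h with h | h
      · exact ⟨_, out_mem_orGate h, rfl⟩
      · exact ⟨_, out_mem_andGate h, rfl⟩
    | rndInc i =>
      simp only [sideGates, gates, Finset.mem_union] at h
      rcases h with h | h
      · exact ⟨_, out_mem_xorGate h, rfl⟩
      · exact ⟨_, out_mem_andGate h, rfl⟩
    | fShift i =>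
      simp only [sideGates, gates] at h
      split_ifs at h
      · exact ⟨_, out_mem_muxGate h, rfl⟩
      · exact ⟨_, out_mem_muxOneGate h, rfl⟩
    | eFin i =>
      simp only [sideGates, gates, Finset.mem_union] at h
      rcases h with h | h
      · exact ⟨_, out_mem_xorGate h, rfl⟩
      · exact ⟨_, out_mem_andGate h, rfl⟩
  simp only [chunk, Finset.mem_union] at hC
  rcases hC with (h | h) | h
  · exact key _ h
  · exact key _ h
  · cases k <;> simp only [errGates] at h
    case big => exact absurd rfl hb
    case errM => exact ⟨_, out_mem_xorGate h, rfl⟩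
    case errE => exact ⟨_, out_mem_xorGate h, rfl⟩
    all_goals simp at h

/-- For few exponent bits the wide clauses of the comparison are as short as the others, but they
differ from them in the sign of the literal of `gt`, `lt` or `eq`. -/
lemma notMem_chunk_of_mem_topClauses {k : Key} (hb : k ≠ .big) {s : Bool} {C : Clause Var}
    (h : C ∈ topClauses m (W s)) : C ∉ chunk m n k := by
  intro hC
  have hkey : ∀ x ∈ clauseVars C, keyOf x = .big ∨ ∃ t, keyOf x = .cmp t := by
    intro x hx
    simp only [topClauses, Finset.mem_insert, Finset.mem_singleton, wide] at h
    rcases h with rfl | rfl | rfl <;>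
    · simp only [clauseVars, Finset.image_union, Finset.mem_union, Finset.mem_image,
        List.mem_toFinset, List.mem_singleton, exists_eq_left, Finset.mem_range] at hx
      rcases hx with rfl | ⟨_, ⟨i, -, rfl⟩, rfl⟩
      · exact Or.inl rfl
      · exact Or.inr ⟨i, rfl⟩
  obtain ⟨x, hx, hxk⟩ := exists_keyOf_eq hb hC
  rcases hkey x hx with h1 | ⟨t, h1⟩
  · exact hb (hxk.symm.trans h1)
  obtain rfl : k = .cmp t := hxk.symm.trans h1
  have hlit : (.wire s .gt, false) ∈ C ∨ (.wire s .lt, false) ∈ C ∨ (.wire s .eq, true) ∈ C := by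
    simp only [topClauses, Finset.mem_insert, Finset.mem_singleton, wide] at h
    rcases h with rfl | rfl | rfl <;> simp [W, lit, neg]
  have hvar : ∀ w b, (Var.wire s w, b) ∈ C → Var.wire s w ∈ clauseVars C := fun w b h =>
    Finset.mem_image_of_mem Prod.fst h
  have hside : ∀ s', C ∈ sideGates m n s' (.cmp t) → False := by
    intro s' hC
    have e1 : ∀ i, (Var.wire s .gt) ≠ (expo s' i).1 ∧ (Var.wire s .lt) ≠ (expo s' i).1 ∧
      (Var.wire s .eq) ≠ (expo s' i).1 := by cases s' <;> simp [expo, lit]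
    have e2 : ∀ i, (Var.wire s .gt) ≠ (expo (!s') i).1 ∧ (Var.wire s .lt) ≠ (expo (!s') i).1 ∧
      (Var.wire s .eq) ≠ (expo (!s') i).1 := by cases s' <;> simp [expo, lit]
    have hno : ∀ G : CNF Var, C ∈ G → (.wire s .gt ∉ vars G ∧ .wire s .lt ∉ vars G ∧
        .wire s .eq ∉ vars G) → False := by
      intro G hG ⟨g1, g2, g3⟩
      rcases hlit with h | h | h
      · exact g1 (clauseVars_subset_vars hG (hvar _ _ h))
      · exact g2 (clauseVars_subset_vars hG (hvar _ _ h))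
      · exact g3 (clauseVars_subset_vars hG (hvar _ _ h))
    simp only [sideGates, gates, Finset.mem_union] at hC
    rcases hC with h | h
    · split_ifs at h
      · simp only [cmpGates, Finset.mem_union] at h
        rcases h with ((h | h) | h) | h
        · exact hno _ h (by simp [mem_vars_eqGate, e1, e2])
        · exact hno _ h (by simp [-List.mem_map, mem_vars_andGate, e1, e2])
        · exact hno _ h (by simp [-List.mem_map, mem_vars_andGate, e1, e2])
        · simp only [ofLists, List.mem_toFinset, List.map_cons, List.map_nil, List.mem_cons,
            List.not_mem_nil, or_false] at h
          rcases h with rfl | rfl | rfl <;> simp [W, lit, neg] at hlit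
      · simp at h
    · rcases t with _ | t
      · simp [preGate] at h
      · simp only [preGate] at h
        split_ifs at h
        · exact hno _ h (by simp [-List.mem_map, mem_vars_andGate])
        · exact hno _ h (by simp [mem_vars_constGate])
  simp only [chunk, Finset.mem_union] at hC
  rcases hC with (h | h) | h
  · exact hside _ h
  · exact hside _ h
  · simp [errGates] at h

lemma errClause_notMem_chunk {k : Key} (hb : k ≠ .big) : errClause n m ∉ chunk m n k := by
  intro hC
  have hkey : ∀ x ∈ clauseVars (errClause n m), (∃ i, x = .errM i) ∨ ∃ i, x = .errE i := by
    intro x hx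
    simp only [errClause, clauseVars, Finset.image_union, Finset.mem_union, Finset.mem_image] at hx
    rcases hx with ⟨_, ⟨i, -, rfl⟩, rfl⟩ | ⟨_, ⟨i, -, rfl⟩, rfl⟩
    · exact Or.inl ⟨i, rfl⟩
    · exact Or.inr ⟨i, rfl⟩
  obtain ⟨x, hx, hxk⟩ := exists_keyOf_eq hb hC
  rcases hkey x hx with ⟨i, rfl⟩ | ⟨i, rfl⟩ <;>
  · simp only [keyOf] at hxk
    subst hxk
    simp only [chunk, sideGates, gates, errGates, Finset.mem_union, Finset.notMem_empty,
      false_or] at hC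
    rcases hkey _ (mem_xorGate_vars hC).2 with ⟨i, h⟩ | ⟨i, h⟩ <;> simp at h

/-- The output of a gate dates every clause of its encoding: two chunks with a common clause would
each have to come no later than the other. -/
lemma chunk_disjoint : ∀ k ∈ keys m n, ∀ l ∈ keys m n, k ≠ l →
    Disjoint (chunk m n k) (chunk m n l) := by
  have hbig : ∀ l, l ≠ .big → Disjoint (chunk m n .big) (chunk m n l) := by
    intro l hl
    rw [Finset.disjoint_left]
    intro C hC
    simp only [chunk, sideGates, gates, errGates, Finset.mem_union, Finset.mem_singleton] at hC
    rcases hC with (h | h) | rfl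
    · exact notMem_chunk_of_mem_topClauses hl h
    · exact notMem_chunk_of_mem_topClauses hl h
    · exact errClause_notMem_chunk hl
  intro k hk l hl hkl
  by_cases hkb : k = .big
  · subst hkb; exact hbig l hkl.symm
  by_cases hlb : l = .big
  · subst hlb; exact (hbig k hkl).symm
  rw [mem_keys] at hk hl
  rw [Finset.disjoint_left]
  intro C hCk hCl
  obtain ⟨x, hx, hxk⟩ := exists_keyOf_eq hkb hCk
  obtain ⟨y, hy, hyl⟩ := exists_keyOf_eq hlb hCl
  have h1 := (inTime_chunk hl hlb x (clauseVars_subset_vars hCl hx)).rank_keyOf_le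
  have h2 := (inTime_chunk hk hkb y (clauseVars_subset_vars hCk hy)).rank_keyOf_le
  rw [hxk] at h1
  rw [hyl] at h2
  exact hkl (rank_inj hk hl (le_antisymm h1 h2))

lemma isSmall_sideGates {k : Key} (hb : k ≠ .big) (s : Bool) :
    IsSmall 200 (sideGates m n s k) := by
  have h0 : IsSmall 40 (∅ : CNF Var) := isSmall_empty.mono (by norm_num)
  cases k with
  | big => exact absurd rfl hb
  | cmp t =>
    have h1 : IsSmall 160 (if t < m then cmpGates (W s) (expo s) (expo (!s)) t else ∅) := by
      split_ifs
      · have h2 := isSmall_ofLists [[W s .gt, neg (W s (.gtBit t))],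
          [W s .lt, neg (W s (.ltBit t))], [neg (W s .eq), W s (.eqBit t)]]
        exact ((((isSmall_eqGate _ _ _).union (isSmall_andGate (by simp))).union
          (isSmall_andGate (by simp))).union (h2.mono (b := 40) (by simp))).mono (by norm_num)
      · exact h0.mono (by norm_num)
    refine IsSmall.union (a := 160) (b := 40) h1 ?_
    rcases t with _ | t
    · exact h0
    · simp only [preGate]
      split_ifs
      exacts [isSmall_andGate (by simp), isSmall_constGate _ _]
  | borrow0 => exact (isSmall_constGate _ _).mono (by norm_num)
  | eSel i => exact ((isSmall_muxGate _ _ _ _).union (isSmall_muxGate _ _ _ _)).mono (by norm_num)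
  | sub i => exact ((isSmall_xor3Gate _ _ _ _).union (isSmall_majGate _ _ _ _)).mono (by norm_num)
  | mSel i => exact (isSmall_muxGate _ _ _ _).mono (by norm_num)
  | alignInit =>
    exact (((isSmall_constGate _ _).union (isSmall_constGate _ _)).union
      (isSmall_constGate _ _)).mono (by norm_num)
  | lost0 j => exact (isSmall_constGate _ _).mono (by norm_num)
  | lost j i => exact (isSmall_orGate (by simp)).mono (by norm_num)
  | shift j i =>
    simp only [sideGates, gates]
    split_ifs
    exacts [(isSmall_muxGate _ _ _ _).mono (by norm_num),
      (isSmall_muxZeroGate _ _ _).mono (by norm_num)]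
  | stick j =>
    exact ((isSmall_andGate (by simp)).union (isSmall_orGate (by simp))).mono (by norm_num)
  | carry0 => exact (isSmall_constGate _ _).mono (by norm_num)
  | add i =>
    exact ((isSmall_muxGate _ _ _ _).union
      ((isSmall_xor3Gate _ _ _ _).union (isSmall_majGate _ _ _ _))).mono (by norm_num)
  | norm i =>
    simp only [sideGates, gates]
    split_ifs
    exacts [(isSmall_muxGate _ _ _ _).mono (by norm_num),
      (isSmall_muxOneGate _ _ _).mono (by norm_num)]
  | normLow =>
    exact ((((isSmall_muxGate _ _ _ _).union (isSmall_muxGate _ _ _ _)).union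
      (isSmall_orGate (by simp))).union (isSmall_muxGate _ _ _ _)).mono (by norm_num)
  | eUpd i => exact ((isSmall_xorGate _ _ _).union (isSmall_andGate (by simp))).mono (by norm_num)
  | rndInit =>
    exact ((isSmall_orGate (by simp)).union (isSmall_andGate (by simp))).mono (by norm_num)
  | rndInc i =>
    exact ((isSmall_xorGate _ _ _).union (isSmall_andGate (by simp))).mono (by norm_num)
  | fShift i =>
    simp only [sideGates, gates]
    split_ifs
    exacts [(isSmall_muxGate _ _ _ _).mono (by norm_num),
      (isSmall_muxOneGate _ _ _).mono (by norm_num)]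
  | eFin i => exact ((isSmall_xorGate _ _ _).union (isSmall_andGate (by simp))).mono (by norm_num)
  | errM i => exact h0.mono (by norm_num)
  | errE i => exact h0.mono (by norm_num)

lemma isSmall_chunk {k : Key} (hb : k ≠ .big) : IsSmall 440 (chunk m n k) := by
  refine ((isSmall_sideGates hb false).union (isSmall_sideGates hb true)).union (b := 40) ?_
  cases k with
  | big => exact absurd rfl hb
  | errM i => exact isSmall_xorGate _ _ _
  | errE i => exact isSmall_xorGate _ _ _
  | _ => exact isSmall_empty.mono (by norm_num)

lemma card_chunk_le (k : Key) : (chunk m n k).card ≤ 440 := by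
  by_cases hb : k = .big
  · subst hb
    have h3 : ∀ s, (topClauses m (W s)).card ≤ 3 := fun s => Finset.card_le_three
    simp only [chunk, sideGates, gates, errGates]
    have h4 := Finset.card_union_le (topClauses m (W false) ∪ topClauses m (W true))
      {errClause n m}
    have h5 := Finset.card_union_le (topClauses m (W false)) (topClauses m (W true))
    have h6 := h3 false
    have h7 := h3 true
    rw [Finset.card_singleton] at h4
    omega
  · exact (isSmall_chunk hb).1

end ChunkVars

/-! ### The facts derived from the chunks -/

section Pieces

/-- The wire has the same value in both copies. -/
def eqv (w : Wire) : CNF Var :=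
  ofLists [[neg (W false w), W true w], [W false w, neg (W true w)]]

/-- If the exponents are equal, that is, if `gt` holds in neither copy, then the wire is `0` in the
left copy. -/
def zeroE (w : Wire) : CNF Var := ofLists [[W false .gt, W true .gt, neg (W false w)]]

/-- If the exponents differ, the wire has the same value in both copies. -/
def condEqv (w : Wire) : CNF Var :=
  ofLists [[neg (W false .gt), neg (W false w), W true w],
    [neg (W false .gt), W false w, neg (W true w)],
    [neg (W true .gt), neg (W false w), W true w], [neg (W true .gt), W false w, neg (W true w)]]

/-- If the exponents are equal, the wire carries bit `i` of the mantissa of the first operand. -/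
def condInput (i : ℕ) (w : Wire) : CNF Var :=
  ofLists [[W false .gt, W true .gt, neg (W false w), mant false i],
    [W false .gt, W true .gt, W false w, neg (mant false i)],
    [W false .gt, W true .gt, neg (W true w), mant true i],
    [W false .gt, W true .gt, W true w, neg (mant true i)]]

/-- At most one of the copies finds its first exponent to be the larger one. -/
def excl : CNF Var := ofLists [[neg (W false .gt), neg (W true .gt)]]

/-- What is known about bit `i` of the word of the barrel shifter before stage `j`: if the exponents
differ, it is the same in both copies; if they are equal, it has not been moved. -/
def alFact (j : ℕ) : ℕ → CNF Var
  | 0 => eqv (alignBit j 0) ∪ zeroE (alignBit j 0)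
  | 1 => eqv (alignBit j 1) ∪ zeroE (alignBit j 1)
  | i + 2 => condEqv (alignBit j (i + 2)) ∪ condInput i (alignBit j (i + 2))

/-- If the exponents are equal, so are bits `i` of the two selected exponents of the left copy. -/
def sameSel (i : ℕ) : CNF Var :=
  ofLists [[W false .gt, W true .gt, neg (W false (.eLarge i)), W false (.eSmall i)],
    [W false .gt, W true .gt, W false (.eLarge i), neg (W false (.eSmall i))]]

/-- If the comparison finds neither exponent to be the larger one, their bits `t` agree. -/
def sameExpo (t : ℕ) : CNF Var :=
  ofLists [[W false .gt, W false .lt, neg (expo false t), expo true t],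
    [W false .gt, W false .lt, expo false t, neg (expo true t)]]

/-- If a copy finds its first exponent to be the larger one, the other copy finds its second
exponent to be the larger one, unless this is due to one of the bits below `t`. -/
def gtToLt (s : Bool) (t : ℕ) : Clause Var :=
  wide [neg (W s .gt), W (!s) .lt] (fun i => W s (.gtBit i)) t

/-- The counterpart of `gtToLt` for the second exponent. -/
def ltToGt (s : Bool) (t : ℕ) : Clause Var :=
  wide [neg (W s .lt), W (!s) .gt] (fun i => W s (.ltBit i)) t

/-- The comparison does not find both exponents to be the larger one, unless this is due to the bits
below `t`. -/
def notBoth (t : ℕ) : Clause Var :=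
  wide [neg (W false .gt), neg (W false .lt)] (fun i => W false (.gtBit i)) t ∪
    wide [] (fun i => W false (.ltBit i)) t

/-- If the exponents agree above bit `t`, the first one can only be larger because of the bits up
to `t`. -/
def gtBelow (t : ℕ) : Clause Var :=
  wide [neg (W false .gt), neg (W false (.pre t))] (fun i => W false (.gtBit i)) (t + 1)

/-- The counterpart of `gtBelow` for the second exponent. -/
def ltBelow (t : ℕ) : Clause Var :=
  wide [neg (W false .lt), neg (W false (.pre t))] (fun i => W false (.ltBit i)) (t + 1)

/-- If the exponents differ above bit `t`, one of them is found to be larger. -/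
def decided (t : ℕ) : CNF Var := ofLists [[W false (.pre t), W false .gt, W false .lt]]

/-- The facts about the part of the comparison above bit `t`, phrased with `pre (t - 1)`. -/
def preFacts : ℕ → CNF Var
  | 0 => ∅
  | t + 1 => eqv (.pre t) ∪ decided t ∪ {gtBelow t, ltBelow t}

/-- The facts about the results of the comparison when the bits from `t` on have been read. -/
def resultFacts (t : ℕ) : CNF Var :=
  {gtToLt false t, gtToLt true t, ltToGt false t, ltToGt true t, notBoth t}

/-- The clauses derived from a chunk. They express that the two copies agree, and that the smaller
mantissa is not shifted if the exponents are equal. -/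
def facts (m n : ℕ) : Key → CNF Var
  | .big => chunk m n .big
  | .cmp t => resultFacts t ∪ preFacts t ∪ if t < m then sameExpo t else ∅
  | .borrow0 => (eqv (.borrow 0) ∪ zeroE (.borrow 0)) ∪ excl
  | .eSel i => eqv (.eLarge i) ∪ eqv (.eSmall i) ∪ sameSel i
  | .sub i => (eqv (.diff i) ∪ zeroE (.diff i)) ∪ (eqv (.borrow (i + 1)) ∪ zeroE (.borrow (i + 1)))
  | .mSel i => alFact 0 (i + 2)
  | .alignInit => alFact 0 0 ∪ alFact 0 1 ∪ (eqv (.sticky 0) ∪ zeroE (.sticky 0))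
  | .lost0 j => condEqv (.lost j 0)
  | .lost j i => condEqv (.lost j (i + 1))
  | .shift j i => alFact (j + 1) i
  | .stick j => eqv (.sticky (j + 1)) ∪ zeroE (.sticky (j + 1))
  | .carry0 => eqv (.carry 0)
  | .add i => eqv (.sum i) ∪ eqv (.carry (i + 1))
  | .norm i => eqv (.norm i)
  | .normLow => eqv .rNorm ∪ eqv .sNorm
  | .eUpd i => eqv (.eOut i) ∪ eqv (outCarryBit n (i + 1))
  | .rndInit => eqv .inc
  | .rndInc i => eqv (.rnd i) ∪ eqv (rndCarryBit (i + 1))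
  | .fShift i => eqv (.mFinal i)
  | .eFin i => eqv (.eFinal i) ∪ eqv (finCarryBit n (i + 1))
  | .errM t => {errClause t m}
  | .errE t => {errClause 0 t}

variable {σ : Var → Bool} {w : Wire} {x : Var} {i t : ℕ} {s : Bool}

@[simp] lemma val_W : val σ (W s w) = σ (.wire s w) := by simp [val, W, lit]

lemma satisfies_eqv : Satisfies σ (eqv w) ↔ σ (.wire false w) = σ (.wire true w) := by
  simp [eqv, satisfies_ofLists, -List.any_eq_true]
  cases σ (.wire false w) <;> cases σ (.wire true w) <;> simp

lemma satisfies_zeroE : Satisfies σ (zeroE w) ↔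
    (σ (.wire false .gt) = false → σ (.wire true .gt) = false → σ (.wire false w) = false) := by
  simp [zeroE, satisfies_ofLists, -List.any_eq_true]
  cases σ (.wire false .gt) <;> cases σ (.wire true .gt) <;> simp

lemma satisfies_condEqv : Satisfies σ (condEqv w) ↔
    (σ (.wire false .gt) = true ∨ σ (.wire true .gt) = true →
      σ (.wire false w) = σ (.wire true w)) := by
  simp [condEqv, satisfies_ofLists, -List.any_eq_true]
  cases σ (.wire false .gt) <;> cases σ (.wire true .gt) <;> cases σ (.wire false w) <;>
    cases σ (.wire true w) <;> simp

lemma satisfies_condInput : Satisfies σ (condInput i w) ↔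
    (σ (.wire false .gt) = false → σ (.wire true .gt) = false →
      σ (.wire false w) = val σ (mant false i) ∧ σ (.wire true w) = val σ (mant true i)) := by
  simp [condInput, satisfies_ofLists, -List.any_eq_true]
  cases σ (.wire false .gt) <;> cases σ (.wire true .gt) <;> cases σ (.wire false w) <;>
    cases σ (.wire true w) <;> simp

lemma satisfies_excl : Satisfies σ excl ↔
    (σ (.wire false .gt) = false ∨ σ (.wire true .gt) = false) := by
  simp [excl, satisfies_ofLists, -List.any_eq_true]

lemma satisfies_sameSel : Satisfies σ (sameSel i) ↔
    (σ (.wire false .gt) = false → σ (.wire true .gt) = false →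
      σ (.wire false (.eLarge i)) = σ (.wire false (.eSmall i))) := by
  simp [sameSel, satisfies_ofLists, -List.any_eq_true]
  cases σ (.wire false .gt) <;> cases σ (.wire true .gt) <;> cases σ (.wire false (.eLarge i)) <;>
    cases σ (.wire false (.eSmall i)) <;> simp

lemma satisfies_sameExpo : Satisfies σ (sameExpo i) ↔
    (σ (.wire false .gt) = false → σ (.wire false .lt) = false →
      val σ (expo false i) = val σ (expo true i)) := by
  simp [sameExpo, satisfies_ofLists, -List.any_eq_true]
  cases σ (.wire false .gt) <;> cases σ (.wire false .lt) <;> cases val σ (expo false i) <;>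
    cases val σ (expo true i) <;> simp

lemma satisfies_decided : Satisfies σ (decided i) ↔
    (σ (.wire false (.pre i)) = true ∨ σ (.wire false .gt) = true ∨
      σ (.wire false .lt) = true) := by
  simp [decided, satisfies_ofLists, -List.any_eq_true]

lemma satisfies_singleton {C : Clause Var} : Satisfies σ {C} ↔ ∃ l ∈ C, val σ l = true := by
  simp only [Satisfies, Finset.mem_singleton, forall_eq, val, beq_iff_eq]

lemma forall_mem_vars_eqv {P : Var → Prop} :
    (∀ x ∈ vars (eqv w), P x) ↔ ∀ s, P (.wire s w) := by
  simp [eqv, mem_vars_ofLists, -List.mem_map, or_imp, forall_and]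
  tauto

lemma forall_mem_vars_zeroE {P : Var → Prop} :
    (∀ x ∈ vars (zeroE w), P x) ↔ (∀ s, P (.wire s .gt)) ∧ P (.wire false w) := by
  simp [zeroE, mem_vars_ofLists, -List.mem_map, or_imp, forall_and]
  tauto

lemma forall_mem_vars_condEqv {P : Var → Prop} :
    (∀ x ∈ vars (condEqv w), P x) ↔ (∀ s, P (.wire s .gt)) ∧ ∀ s, P (.wire s w) := by
  simp [condEqv, mem_vars_ofLists, -List.mem_map, or_imp, forall_and]
  tauto

lemma forall_mem_vars_condInput {P : Var → Prop} :
    (∀ x ∈ vars (condInput i w), P x) ↔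
      (∀ s, P (.wire s .gt)) ∧ (∀ s, P (.wire s w)) ∧ ∀ s, P (mant s i).1 := by
  simp [condInput, mem_vars_ofLists, -List.mem_map, or_imp, forall_and]
  tauto

lemma forall_mem_vars_excl {P : Var → Prop} :
    (∀ x ∈ vars excl, P x) ↔ ∀ s, P (.wire s .gt) := by
  simp [excl, mem_vars_ofLists, -List.mem_map, or_imp, forall_and]

lemma forall_mem_vars_sameSel {P : Var → Prop} :
    (∀ x ∈ vars (sameSel i), P x) ↔
      (∀ s, P (.wire s .gt)) ∧ P (.wire false (.eLarge i)) ∧ P (.wire false (.eSmall i)) := by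
  simp [sameSel, mem_vars_ofLists, -List.mem_map, or_imp, forall_and]
  tauto

lemma forall_mem_vars_sameExpo {P : Var → Prop} :
    (∀ x ∈ vars (sameExpo i), P x) ↔
      P (.wire false .gt) ∧ P (.wire false .lt) ∧ ∀ s, P (expo s i).1 := by
  simp [sameExpo, mem_vars_ofLists, -List.mem_map, or_imp, forall_and]
  tauto

lemma forall_mem_vars_decided {P : Var → Prop} :
    (∀ x ∈ vars (decided i), P x) ↔
      P (.wire false (.pre i)) ∧ P (.wire false .gt) ∧ P (.wire false .lt) := by
  simp [decided, mem_vars_ofLists, -List.mem_map, or_imp, forall_and]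

lemma forall_mem_vars_union {F G : CNF Var} {P : Var → Prop} :
    (∀ x ∈ vars (F ∪ G), P x) ↔ (∀ x ∈ vars F, P x) ∧ ∀ x ∈ vars G, P x := by
  simp [vars_union, or_imp, forall_and]

lemma isSmall_eqv (w : Wire) : IsSmall 40 (eqv w) := (isSmall_ofLists _).mono (by simp)
lemma isSmall_zeroE (w : Wire) : IsSmall 40 (zeroE w) := (isSmall_ofLists _).mono (by simp)
lemma isSmall_condEqv (w : Wire) : IsSmall 40 (condEqv w) := (isSmall_ofLists _).mono (by simp)
lemma isSmall_condInput (i : ℕ) (w : Wire) : IsSmall 40 (condInput i w) :=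
  (isSmall_ofLists _).mono (by simp)
lemma isSmall_excl : IsSmall 40 excl := (isSmall_ofLists _).mono (by simp)
lemma isSmall_sameSel (i : ℕ) : IsSmall 40 (sameSel i) := (isSmall_ofLists _).mono (by simp)
lemma isSmall_sameExpo (i : ℕ) : IsSmall 40 (sameExpo i) := (isSmall_ofLists _).mono (by simp)
lemma isSmall_decided (i : ℕ) : IsSmall 40 (decided i) := (isSmall_ofLists _).mono (by simp)
lemma isSmall_alFact (j i : ℕ) : IsSmall 80 (alFact j i) := by
  rcases i with _ | _ | i
  exacts [(isSmall_eqv _).union (isSmall_zeroE _), (isSmall_eqv _).union (isSmall_zeroE _),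
    (isSmall_condEqv _).union (isSmall_condInput _ _)]

lemma forall_mem_vars_alFact {j i : ℕ} {P : Var → Prop} (h1 : ∀ s, P (.wire s .gt))
    (h2 : ∀ s, P (.wire s (alignBit j i))) (h3 : 2 ≤ i → ∀ s, P (mant s (i - 2)).1) :
    ∀ x ∈ vars (alFact j i), P x := by
  rcases i with _ | _ | i
  · exact forall_mem_vars_union.2 ⟨forall_mem_vars_eqv.2 h2, forall_mem_vars_zeroE.2 ⟨h1, h2 _⟩⟩
  · exact forall_mem_vars_union.2 ⟨forall_mem_vars_eqv.2 h2, forall_mem_vars_zeroE.2 ⟨h1, h2 _⟩⟩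
  · exact forall_mem_vars_union.2 ⟨forall_mem_vars_condEqv.2 ⟨h1, h2⟩,
      forall_mem_vars_condInput.2 ⟨h1, h2, h3 (by omega)⟩⟩

/-- The semantic content of `alFact`, in a form that treats all positions alike: the bit is the same
in both copies if the exponents differ, and equal to `a` on the left and `b` on the right if they do
not. -/
lemma satisfies_alFact {j i : ℕ} : Satisfies σ (alFact j i) ↔
    (σ (.wire false .gt) = true ∨ σ (.wire true .gt) = true →
      σ (.wire false (alignBit j i)) = σ (.wire true (alignBit j i))) ∧
    (σ (.wire false .gt) = false → σ (.wire true .gt) = false →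
      σ (.wire false (alignBit j i)) = (if 2 ≤ i then val σ (mant false (i - 2)) else false) ∧
      σ (.wire true (alignBit j i)) = (if 2 ≤ i then val σ (mant true (i - 2)) else false)) := by
  rcases i with _ | _ | i
  · simp only [alFact, satisfies_union, satisfies_eqv, satisfies_zeroE]
    cases σ (.wire false .gt) <;> cases σ (.wire true .gt) <;> simp
    cases σ (.wire false (alignBit j 0)) <;> cases σ (.wire true (alignBit j 0)) <;> simp
  · simp only [alFact, satisfies_union, satisfies_eqv, satisfies_zeroE]
    cases σ (.wire false .gt) <;> cases σ (.wire true .gt) <;> simp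
    cases σ (.wire false (alignBit j 1)) <;> cases σ (.wire true (alignBit j 1)) <;> simp
  · simp only [alFact, satisfies_union, satisfies_condEqv, satisfies_condInput]
    simp

lemma exists_mem_wide {base : List (Literal Var)} {f : ℕ → Literal Var} :
    (∃ l ∈ wide base f t, val σ l = true) ↔
      base.any (val σ) = true ∨ ∃ i < t, val σ (f i) = true := by
  simp only [wide, Finset.mem_union, List.mem_toFinset, Finset.mem_image, Finset.mem_range,
    or_and_right, exists_or, List.any_eq_true]
  exact or_congr Iff.rfl ⟨fun ⟨l, ⟨i, hi, h⟩, h'⟩ => ⟨i, hi, h ▸ h'⟩,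
    fun ⟨i, hi, h⟩ => ⟨_, ⟨i, hi, rfl⟩, h⟩⟩

lemma satisfies_gtToLt : Satisfies σ {gtToLt s t} ↔ (σ (.wire s .gt) = true →
    σ (.wire (!s) .lt) = true ∨ ∃ i < t, σ (.wire s (.gtBit i)) = true) := by
  rw [satisfies_singleton, gtToLt, exists_mem_wide]
  cases h : σ (.wire s .gt) <;> simp [-List.any_eq_true, h]

lemma satisfies_ltToGt : Satisfies σ {ltToGt s t} ↔ (σ (.wire s .lt) = true →
    σ (.wire (!s) .gt) = true ∨ ∃ i < t, σ (.wire s (.ltBit i)) = true) := by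
  rw [satisfies_singleton, ltToGt, exists_mem_wide]
  cases h : σ (.wire s .lt) <;> simp [-List.any_eq_true, h]

lemma satisfies_notBoth : Satisfies σ {notBoth t} ↔
    (σ (.wire false .gt) = true → σ (.wire false .lt) = true →
      ∃ i < t, σ (.wire false (.gtBit i)) = true ∨ σ (.wire false (.ltBit i)) = true) := by
  rw [satisfies_singleton, notBoth]
  simp only [Finset.mem_union, or_and_right, exists_or, exists_mem_wide, and_or_left]
  cases h : σ (.wire false .gt) <;> cases h' : σ (.wire false .lt) <;>
    simp [-List.any_eq_true, h, h']

lemma satisfies_gtBelow : Satisfies σ {gtBelow t} ↔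
    (σ (.wire false .gt) = true → σ (.wire false (.pre t)) = true →
      ∃ i < t + 1, σ (.wire false (.gtBit i)) = true) := by
  rw [satisfies_singleton, gtBelow, exists_mem_wide]
  cases h : σ (.wire false .gt) <;> cases h' : σ (.wire false (.pre t)) <;>
    simp [-List.any_eq_true, h, h']

lemma satisfies_ltBelow : Satisfies σ {ltBelow t} ↔
    (σ (.wire false .lt) = true → σ (.wire false (.pre t)) = true →
      ∃ i < t + 1, σ (.wire false (.ltBit i)) = true) := by
  rw [satisfies_singleton, ltBelow, exists_mem_wide]
  cases h : σ (.wire false .lt) <;> cases h' : σ (.wire false (.pre t)) <;>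
    simp [-List.any_eq_true, h, h']

lemma vars_singleton (C : Clause Var) : vars {C} = clauseVars C := by
  simp [vars, clauseVars]

lemma forall_mem_clauseVars_wide {base : List (Literal Var)} {f : ℕ → Literal Var}
    {P : Var → Prop} : (∀ x ∈ clauseVars (wide base f t), P x) ↔
      (∀ l ∈ base, P l.1) ∧ ∀ i < t, P (f i).1 := by
  simp only [wide, clauseVars, Finset.forall_mem_image, Finset.mem_union, or_imp, forall_and,
    List.mem_toFinset, Finset.mem_range]

lemma forall_mem_vars_gtToLt {P : Var → Prop} : (∀ x ∈ vars {gtToLt s t}, P x) ↔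
    P (.wire s .gt) ∧ P (.wire (!s) .lt) ∧ ∀ i < t, P (.wire s (.gtBit i)) := by
  rw [vars_singleton, gtToLt, forall_mem_clauseVars_wide]
  simp [and_assoc]

lemma forall_mem_vars_ltToGt {P : Var → Prop} : (∀ x ∈ vars {ltToGt s t}, P x) ↔
    P (.wire s .lt) ∧ P (.wire (!s) .gt) ∧ ∀ i < t, P (.wire s (.ltBit i)) := by
  rw [vars_singleton, ltToGt, forall_mem_clauseVars_wide]
  simp [and_assoc]

lemma forall_mem_vars_notBoth {P : Var → Prop} : (∀ x ∈ vars {notBoth t}, P x) ↔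
    P (.wire false .gt) ∧ P (.wire false .lt) ∧ (∀ i < t, P (.wire false (.gtBit i))) ∧
      ∀ i < t, P (.wire false (.ltBit i)) := by
  have : clauseVars (notBoth t) = clauseVars (wide [neg (W false .gt), neg (W false .lt)]
      (fun i => W false (.gtBit i)) t) ∪ clauseVars (wide [] (fun i => W false (.ltBit i)) t) := by
    simp [clauseVars, notBoth, Finset.image_union]
  simp only [vars_singleton, this, Finset.mem_union, or_imp, forall_and, forall_mem_clauseVars_wide]
  simp [and_assoc]

lemma forall_mem_vars_gtBelow {P : Var → Prop} : (∀ x ∈ vars {gtBelow t}, P x) ↔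
    P (.wire false .gt) ∧ P (.wire false (.pre t)) ∧
      ∀ i < t + 1, P (.wire false (.gtBit i)) := by
  rw [vars_singleton, gtBelow, forall_mem_clauseVars_wide]
  simp [and_assoc]

lemma forall_mem_vars_ltBelow {P : Var → Prop} : (∀ x ∈ vars {ltBelow t}, P x) ↔
    P (.wire false .lt) ∧ P (.wire false (.pre t)) ∧
      ∀ i < t + 1, P (.wire false (.ltBit i)) := by
  rw [vars_singleton, ltBelow, forall_mem_clauseVars_wide]
  simp [and_assoc]

lemma resultFacts_eq : resultFacts t =
    {gtToLt false t} ∪ {gtToLt true t} ∪ {ltToGt false t} ∪ {ltToGt true t} ∪ {notBoth t} := by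
  ext C
  simp [resultFacts]

/-- When all bits have been read, the comparison is known to be symmetric. -/
lemma satisfies_resultFacts_zero : Satisfies σ (resultFacts 0) ↔
    σ (.wire false .gt) = σ (.wire true .lt) ∧ σ (.wire true .gt) = σ (.wire false .lt) ∧
      (σ (.wire false .gt) = false ∨ σ (.wire false .lt) = false) := by
  simp only [resultFacts_eq, satisfies_union, satisfies_gtToLt, satisfies_ltToGt,
    satisfies_notBoth, Nat.not_lt_zero, false_and, exists_false, or_false, Bool.not_false,
    Bool.not_true]
  cases σ (.wire false .gt) <;> cases σ (.wire false .lt) <;> cases σ (.wire true .gt) <;>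
    cases σ (.wire true .lt) <;> simp

lemma forall_mem_vars_resultFacts_zero {P : Var → Prop} : (∀ x ∈ vars (resultFacts 0), P x) ↔
    (∀ s, P (.wire s .gt)) ∧ ∀ s, P (.wire s .lt) := by
  simp only [resultFacts_eq, forall_mem_vars_union, forall_mem_vars_gtToLt, forall_mem_vars_ltToGt,
    forall_mem_vars_notBoth]
  simp
  tauto

lemma isSmall_resultFacts_zero : IsSmall 40 (resultFacts 0) := by
  refine ⟨Finset.card_le_five.trans (by norm_num), ?_⟩
  have : vars (resultFacts 0) ⊆
      {.wire false .gt, .wire true .gt, .wire false .lt, .wire true .lt} :=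
    forall_mem_vars_resultFacts_zero.2 ⟨by simp, by simp⟩
  exact (Finset.card_le_card this).trans (Finset.card_le_four.trans (by norm_num))

end Pieces

/-! ### Local inferences for the arithmetic part of the circuit -/

section Steps

set_option linter.unusedSimpArgs false

variable {m n : ℕ}

/-- `Alive`, for the chunks of the miter. -/
def Live (m n : ℕ) (u : Key) (x : Var) : Prop := Alive (keys m n) (rank m n) (chunk m n) u x

/-- `Available`, for the facts of the miter. -/
def Known (m n : ℕ) (u : Key) (S : CNF Var) : Prop :=
  Available (keys m n) (rank m n) (chunk m n) (facts m n) u S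

/-- A bound, uniform in `m` and `n`, for the number of clauses and of variables in a local step. The
chunk accounts for at most `440` of them, and the premises for at most `560`. -/
def stepBound : ℕ := 1000

/-- `LocalStep`, for the facts of the miter. -/
def Step (m n : ℕ) (u : Key) (C : Clause Var) : Prop :=
  LocalStep (keys m n) (rank m n) (chunk m n) (facts m n) stepBound stepBound u C

lemma live_of_mem {u v : Key} {x : Var} (hv : ValidKey m n v) (h : rank m n u ≤ rank m n v)
    (hx : x ∈ vars (chunk m n v)) : Live m n u x := ⟨v, mem_keys.2 hv, h, hx⟩

lemma Known.union {u : Key} {S S' : CNF Var} (h : Known m n u S) (h' : Known m n u S') :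
    Known m n u (S ∪ S') := by
  refine ⟨fun D hD => ?_, forall_mem_vars_union.2 ⟨h.2, h'.2⟩⟩
  rcases Finset.mem_union.1 hD with hD | hD
  exacts [h.1 D hD, h'.1 D hD]

lemma known_empty (u : Key) : Known m n u ∅ := ⟨by simp, by simp [vars]⟩

lemma known_of_subset {t u : Key} {S : CNF Var} (ht : ValidKey m n t)
    (hlt : rank m n t < rank m n u) (hS : S ⊆ facts m n t) (h : ∀ x ∈ vars S, Live m n u x) :
    Known m n u S :=
  ⟨fun _ hD => ⟨t, mem_keys.2 ht, hlt, hS hD⟩, h⟩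

/-- A local step with premises `S` of bounded size. The clauses `S'` are not used in the inference;
they witness that the variables of the conclusion have occurred. -/
lemma step_of_small' {u : Key} (hu : u ≠ .big) {S S' Q : CNF Var} (hS : IsSmall 560 S)
    (hav : Known m n u S) (hav' : Known m n u S')
    (hent : ∀ σ, Satisfies σ (chunk m n u) → Satisfies σ S → Satisfies σ Q)
    (hvars : ∀ x ∈ vars Q, x ∈ vars (chunk m n u) ∨ x ∈ vars S') : ∀ C ∈ Q, Step m n u C := by
  intro C hC
  refine ⟨S, hS.1.trans (by norm_num [stepBound]), hav, fun σ hσ D hD => ?_,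
    ⟨S', hav', fun x hx => ?_⟩, ?_⟩
  · rw [Finset.mem_singleton] at hD
    rw [satisfies_union] at hσ
    exact hent σ hσ.1 hσ.2 D (hD ▸ hC)
  · rw [vars_union, Finset.mem_union]
    exact hvars x (clauseVars_subset_vars hC hx)
  · exact (Finset.card_le_card Finset.sdiff_subset).trans
      (((isSmall_chunk hu).union hS).2.trans (by norm_num [stepBound]))

lemma step_of_small {u : Key} (hu : u ≠ .big) {S Q : CNF Var} (hS : IsSmall 560 S)
    (hav : Known m n u S)
    (hent : ∀ σ, Satisfies σ (chunk m n u) → Satisfies σ S → Satisfies σ Q)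
    (hvars : ∀ x ∈ vars Q, x ∈ vars (chunk m n u) ∨ x ∈ vars S) : ∀ C ∈ Q, Step m n u C :=
  step_of_small' hu hS hav hav hent hvars

lemma live_gt (hn : 1 ≤ n) {u : Key} (hu : rank m n u ≤ time 9 0 0 (n - 1)) (s : Bool) :
    Live m n u (.wire s .gt) := by
  refine live_of_mem (v := .add (n - 1)) (by simp [ValidKey]; omega) hu ?_
  cases s <;> simp [chunk, sideGates, gates, vars_union, mem_vars_muxGate]

lemma live_mant {i : ℕ} (hi : i < n) {u : Key} (hu : rank m n u ≤ time 9 0 0 i) (s : Bool) :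
    Live m n u (mant s i).1 := by
  refine live_of_mem (v := .add i) hi hu ?_
  cases s <;> simp [chunk, sideGates, gates, vars_union, mem_vars_muxGate]

lemma live_lt (hm : 1 ≤ m) {u : Key} (hu : rank m n u ≤ time 3 0 0 (m - 1)) (s : Bool) :
    Live m n u (.wire s .lt) := by
  refine live_of_mem (v := .eSel (m - 1)) (by simp [ValidKey]; omega) hu ?_
  cases s <;> simp [chunk, sideGates, gates, vars_union, mem_vars_muxGate]

attribute [local simp] mem_vars_constGate mem_vars_andGate mem_vars_orGate mem_vars_xorGate
  mem_vars_eqGate mem_vars_xor3Gate mem_vars_majGate mem_vars_muxGate mem_vars_muxZeroGate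
  mem_vars_muxOneGate chunk sideGates gates errGates vars_union rank ValidKey

lemma live_self {u : Key} {x : Var} (hu : ValidKey m n u) (hx : x ∈ vars (chunk m n u)) :
    Live m n u x := live_of_mem hu le_rfl hx

lemma known_excl (hn : 1 ≤ n) {u : Key} (h1 : time 3 0 0 0 ≤ rank m n u)
    (h2 : rank m n u ≤ time 9 0 0 (n - 1)) : Known m n u excl :=
  known_of_subset (t := .borrow0) trivial (lt_of_lt_of_le (by simp) h1) Finset.subset_union_right
    (forall_mem_vars_excl.2 (live_gt hn h2))

lemma known_eqv_zeroE {t u : Key} {w : Wire} (hn : 1 ≤ n) (ht : ValidKey m n t)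
    (hlt : rank m n t < rank m n u) (h2 : rank m n u ≤ time 9 0 0 (n - 1))
    (hS : eqv w ∪ zeroE w ⊆ facts m n t) (h : ∀ s, Live m n u (.wire s w)) :
    Known m n u (eqv w ∪ zeroE w) :=
  known_of_subset ht hlt hS (forall_mem_vars_union.2 ⟨forall_mem_vars_eqv.2 h,
    forall_mem_vars_zeroE.2 ⟨live_gt hn h2, h _⟩⟩)

lemma known_eqv {t u : Key} {w : Wire} (ht : ValidKey m n t)
    (hlt : rank m n t < rank m n u) (hS : eqv w ⊆ facts m n t) (h : ∀ s, Live m n u (.wire s w)) :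
    Known m n u (eqv w) :=
  known_of_subset ht hlt hS (forall_mem_vars_eqv.2 h)

lemma known_borrow (hn : 1 ≤ n) {u : Key} {i : ℕ} (hi : i ≤ m) (h1 : time 4 0 0 i ≤ rank m n u)
    (h2 : rank m n u ≤ time 9 0 0 (n - 1)) (h : ∀ s, Live m n u (.wire s (.borrow i))) :
    Known m n u (eqv (.borrow i) ∪ zeroE (.borrow i)) := by
  cases i with
  | zero =>
    exact known_eqv_zeroE (t := .borrow0) hn trivial (lt_of_lt_of_le (by simp) h1) h2
      Finset.subset_union_left h
  | succ i =>
    exact known_eqv_zeroE (t := .sub i) hn hi (lt_of_lt_of_le (by simp) h1) h2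
      Finset.subset_union_right h

lemma known_sticky (hn : 1 ≤ n) {u : Key} {j : ℕ} (hj : j ≤ m) (h1 : time 7 j 0 0 ≤ rank m n u)
    (h2 : rank m n u ≤ time 9 0 0 (n - 1)) (h : ∀ s, Live m n u (.wire s (.sticky j))) :
    Known m n u (eqv (.sticky j) ∪ zeroE (.sticky j)) := by
  cases j with
  | zero =>
    exact known_eqv_zeroE (t := .alignInit) hn trivial (lt_of_lt_of_le (by simp) h1) h2
      Finset.subset_union_right h
  | succ j =>
    exact known_eqv_zeroE (t := .stick j) hn hj (lt_of_lt_of_le (by simp) h1) h2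
      Finset.Subset.rfl h

lemma alFact_subset_facts {j i : ℕ} (hj : j ≤ m) (hi : i < n + 2) :
    ∃ t, ValidKey m n t ∧ rank m n t < time 7 j 0 0 ∧ alFact j i ⊆ facts m n t := by
  rcases j with _ | j
  · rcases i with _ | _ | i
    · exact ⟨.alignInit, trivial, by simp, Finset.subset_union_left.trans Finset.subset_union_left⟩
    · exact ⟨.alignInit, trivial, by simp, Finset.subset_union_right.trans Finset.subset_union_left⟩
    · exact ⟨.mSel i, by simpa using hi, by simp, Finset.Subset.rfl⟩
  · exact ⟨.shift j i, ⟨hj, hi⟩, by simp, Finset.Subset.rfl⟩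

lemma known_alFact (hn : 1 ≤ n) {u : Key} {j i : ℕ} (hj : j ≤ m) (hi : i < n + 2)
    (h1 : time 7 j 0 0 ≤ rank m n u) (h2 : rank m n u ≤ time 9 0 0 (n - 1))
    (h3 : 2 ≤ i → rank m n u ≤ time 9 0 0 (i - 2))
    (h : ∀ s, Live m n u (.wire s (alignBit j i))) : Known m n u (alFact j i) := by
  obtain ⟨t, ht, hlt, hS⟩ := alFact_subset_facts (m := m) hj hi
  exact known_of_subset ht (hlt.trans_le h1) hS (forall_mem_vars_alFact (live_gt hn h2) h
    fun hi2 => live_mant (by omega) (h3 hi2))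

lemma known_carry {u : Key} {i : ℕ} (hi : i ≤ n) (h1 : time 9 0 0 i ≤ rank m n u)
    (h : ∀ s, Live m n u (.wire s (.carry i))) : Known m n u (eqv (.carry i)) := by
  cases i with
  | zero =>
    exact known_eqv (t := .carry0) trivial (lt_of_lt_of_le (by simp) h1) Finset.Subset.rfl h
  | succ i =>
    exact known_eqv (t := .add i) hi (lt_of_lt_of_le (by simp) h1) Finset.subset_union_right h

lemma known_outCarryBit {u : Key} {i : ℕ} (hi : i ≤ m) (h1 : time 12 0 0 i ≤ rank m n u)
    (h : ∀ s, Live m n u (.wire s (outCarryBit n i))) : Known m n u (eqv (outCarryBit n i)) := by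
  cases i with
  | zero => exact known_carry le_rfl (le_trans (by simp) h1) h
  | succ i =>
    exact known_eqv (t := .eUpd i) hi (lt_of_lt_of_le (by simp) h1) Finset.subset_union_right h

lemma known_rndCarryBit {u : Key} {i : ℕ} (hi : i ≤ n) (h1 : time 14 0 0 i ≤ rank m n u)
    (h : ∀ s, Live m n u (.wire s (rndCarryBit i))) : Known m n u (eqv (rndCarryBit i)) := by
  cases i with
  | zero =>
    exact known_eqv (t := .rndInit) trivial (lt_of_lt_of_le (by simp) h1) Finset.Subset.rfl h
  | succ i =>
    exact known_eqv (t := .rndInc i) hi (lt_of_lt_of_le (by simp) h1) Finset.subset_union_right h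

lemma known_finCarryBit {u : Key} {i : ℕ} (hi : i ≤ m) (h1 : time 16 0 0 i ≤ rank m n u)
    (h : ∀ s, Live m n u (.wire s (finCarryBit n i))) : Known m n u (eqv (finCarryBit n i)) := by
  cases i with
  | zero => exact known_rndCarryBit le_rfl (le_trans (by simp) h1) h
  | succ i =>
    exact known_eqv (t := .eFin i) hi (lt_of_lt_of_le (by simp) h1) Finset.subset_union_right h

attribute [local simp] satisfies_union satisfies_constGate satisfies_andGate satisfies_orGate
  satisfies_xorGate satisfies_eqGate satisfies_xor3Gate satisfies_majGate satisfies_muxGate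
  satisfies_muxZeroGate satisfies_muxOneGate satisfies_eqv satisfies_zeroE satisfies_condEqv
  satisfies_condInput satisfies_excl satisfies_sameSel satisfies_sameExpo satisfies_decided
  satisfies_alFact satisfies_resultFacts_zero forall_mem_vars_union forall_mem_vars_eqv
  forall_mem_vars_zeroE forall_mem_vars_condEqv forall_mem_vars_excl forall_mem_vars_sameSel
  forall_mem_vars_sameExpo forall_mem_vars_decided

attribute [-simp] List.any_eq_true List.all_eq_true

/-- When all bits have been compared, the results of the two comparisons are mirror images of each
other, so that `gt` cannot hold in both copies. -/
lemma step_borrow0 (hm : 1 ≤ m) (hn : 1 ≤ n) :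
    ∀ C ∈ facts m n .borrow0, Step m n .borrow0 C := by
  have hl : ∀ x ∈ vars (resultFacts 0), Live m n .borrow0 x :=
    forall_mem_vars_resultFacts_zero.2 ⟨live_gt hn (by simp), live_lt hm (by simp)⟩
  refine step_of_small (by simp) (isSmall_resultFacts_zero.mono (by norm_num))
    (known_of_subset (t := .cmp 0) (Nat.zero_le _) (by simp)
      (Finset.subset_union_left.trans Finset.subset_union_left) hl) ?_ ?_
  · intro σ h1 h2
    simp [facts] at h1 h2 ⊢
    grind
  · have he : ∀ s, Var.wire s .gt ∈ vars (resultFacts 0) :=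
      (forall_mem_vars_resultFacts_zero.1 fun x hx => hx).1
    simp only [facts, alFact, forall_mem_vars_union, forall_mem_vars_eqv, forall_mem_vars_zeroE,
      forall_mem_vars_condEqv, forall_mem_vars_sameSel, forall_mem_vars_excl]
    simp [he]

/-- If one exponent is larger, both copies select it by `gt` and `lt`. If the exponents are equal,
the copies select different operands, whose exponent bits agree. -/
lemma step_eSel (hm : 1 ≤ m) (hn : 1 ≤ n) {i : ℕ} (hi : i < m) :
    ∀ C ∈ facts m n (.eSel i), Step m n (.eSel i) C := by
  have hgt := live_gt (m := m) hn (u := .eSel i) (by simp)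
  have hlt := live_lt (n := n) hm (u := .eSel i) (by simp; omega)
  have hx : ∀ s, Live m n (.eSel i) (expo s i).1 :=
    fun s => live_self (u := .eSel i) hi (by cases s <;> simp)
  refine step_of_small (by simp) (S := resultFacts 0 ∪ excl ∪ sameExpo i)
    (((isSmall_resultFacts_zero.union isSmall_excl).union (isSmall_sameExpo i)).mono
      (by norm_num)) (Known.union (Known.union ?_ (known_excl hn (by simp) (by simp))) ?_) ?_ ?_
  · exact known_of_subset (t := .cmp 0) (Nat.zero_le _) (by simp)
      (Finset.subset_union_left.trans Finset.subset_union_left)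
      (forall_mem_vars_resultFacts_zero.2 ⟨hgt, hlt⟩)
  · exact known_of_subset (t := .cmp i) hi.le (by simp)
      (by simp only [facts, if_pos hi]; exact Finset.subset_union_right)
      (forall_mem_vars_sameExpo.2 ⟨hgt _, hlt _, hx⟩)
  · intro σ h1 h2
    simp [facts] at h1 h2 ⊢
    grind
  · simp only [facts, alFact, forall_mem_vars_union, forall_mem_vars_eqv, forall_mem_vars_zeroE,
      forall_mem_vars_condEqv, forall_mem_vars_sameSel, forall_mem_vars_excl]
    simp

/-- If the exponents are equal, so are the two selected exponents, and all borrows and all bits of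
the difference vanish. -/
lemma step_sub (hn : 1 ≤ n) {i : ℕ} (hi : i < m) :
    ∀ C ∈ facts m n (.sub i), Step m n (.sub i) C := by
  have hgt := live_gt (m := m) hn (u := .sub i) (by simp)
  refine step_of_small (by simp)
    (S := eqv (.eLarge i) ∪ eqv (.eSmall i) ∪ sameSel i ∪ (eqv (.borrow i) ∪ zeroE (.borrow i)))
    (((((isSmall_eqv _).union (isSmall_eqv _)).union (isSmall_sameSel i)).union
      ((isSmall_eqv _).union (isSmall_zeroE _))).mono (by norm_num))
    (Known.union ?_ (known_borrow hn hi.le (by simp) (by simp)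
      fun s => live_self (u := .sub i) hi (by cases s <;> simp))) ?_ ?_
  · refine known_of_subset (t := .eSel i) hi (by simp) Finset.Subset.rfl ?_
    simp only [forall_mem_vars_union, forall_mem_vars_eqv, forall_mem_vars_sameSel]
    exact ⟨⟨fun s => live_self (u := .sub i) hi (by cases s <;> simp),
        fun s => live_self (u := .sub i) hi (by cases s <;> simp)⟩,
      hgt, live_self hi (by simp), live_self hi (by simp)⟩
  · intro σ h1 h2
    simp [facts] at h1 h2 ⊢
    cases hx : σ (.wire false (.eLarge i)) <;> grind
  · have he : ∀ s, Var.wire s .gt ∈ vars (zeroE (.borrow i)) :=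
      (forall_mem_vars_zeroE.1 fun x hx => hx).1
    simp only [facts, alFact, forall_mem_vars_union, forall_mem_vars_eqv, forall_mem_vars_zeroE,
      forall_mem_vars_condEqv, forall_mem_vars_sameSel, forall_mem_vars_excl]
    simp [he]

lemma step_mSel (hn : 1 ≤ n) {i : ℕ} :
    ∀ C ∈ facts m n (.mSel i), Step m n (.mSel i) C := by
  refine step_of_small (by simp) (isSmall_excl.mono (by norm_num))
    (known_excl hn (by simp) (by simp)) ?_ ?_
  · intro σ h1 h2
    simp [facts, alignBit] at h1 h2 ⊢
    grind
  · refine forall_mem_vars_alFact ?_ ?_ fun _ => ?_ <;> rintro (_ | _) <;> simp [alignBit]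

lemma step_alignInit (hn : 1 ≤ n) : ∀ C ∈ facts m n .alignInit, Step m n .alignInit C := by
  have he : ∀ s, Var.wire s .gt ∈ vars excl := forall_mem_vars_excl.1 fun x hx => hx
  refine step_of_small (by simp) (isSmall_excl.mono (by norm_num))
    (known_excl hn (by simp) (by simp)) ?_ ?_
  · intro σ h1 h2
    simp [facts] at h1 h2 ⊢
    grind
  · simp only [facts, alFact, forall_mem_vars_union, forall_mem_vars_eqv, forall_mem_vars_zeroE,
      forall_mem_vars_condEqv, forall_mem_vars_sameSel, forall_mem_vars_excl]
    simp [he]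

lemma step_lost0 (hn : 1 ≤ n) {j : ℕ} :
    ∀ C ∈ facts m n (.lost0 j), Step m n (.lost0 j) C := by
  have he : ∀ s, Var.wire s .gt ∈ vars excl := forall_mem_vars_excl.1 fun x hx => hx
  refine step_of_small (by simp) (isSmall_excl.mono (by norm_num))
    (known_excl hn (by simp) (by simp)) ?_ ?_
  · intro σ h1 h2
    simp [facts] at h1 h2 ⊢
    grind
  · simp only [facts, alFact, forall_mem_vars_union, forall_mem_vars_eqv, forall_mem_vars_zeroE,
      forall_mem_vars_condEqv, forall_mem_vars_sameSel, forall_mem_vars_excl]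
    simp [he]

lemma known_lost (hn : 1 ≤ n) {u : Key} {j i : ℕ} (hj : j < m) (hi : i ≤ min (2 ^ j) (n + 2))
    (h1 : time 7 j 1 i ≤ rank m n u)
    (h2 : rank m n u ≤ time 9 0 0 (n - 1)) (h : ∀ s, Live m n u (.wire s (.lost j i))) :
    Known m n u (condEqv (.lost j i)) := by
  have hl : ∀ x ∈ vars (condEqv (.lost j i)), Live m n u x :=
    forall_mem_vars_condEqv.2 ⟨live_gt hn h2, h⟩
  cases i with
  | zero =>
    exact known_of_subset (t := .lost0 j) hj (lt_of_lt_of_le (by simp) h1) Finset.Subset.rfl hl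
  | succ i =>
    exact known_of_subset (t := .lost j i) ⟨hj, hi⟩ (lt_of_lt_of_le (by simp) h1)
      Finset.Subset.rfl hl

/-- The bits that may be shifted out agree in the two copies if the exponents differ. Nothing is
known about them if the exponents are equal, since the copies then shift different mantissas. -/
lemma step_lost (hn : 1 ≤ n) {j i : ℕ} (hk : ValidKey m n (.lost j i)) :
    ∀ C ∈ facts m n (.lost j i), Step m n (.lost j i) C := by
  have he : ∀ s, Var.wire s .gt ∈ vars (condEqv (.lost j i)) :=
    (forall_mem_vars_condEqv.1 fun x hx => hx).1
  have hin : i < n + 2 := lt_of_lt_of_le hk.2 (min_le_right _ _)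
  refine step_of_small (by simp) (S := condEqv (.lost j i) ∪ alFact j i)
    (((isSmall_condEqv _).union (isSmall_alFact _ _)).mono (by norm_num))
    (Known.union (known_lost hn hk.1 hk.2.le (by simp) (by simp)
        fun s => live_self (u := .lost j i) hk (by cases s <;> simp))
      (known_alFact hn hk.1.le hin (by simp) (by simp) (by simp)
        fun s => live_self (u := .lost j i) hk (by cases s <;> simp))) ?_ ?_
  · intro σ h1 h2
    simp [facts] at h1 h2 ⊢
    grind
  · simp only [facts, alFact, forall_mem_vars_union, forall_mem_vars_eqv, forall_mem_vars_zeroE,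
      forall_mem_vars_condEqv, forall_mem_vars_sameSel, forall_mem_vars_excl]
    simp [he]

lemma known_diff (hn : 1 ≤ n) {u : Key} {j : ℕ} (hj : j < m) (h1 : time 5 0 0 0 ≤ rank m n u)
    (h2 : rank m n u ≤ time 9 0 0 (n - 1)) (h : ∀ s, Live m n u (.wire s (.diff j))) :
    Known m n u (eqv (.diff j) ∪ zeroE (.diff j)) :=
  known_eqv_zeroE (t := .sub j) hn hj (lt_of_lt_of_le (by simp) h1) h2 Finset.subset_union_left h

/-- If the exponents differ, the copies shift the same word by the same distance; if they are equal,
the word stays where it is. -/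
lemma step_shift (hn : 1 ≤ n) {j i : ℕ} (hk : ValidKey m n (.shift j i)) :
    ∀ C ∈ facts m n (.shift j i), Step m n (.shift j i) C := by
  have hgt := live_gt (m := m) hn (u := .shift j i) (by simp)
  have he : ∀ s, Var.wire s .gt ∈ vars excl := forall_mem_vars_excl.1 fun x hx => hx
  have hd : Known m n (.shift j i) (excl ∪ (eqv (.diff j) ∪ zeroE (.diff j)) ∪ alFact j i) :=
    ((known_excl hn (by simp) (by simp)).union
      (known_diff hn hk.1 (by simp) (by simp) fun s => live_self hk (by
        by_cases hi : i + 2 ^ j < n + 2 <;> cases s <;> simp [hi]))).union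
    (known_alFact hn hk.1.le hk.2 (by simp) (by simp) (by simp) fun s => live_self hk (by
        by_cases hi : i + 2 ^ j < n + 2 <;> cases s <;> simp [hi]))
  have hmant : 2 ≤ i → ∀ s, (mant s (i - 2)).1 ∈ vars (alFact j i) := by
    intro h2
    obtain ⟨i, rfl⟩ := Nat.exists_eq_add_of_le' h2
    simp only [alFact, vars_union, Finset.mem_union]
    exact fun s => Or.inr ((forall_mem_vars_condInput.1 fun x hx => hx).2.2 s)
  by_cases hi : i + 2 ^ j < n + 2
  · refine step_of_small (by simp)
      (((((isSmall_excl.union ((isSmall_eqv _).union (isSmall_zeroE _))).union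
        (isSmall_alFact _ _))).union (isSmall_alFact _ _)).mono (by norm_num))
      (hd.union (known_alFact hn (i := i + 2 ^ j) hk.1.le hi (by simp) (by simp) (by simp)
        fun s => live_self (u := .shift j i) hk (by cases s <;> simp [hi]))) ?_ ?_
    · intro σ h1 h2
      simp [facts, hi, -satisfies_alFact] at h1 h2 ⊢
      rw [satisfies_alFact, satisfies_alFact] at h2
      rw [satisfies_alFact]
      grind
    · refine forall_mem_vars_alFact ?_ ?_ fun h2 => ?_
      · simp [he]
      · simp [hi]
      · simp [hmant h2]
  · refine step_of_small (by simp)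
      ((((isSmall_excl.union ((isSmall_eqv _).union (isSmall_zeroE _))).union
        (isSmall_alFact _ _))).mono (by norm_num)) hd ?_ ?_
    · intro σ h1 h2
      simp [facts, hi] at h1 h2 ⊢
      grind
    · refine forall_mem_vars_alFact ?_ ?_ fun h2 => ?_
      · simp [he]
      · simp [hi]
      · simp [hmant h2]

/-- If the exponents are equal, bit `j` of the difference is `0`, and the bits that may be shifted
out, which differ in the two copies, do not matter. -/
lemma step_stick (hn : 1 ≤ n) {j : ℕ} (hj : j < m) :
    ∀ C ∈ facts m n (.stick j), Step m n (.stick j) C := by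
  have hgt := live_gt (m := m) hn (u := .stick j) (by simp)
  have he : ∀ s, Var.wire s .gt ∈ vars (condEqv (.lost j (min (2 ^ j) (n + 2)))) :=
    (forall_mem_vars_condEqv.1 fun x hx => hx).1
  refine step_of_small (by simp) (S := condEqv (.lost j (min (2 ^ j) (n + 2))) ∪
      (eqv (.diff j) ∪ zeroE (.diff j)) ∪ (eqv (.sticky j) ∪ zeroE (.sticky j)))
    ((((isSmall_condEqv _).union ((isSmall_eqv _).union (isSmall_zeroE _))).union
      ((isSmall_eqv _).union (isSmall_zeroE _))).mono (by norm_num))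
    (((known_lost hn hj le_rfl (by simp) (by simp)
        fun s => live_self (u := .stick j) hj (by cases s <;> simp)).union
      (known_diff hn hj (by simp) (by simp)
          fun s => live_self (u := .stick j) hj (by cases s <;> simp))).union
      (known_sticky hn hj.le (by simp) (by simp)
          fun s => live_self (u := .stick j) hj (by cases s <;> simp))) ?_ ?_
  · intro σ h1 h2
    simp [facts] at h1 h2 ⊢
    clear he hgt
    generalize min (2 ^ j) (n + 2) = p at h1 h2
    cases hd : σ (.wire false (.diff j)) <;> cases hg : σ (.wire false .gt) <;>
      cases hg' : σ (.wire true .gt) <;> grind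
  · simp only [facts, alFact, forall_mem_vars_union, forall_mem_vars_eqv, forall_mem_vars_zeroE,
      forall_mem_vars_condEqv, forall_mem_vars_sameSel, forall_mem_vars_excl]
    simp [he]

lemma step_carry0 : ∀ C ∈ facts m n .carry0, Step m n .carry0 C := by
  refine step_of_small (by simp) (isSmall_empty.mono (by norm_num)) (known_empty _) ?_ ?_
  · intro σ h1 h2
    simp [facts] at h1 h2 ⊢
    grind
  · simp only [facts, alFact, forall_mem_vars_union, forall_mem_vars_eqv, forall_mem_vars_zeroE,
      forall_mem_vars_condEqv, forall_mem_vars_sameSel, forall_mem_vars_excl]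
    simp

/-- If the exponents are equal, the copies add the two mantissas in opposite order; this is the only
place where the symmetry of the full adder is used. -/
lemma step_add (hn : 1 ≤ n) {i : ℕ} (hi : i < n) :
    ∀ C ∈ facts m n (.add i), Step m n (.add i) C := by
  refine step_of_small (by simp) (S := excl ∪ alFact m (i + 2) ∪ eqv (.carry i))
    (((isSmall_excl.union (isSmall_alFact _ _)).union (isSmall_eqv _)).mono (by norm_num))
    (((known_excl hn (by simp) (by simp; omega)).union
      (known_alFact hn le_rfl (by omega) (by simp) (by simp; omega) (by simp)
        fun s => live_self (u := .add i) hi (by cases s <;> simp))).union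
      (known_carry hi.le (by simp) fun s => live_self (u := .add i) hi (by cases s <;> simp))) ?_ ?_
  · intro σ h1 h2
    simp [facts] at h1 h2 ⊢
    cases hc : σ (.wire false (.carry i)) <;> cases ha : val σ (mant false i) <;>
      cases hb : val σ (mant true i) <;> grind
  · simp only [facts, alFact, forall_mem_vars_union, forall_mem_vars_eqv, forall_mem_vars_zeroE,
      forall_mem_vars_condEqv, forall_mem_vars_sameSel, forall_mem_vars_excl]
    simp

lemma known_sum {u : Key} {i : ℕ} (hi : i < n) (h1 : time 10 0 0 0 ≤ rank m n u)
    (h : ∀ s, Live m n u (.wire s (.sum i))) : Known m n u (eqv (.sum i)) :=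
  known_eqv (t := .add i) hi (lt_of_lt_of_le (by simp) h1) Finset.subset_union_left h

lemma known_norm {u : Key} {i : ℕ} (hi : i < n) (h1 : time 11 0 0 0 ≤ rank m n u)
    (h : ∀ s, Live m n u (.wire s (.norm i))) : Known m n u (eqv (.norm i)) :=
  known_eqv (t := .norm i) hi (lt_of_lt_of_le (by simp) h1) Finset.Subset.rfl h

lemma known_rnd {u : Key} {i : ℕ} (hi : i < n) (h1 : time 15 0 0 0 ≤ rank m n u)
    (h : ∀ s, Live m n u (.wire s (.rnd i))) : Known m n u (eqv (.rnd i)) :=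
  known_eqv (t := .rndInc i) hi (lt_of_lt_of_le (by simp) h1) Finset.subset_union_left h

/-- After the significand addition, the shifted word is only used through its guard and round bits,
which agree in the two copies. -/
lemma known_eqv_alignBit {u : Key} {i : ℕ} (hi : i < 2) (h1 : time 8 0 0 0 ≤ rank m n u)
    (h : ∀ s, Live m n u (.wire s (alignBit m i))) : Known m n u (eqv (alignBit m i)) := by
  obtain ⟨t, ht, hlt, hS⟩ := alFact_subset_facts (m := m) (n := n) (i := i) le_rfl (by omega)
  refine known_eqv ht (hlt.trans (lt_of_lt_of_le (by simp) h1)) (Finset.Subset.trans ?_ hS) h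
  rcases i with _ | _ | i
  exacts [Finset.subset_union_left, Finset.subset_union_left, absurd hi (by omega)]

lemma known_eqv_sticky {u : Key} (h1 : time 8 0 0 0 ≤ rank m n u)
    (h : ∀ s, Live m n u (.wire s (.sticky m))) : Known m n u (eqv (.sticky m)) := by
  rcases m with _ | m
  · exact known_eqv (t := .alignInit) trivial (lt_of_lt_of_le (by simp) h1)
      (Finset.subset_union_left.trans Finset.subset_union_right) h
  · exact known_eqv (t := .stick m) (Nat.lt_succ_self m) (lt_of_lt_of_le (by simp) h1)
      Finset.subset_union_left h

lemma known_eLarge {u : Key} {i : ℕ} (hi : i < m) (h1 : time 4 0 0 0 ≤ rank m n u)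
    (h : ∀ s, Live m n u (.wire s (.eLarge i))) : Known m n u (eqv (.eLarge i)) :=
  known_eqv (t := .eSel i) hi (lt_of_lt_of_le (by simp) h1)
    (Finset.subset_union_left.trans Finset.subset_union_left) h

lemma known_eOut {u : Key} {i : ℕ} (hi : i < m) (h1 : time 13 0 0 0 ≤ rank m n u)
    (h : ∀ s, Live m n u (.wire s (.eOut i))) : Known m n u (eqv (.eOut i)) :=
  known_eqv (t := .eUpd i) hi (lt_of_lt_of_le (by simp) h1) Finset.subset_union_left h

lemma step_norm {i : ℕ} (hi : i < n) :
    ∀ C ∈ facts m n (.norm i), Step m n (.norm i) C := by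
  by_cases h : i + 1 < n
  · refine step_of_small (by simp) (S := eqv (.carry n) ∪ eqv (.sum i) ∪ eqv (.sum (i + 1)))
      (((isSmall_eqv _).union (isSmall_eqv _)).union (isSmall_eqv _) |>.mono (by norm_num))
      (((known_carry le_rfl (by simp)
          fun s => live_self (u := .norm i) hi (by cases s <;> simp [h])).union
        (known_sum hi (by simp)
            fun s => live_self (u := .norm i) hi (by cases s <;> simp [h]))).union
        (known_sum h (by simp)
            fun s => live_self (u := .norm i) hi (by cases s <;> simp [h]))) ?_ ?_
    · intro σ h1 h2
      simp [facts, h] at h1 h2 ⊢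
      grind
    · simp only [facts, forall_mem_vars_eqv]
      simp [h]
  · refine step_of_small (by simp) (S := eqv (.carry n) ∪ eqv (.sum i))
      ((isSmall_eqv _).union (isSmall_eqv _) |>.mono (by norm_num))
      ((known_carry le_rfl (by simp)
          fun s => live_self (u := .norm i) hi (by cases s <;> simp [h])).union
        (known_sum hi (by simp)
            fun s => live_self (u := .norm i) hi (by cases s <;> simp [h]))) ?_ ?_
    · intro σ h1 h2
      simp [facts, h] at h1 h2 ⊢
      grind
    · simp only [facts, forall_mem_vars_eqv]
      simp [h]

lemma step_normLow :
    ∀ C ∈ facts m n .normLow, Step m n .normLow C := by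
  refine step_of_small (by simp)
    (S := eqv (.carry n) ∪ eqv (alignBit m 0) ∪ eqv (alignBit m 1) ∪ eqv (.sticky m))
    (((((isSmall_eqv _).union (isSmall_eqv _)).union (isSmall_eqv _)).union (isSmall_eqv _)).mono
      (by norm_num))
    ((((known_carry le_rfl (by simp)
        fun s => live_self (u := .normLow) trivial (by cases s <;> simp)).union
      (known_eqv_alignBit (by simp) (by simp)
          fun s => live_self (u := .normLow) trivial (by cases s <;> simp))).union
      (known_eqv_alignBit (by simp) (by simp)
          fun s => live_self (u := .normLow) trivial (by cases s <;> simp))).union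
      (known_eqv_sticky (by simp)
          fun s => live_self (u := .normLow) trivial (by cases s <;> simp))) ?_ ?_
  · intro σ h1 h2
    simp [facts] at h1 h2 ⊢
    grind
  · simp only [facts, forall_mem_vars_union, forall_mem_vars_eqv]
    simp

lemma step_eUpd {i : ℕ} (hi : i < m) :
    ∀ C ∈ facts m n (.eUpd i), Step m n (.eUpd i) C := by
  refine step_of_small (by simp) (S := eqv (outCarryBit n i) ∪ eqv (.eLarge i))
    (((isSmall_eqv _).union (isSmall_eqv _)).mono (by norm_num))
    ((known_outCarryBit hi.le (by simp)
        fun s => live_self (u := .eUpd i) hi (by cases s <;> simp)).union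
      (known_eLarge hi (by simp) fun s => live_self (u := .eUpd i) hi (by cases s <;> simp))) ?_ ?_
  · intro σ h1 h2
    simp [facts] at h1 h2 ⊢
    grind
  · simp only [facts, forall_mem_vars_union, forall_mem_vars_eqv]
    simp

lemma step_rndInit (hn : 1 ≤ n) :
    ∀ C ∈ facts m n .rndInit, Step m n .rndInit C := by
  refine step_of_small (by simp) (S := eqv (.norm 0) ∪ eqv .sNorm ∪ eqv .rNorm)
    ((((isSmall_eqv _).union (isSmall_eqv _)).union (isSmall_eqv _)).mono (by norm_num))
    (((known_norm hn (by simp)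
        fun s => live_self (u := .rndInit) trivial (by cases s <;> simp)).union
      (known_eqv (t := .normLow) trivial (by simp) Finset.subset_union_right
          fun s => live_self (u := .rndInit) trivial (by cases s <;> simp))).union
      (known_eqv (t := .normLow) trivial (by simp) Finset.subset_union_left
          fun s => live_self (u := .rndInit) trivial (by cases s <;> simp))) ?_ ?_
  · intro σ h1 h2
    simp [facts] at h1 h2 ⊢
    grind
  · simp only [facts, forall_mem_vars_union, forall_mem_vars_eqv]
    simp

lemma step_rndInc {i : ℕ} (hi : i < n) :
    ∀ C ∈ facts m n (.rndInc i), Step m n (.rndInc i) C := by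
  refine step_of_small (by simp) (S := eqv (rndCarryBit i) ∪ eqv (.norm i))
    (((isSmall_eqv _).union (isSmall_eqv _)).mono (by norm_num))
    ((known_rndCarryBit hi.le (by simp)
        fun s => live_self (u := .rndInc i) hi (by cases s <;> simp)).union
      (known_norm hi (by simp) fun s => live_self (u := .rndInc i) hi (by cases s <;> simp))) ?_ ?_
  · intro σ h1 h2
    simp [facts] at h1 h2 ⊢
    grind
  · simp only [facts, forall_mem_vars_union, forall_mem_vars_eqv]
    simp

lemma step_fShift {i : ℕ} (hi : i < n) :
    ∀ C ∈ facts m n (.fShift i), Step m n (.fShift i) C := by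
  by_cases h : i + 1 < n
  · refine step_of_small (by simp) (S := eqv (rndCarryBit n) ∪ eqv (.rnd i) ∪ eqv (.rnd (i + 1)))
      (((isSmall_eqv _).union (isSmall_eqv _)).union (isSmall_eqv _) |>.mono (by norm_num))
      (((known_rndCarryBit le_rfl (by simp)
          fun s => live_self (u := .fShift i) hi (by cases s <;> simp [h])).union
        (known_rnd hi (by simp)
            fun s => live_self (u := .fShift i) hi (by cases s <;> simp [h]))).union
        (known_rnd h (by simp)
            fun s => live_self (u := .fShift i) hi (by cases s <;> simp [h]))) ?_ ?_
    · intro σ h1 h2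
      simp [facts, h] at h1 h2 ⊢
      grind
    · simp only [facts, forall_mem_vars_eqv]
      simp [h]
  · refine step_of_small (by simp) (S := eqv (rndCarryBit n) ∪ eqv (.rnd i))
      ((isSmall_eqv _).union (isSmall_eqv _) |>.mono (by norm_num))
      ((known_rndCarryBit le_rfl (by simp)
          fun s => live_self (u := .fShift i) hi (by cases s <;> simp [h])).union
        (known_rnd hi (by simp)
            fun s => live_self (u := .fShift i) hi (by cases s <;> simp [h]))) ?_ ?_
    · intro σ h1 h2
      simp [facts, h] at h1 h2 ⊢
      grind
    · simp only [facts, forall_mem_vars_eqv]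
      simp [h]

lemma step_eFin {i : ℕ} (hi : i < m) :
    ∀ C ∈ facts m n (.eFin i), Step m n (.eFin i) C := by
  refine step_of_small (by simp) (S := eqv (finCarryBit n i) ∪ eqv (.eOut i))
    (((isSmall_eqv _).union (isSmall_eqv _)).mono (by norm_num))
    ((known_finCarryBit hi.le (by simp)
        fun s => live_self (u := .eFin i) hi (by cases s <;> simp)).union
      (known_eOut hi (by simp) fun s => live_self (u := .eFin i) hi (by cases s <;> simp))) ?_ ?_
  · intro σ h1 h2
    simp [facts] at h1 h2 ⊢
    grind
  · simp only [facts, forall_mem_vars_union, forall_mem_vars_eqv]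
    simp

end Steps

/-! ### Local inferences for the exponent comparison -/

section CompareSteps

set_option linter.unusedSimpArgs false

variable {m n : ℕ}

attribute [local simp] mem_vars_constGate mem_vars_andGate mem_vars_orGate mem_vars_xorGate
  mem_vars_eqGate mem_vars_ofLists chunk sideGates gates errGates vars_union rank ValidKey

attribute [local simp] satisfies_union satisfies_constGate satisfies_andGate satisfies_eqGate
  satisfies_ofLists satisfies_eqv satisfies_sameExpo satisfies_decided satisfies_gtToLt
  satisfies_ltToGt satisfies_notBoth satisfies_gtBelow satisfies_ltBelow

attribute [-simp] List.any_eq_true List.all_eq_true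

/-- A local step for a wide clause: the premises `S` may be wide as well, but they share all their
variables with it, up to the few in `X`. -/
lemma step_of_wide {u : Key} (hu : u ≠ .big) {S S' : CNF Var} {C : Clause Var} (X : List Var)
    (hX : X.length ≤ 100) (hS : S.card ≤ 100) (hav : Known m n u S) (hav' : Known m n u S')
    (hent : ∀ σ, Satisfies σ (chunk m n u) → Satisfies σ S → Satisfies σ {C})
    (hvars : ∀ x ∈ vars {C}, x ∈ vars (chunk m n u) ∨ x ∈ vars S')
    (hSX : ∀ x ∈ vars S, x ∈ vars {C} ∨ x ∈ X) : Step m n u C := by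
  refine ⟨S, hS.trans (by norm_num [stepBound]), hav, fun σ hσ => ?_,
    ⟨S', hav', fun x hx => ?_⟩, ?_⟩
  · rw [satisfies_union] at hσ
    exact hent σ hσ.1 hσ.2
  · rw [vars_union, Finset.mem_union]
    exact hvars x (by rwa [vars_singleton])
  · have : vars (chunk m n u ∪ S) \ clauseVars C ⊆ vars (chunk m n u) ∪ X.toFinset := by
      intro x hx
      rw [Finset.mem_sdiff, vars_union, Finset.mem_union, ← vars_singleton] at hx
      rw [Finset.mem_union, List.mem_toFinset]
      rcases hx with ⟨h | h, hC⟩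
      · exact Or.inl h
      · exact Or.inr ((hSX x h).resolve_left hC)
    refine (Finset.card_le_card this).trans ((Finset.card_union_le _ _).trans
      ((add_le_add (isSmall_chunk hu).2 ((List.toFinset_card_le _).trans hX)).trans ?_))
    norm_num [stepBound]

lemma live_cmp {u : Key} {i : ℕ} (hi : i < m) (hu : rank m n u ≤ time 1 0 0 (m - i)) (s : Bool) :
    Live m n u (.wire s (.gtBit i)) ∧ Live m n u (.wire s (.ltBit i)) ∧
      Live m n u (.wire s (.pre i)) := by
  refine ⟨?_, ?_, ?_⟩ <;> refine live_of_mem (v := .cmp i) hi.le hu ?_ <;>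
    cases s <;> simp [hi, cmpGates, -List.mem_map]

lemma live_below {t k : ℕ} (ht : t ≤ k + 1) (htm : t ≤ m) (s : Bool) :
    ∀ i < t, Live m n (.cmp k) (.wire s (.gtBit i)) ∧ Live m n (.cmp k) (.wire s (.ltBit i)) ∧
      Live m n (.cmp k) (.wire s (.pre i)) :=
  fun i hi => live_cmp (by omega) (by simp; omega) s

lemma preFacts_succ (t : ℕ) :
    preFacts (t + 1) = eqv (.pre t) ∪ decided t ∪ ({gtBelow t} ∪ {ltBelow t}) := by
  rw [preFacts]; congr 1

lemma known_top {s : Bool} {u : Key} (hu : time 1 0 0 0 ≤ rank m n u) {f : Clause Var}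
    (hf : f ∈ topClauses m (W s)) (h : ∀ x ∈ vars {f}, Live m n u x) : Known m n u {f} := by
  refine known_of_subset (t := .big) trivial (lt_of_lt_of_le (by simp) hu) ?_ h
  rw [Finset.singleton_subset_iff]
  cases s <;> simp [facts, hf]

lemma comparison_of_satisfies {σ : Var → Bool} {t : ℕ} (ht : t < m)
    (h : Satisfies σ (chunk m n (.cmp t))) (s : Bool) :
    σ (.wire s (.gtBit t)) =
        (σ (.wire s (.pre t)) && val σ (expo s t) && !val σ (expo (!s) t)) ∧
      σ (.wire s (.ltBit t)) =
        (σ (.wire s (.pre t)) && !val σ (expo s t) && val σ (expo (!s) t)) ∧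
      (σ (.wire s (.eqBit t)) = !(val σ (expo s t) ^^ val σ (expo (!s) t))) ∧
      (σ (.wire s (.gtBit t)) = true → σ (.wire s .gt) = true) ∧
      (σ (.wire s (.ltBit t)) = true → σ (.wire s .lt) = true) := by
  simp [ht, cmpGates] at h
  cases s <;> simp only [Bool.not_false, Bool.not_true] <;> grind

lemma prefix_of_satisfies {σ : Var → Bool} {t : ℕ} (ht : t + 1 < m)
    (h : Satisfies σ (chunk m n (.cmp (t + 1)))) (s : Bool) :
    σ (.wire s (.pre t)) = (σ (.wire s (.pre (t + 1))) && σ (.wire s (.eqBit (t + 1)))) := by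
  simp [ht, cmpGates, preGate] at h
  cases s <;> grind

lemma mem_facts_cmp {t : ℕ} {C : Clause Var} (h : C ∈ facts m n (.cmp t)) :
    (∃ s, C = gtToLt s t) ∨ (∃ s, C = ltToGt s t) ∨ C = notBoth t ∨
      (∃ k, t = k + 1 ∧ (C ∈ eqv (.pre k) ∪ decided k ∨ C = gtBelow k ∨ C = ltBelow k)) ∨
      (t < m ∧ C ∈ sameExpo t) := by
  simp only [facts, resultFacts, Finset.mem_union, Finset.mem_insert, Finset.mem_singleton] at h
  rcases h with (h | h) | h
  · rcases h with rfl | rfl | rfl | rfl | rfl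
    exacts [Or.inl ⟨_, rfl⟩, Or.inl ⟨_, rfl⟩, Or.inr (Or.inl ⟨_, rfl⟩), Or.inr (Or.inl ⟨_, rfl⟩),
      Or.inr (Or.inr (Or.inl rfl))]
  · rcases t with _ | k
    · simp [preFacts] at h
    · simp only [preFacts, Finset.mem_union, Finset.mem_insert, Finset.mem_singleton] at h
      exact Or.inr (Or.inr (Or.inr (Or.inl ⟨k, rfl, by simpa only [Finset.mem_union] using h⟩)))
  · split_ifs at h with ht
    · exact Or.inr (Or.inr (Or.inr (Or.inr ⟨ht, h⟩)))
    · simp at h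

/-- The comparison starts with weakenings of the clauses that define `gt` and `lt`. -/
lemma step_cmp_top (hm : 1 ≤ m) (hn : 1 ≤ n) :
    ∀ C ∈ facts m n (.cmp m), Step m n (.cmp m) C := by
  have hgt := live_gt (m := m) hn (u := .cmp m) (by simp)
  have hlt := live_lt (n := n) hm (u := .cmp m) (by simp)
  have hb := fun s => live_below (n := n) (m := m) (k := m) (t := m) (by omega) le_rfl s
  let G : Bool → Clause Var := fun s => wide [neg (W s .gt)] (fun i => W s (.gtBit i)) m
  let L : Bool → Clause Var := fun s => wide [neg (W s .lt)] (fun i => W s (.ltBit i)) m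
  have hG : ∀ s, Known m n (.cmp m) {G s} := fun s =>
    known_top (by simp) (s := s) (by simp [topClauses, G]) (by
      rw [vars_singleton]
      exact forall_mem_clauseVars_wide.2 ⟨by simp [hgt], fun i hi => (hb s i hi).1⟩)
  have hL : ∀ s, Known m n (.cmp m) {L s} := fun s =>
    known_top (by simp) (s := s) (by simp [topClauses, L]) (by
      rw [vars_singleton]
      exact forall_mem_clauseVars_wide.2 ⟨by simp [hlt], fun i hi => (hb s i hi).2.1⟩)
  have hK : Known m n (.cmp m) ({G false} ∪ {G true} ∪ {L false} ∪ {L true}) :=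
    (((hG _).union (hG _)).union (hL _)).union (hL _)
  have hKv : (∀ s, .wire s .gt ∈ vars ({G false} ∪ {G true} ∪ {L false} ∪ {L true})) ∧
      (∀ s, .wire s .lt ∈ vars ({G false} ∪ {G true} ∪ {L false} ∪ {L true})) ∧
      (∀ s, ∀ i < m, .wire s (.gtBit i) ∈ vars ({G false} ∪ {G true} ∪ {L false} ∪ {L true})) ∧
      ∀ s, ∀ i < m, .wire s (.ltBit i) ∈ vars ({G false} ∪ {G true} ∪ {L false} ∪ {L true}) := by
    have h1 : ∀ s, ∀ x ∈ vars {G s}, x ∈ vars ({G false} ∪ {G true} ∪ {L false} ∪ {L true}) := by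
      rintro (_ | _) x hx <;> simp only [vars_union, Finset.mem_union, hx, true_or, or_true]
    have h2 : ∀ s, ∀ x ∈ vars {L s}, x ∈ vars ({G false} ∪ {G true} ∪ {L false} ∪ {L true}) := by
      rintro (_ | _) x hx <;> simp only [vars_union, Finset.mem_union, hx, true_or, or_true]
    simp only [vars_singleton, G, L, forall_mem_clauseVars_wide, List.forall_mem_singleton,
      neg_fst, W_fst] at h1 h2
    exact ⟨fun s => (h1 s).1, fun s => (h2 s).1, fun s => (h1 s).2, fun s => (h2 s).2⟩
  have hpre : ∀ σ, Satisfies σ (chunk m n (.cmp m)) → ∀ s, σ (.wire s (.pre (m - 1))) = true := by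
    intro σ h1 s
    obtain ⟨k, rfl⟩ := Nat.exists_eq_add_of_le' hm
    simp [preGate] at h1
    cases s
    exacts [h1.1, h1.2]
  have hprev : ∀ s, .wire s (.pre (m - 1)) ∈ vars (chunk m n (.cmp m)) := by
    intro s
    obtain ⟨k, rfl⟩ := Nat.exists_eq_add_of_le' hm
    cases s <;> simp [preGate]
  -- weakening
  have hweak : ∀ {C D : Clause Var}, Known m n (.cmp m) {D} → D ⊆ C →
      (∀ x ∈ vars {C}, x ∈ vars (chunk m n (.cmp m)) ∨
        x ∈ vars ({G false} ∪ {G true} ∪ {L false} ∪ {L true})) → Step m n (.cmp m) C := by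
    intro C D hD hDC hC
    refine step_of_wide (by simp) [] (by simp) (by simp) hD hK (fun σ _ h2 => ?_) hC fun x hx => ?_
    · rw [satisfies_singleton] at h2 ⊢
      obtain ⟨l, hl, h⟩ := h2
      exact ⟨l, hDC hl, h⟩
    · rw [vars_singleton] at hx ⊢
      exact Or.inl (Finset.image_subset_image hDC hx)
  intro C hC
  rcases mem_facts_cmp hC with ⟨s, rfl⟩ | ⟨s, rfl⟩ | rfl | ⟨k, rfl, h | rfl | rfl⟩ | ⟨h, -⟩
  · refine hweak (hG s) (Finset.union_subset_union (fun x hx => by simp at hx ⊢; simp [hx])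
      subset_rfl) (forall_mem_vars_gtToLt.2 ?_)
    grind
  · refine hweak (hL s) (Finset.union_subset_union (fun x hx => by simp at hx ⊢; simp [hx])
      subset_rfl) (forall_mem_vars_ltToGt.2 ?_)
    grind
  · refine hweak (hG false) (Finset.Subset.trans (Finset.union_subset_union
      (fun x hx => by simp at hx ⊢; simp [hx]) subset_rfl) Finset.subset_union_left)
      (forall_mem_vars_notBoth.2 ?_)
    grind
  · refine step_of_small' (by simp) (isSmall_empty.mono (by norm_num)) (known_empty _) hK ?_ ?_ C h
    · intro σ h1 _
      simp only [satisfies_union, satisfies_eqv, satisfies_decided]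
      have := hpre σ h1
      grind
    · refine forall_mem_vars_union.2 ⟨forall_mem_vars_eqv.2 ?_, forall_mem_vars_decided.2 ?_⟩ <;>
        grind
  · refine hweak (hG false) (Finset.union_subset_union (fun x hx => by simp at hx ⊢; simp [hx])
      subset_rfl) (forall_mem_vars_gtBelow.2 ?_)
    grind
  · refine hweak (hL false) (Finset.union_subset_union (fun x hx => by simp at hx ⊢; simp [hx])
      subset_rfl) (forall_mem_vars_ltBelow.2 ?_)
    grind
  · exact absurd h (lt_irrefl m)

/-- Each further bit of the comparison that is read removes one literal from the wide clauses. -/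
lemma step_cmp (hn : 1 ≤ n) {t : ℕ} (ht : t < m) :
    ∀ C ∈ facts m n (.cmp t), Step m n (.cmp t) C := by
  have hgt := live_gt (m := m) hn (u := .cmp t) (by simp)
  have hlt := live_lt (m := m) (n := n) (by omega) (u := .cmp t) (by simp)
  have hb := fun s => live_below (n := n) (m := m) (k := t) (t := t + 1) le_rfl ht s
  have hpre : Known m n (.cmp t) (eqv (.pre t)) :=
    known_eqv (t := .cmp (t + 1)) ht (by simp; omega) (by
      simp only [facts, preFacts_succ]
      intro C hC
      simp only [Finset.mem_union, hC, true_or, or_true]) fun s => (hb s t (by omega)).2.2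
  have hres : ∀ C ∈ resultFacts (t + 1), (∀ x ∈ vars {C}, Live m n (.cmp t) x) →
      Known m n (.cmp t) {C} := fun C hC h =>
    known_of_subset (t := .cmp (t + 1)) ht (by simp; omega) (by
      rw [Finset.singleton_subset_iff]
      simp only [facts, Finset.mem_union, hC, true_or]) h
  have hgtb : Known m n (.cmp t) {gtBelow t} :=
    known_of_subset (t := .cmp (t + 1)) ht (by simp; omega) (by
      rw [Finset.singleton_subset_iff]
      simp [facts, preFacts_succ]) (forall_mem_vars_gtBelow.2
        ⟨hgt _, (hb _ t (by omega)).2.2, fun i hi => (hb _ i hi).1⟩)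
  have hltb : Known m n (.cmp t) {ltBelow t} :=
    known_of_subset (t := .cmp (t + 1)) ht (by simp; omega) (by
      rw [Finset.singleton_subset_iff]
      simp [facts, preFacts_succ]) (forall_mem_vars_ltBelow.2
        ⟨hlt _, (hb _ t (by omega)).2.2, fun i hi => (hb _ i hi).2.1⟩)
  have hdec : Known m n (.cmp t) (decided t) :=
    known_of_subset (t := .cmp (t + 1)) ht (by simp; omega) (by
      simp only [facts, preFacts_succ]
      intro C hC
      simp only [Finset.mem_union, hC, true_or, or_true]) (forall_mem_vars_decided.2
        ⟨(hb _ t (by omega)).2.2, hgt _, hlt _⟩)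
  have hcv : ∀ s, .wire s .gt ∈ vars (chunk m n (.cmp t)) ∧
      .wire s .lt ∈ vars (chunk m n (.cmp t)) ∧
      .wire s (.pre t) ∈ vars (chunk m n (.cmp t)) ∧ (expo s t).1 ∈ vars (chunk m n (.cmp t)) := by
    intro s
    cases s <;> simp [ht, cmpGates, -List.mem_map, List.map_cons]
  intro C hC
  rcases mem_facts_cmp hC with ⟨s, rfl⟩ | ⟨s, rfl⟩ | rfl | ⟨k, rfl, h | rfl | rfl⟩ | ⟨-, h⟩
  · have hav : Known m n (.cmp t) ({gtToLt s (t + 1)} ∪ eqv (.pre t)) :=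
      (hres _ (by cases s <;> simp [resultFacts]) (forall_mem_vars_gtToLt.2
        ⟨hgt _, hlt _, fun i hi => (hb _ i hi).1⟩)).union hpre
    refine step_of_wide (by simp) [.wire s (.gtBit t), .wire false (.pre t), .wire true (.pre t)]
      (by simp) (((Finset.card_union_le _ _).trans (add_le_add (Finset.card_singleton _).le
        (isSmall_eqv _).1)).trans (by norm_num)) hav hav ?_ ?_ ?_
    · intro σ h1 h2
      have h3 := comparison_of_satisfies ht h1 s
      have h4 := comparison_of_satisfies ht h1 (!s)
      simp only [satisfies_union, satisfies_gtToLt, satisfies_eqv, Nat.exists_lt_succ_right,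
        Bool.not_not] at h2 h3 h4 ⊢
      cases s <;> grind
    · have := forall_mem_vars_gtToLt.1 fun x (hx : x ∈ vars {gtToLt s (t + 1)}) => hx
      refine forall_mem_vars_gtToLt.2 ?_
      simp only [vars_union, Finset.mem_union]
      grind
    · have := forall_mem_vars_gtToLt.1 fun x (hx : x ∈ vars {gtToLt s t}) => hx
      refine forall_mem_vars_union.2 ⟨forall_mem_vars_gtToLt.2 ?_, forall_mem_vars_eqv.2 ?_⟩
      · simp only [List.mem_cons]
        grind
      · simp
  · have hav : Known m n (.cmp t) ({ltToGt s (t + 1)} ∪ eqv (.pre t)) :=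
      (hres _ (by cases s <;> simp [resultFacts]) (forall_mem_vars_ltToGt.2
        ⟨hlt _, hgt _, fun i hi => (hb _ i hi).2.1⟩)).union hpre
    refine step_of_wide (by simp) [.wire s (.ltBit t), .wire false (.pre t), .wire true (.pre t)]
      (by simp) (((Finset.card_union_le _ _).trans (add_le_add (Finset.card_singleton _).le
        (isSmall_eqv _).1)).trans (by norm_num)) hav hav ?_ ?_ ?_
    · intro σ h1 h2
      have h3 := comparison_of_satisfies ht h1 s
      have h4 := comparison_of_satisfies ht h1 (!s)
      simp only [satisfies_union, satisfies_ltToGt, satisfies_eqv, Nat.exists_lt_succ_right,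
        Bool.not_not] at h2 h3 h4 ⊢
      cases s <;> grind
    · have := forall_mem_vars_ltToGt.1 fun x (hx : x ∈ vars {ltToGt s (t + 1)}) => hx
      refine forall_mem_vars_ltToGt.2 ?_
      simp only [vars_union, Finset.mem_union]
      grind
    · have := forall_mem_vars_ltToGt.1 fun x (hx : x ∈ vars {ltToGt s t}) => hx
      refine forall_mem_vars_union.2 ⟨forall_mem_vars_ltToGt.2 ?_, forall_mem_vars_eqv.2 ?_⟩
      · simp only [List.mem_cons]
        grind
      · simp
  · have hav : Known m n (.cmp t) ({notBoth (t + 1)} ∪ ({gtBelow t} ∪ {ltBelow t})) :=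
      (hres _ (by simp [resultFacts]) (forall_mem_vars_notBoth.2
        ⟨hgt _, hlt _, fun i hi => (hb _ i hi).1, fun i hi => (hb _ i hi).2.1⟩)).union
        (hgtb.union hltb)
    refine step_of_wide (by simp) (S := {notBoth (t + 1)} ∪ ({gtBelow t} ∪ {ltBelow t}))
      [.wire false (.gtBit t), .wire false (.ltBit t), .wire false (.pre t)] (by simp)
      (Finset.card_le_three.trans (by norm_num)) hav hav ?_ ?_ ?_
    · intro σ h1 h2
      have h3 := comparison_of_satisfies ht h1 false
      simp only [satisfies_union, satisfies_notBoth, satisfies_gtBelow, satisfies_ltBelow,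
        Nat.exists_lt_succ_right] at h2 h3 ⊢
      grind
    · have := forall_mem_vars_notBoth.1 fun x (hx : x ∈ vars {notBoth (t + 1)}) => hx
      refine forall_mem_vars_notBoth.2 ?_
      simp only [vars_union, Finset.mem_union]
      grind
    · have := forall_mem_vars_notBoth.1 fun x (hx : x ∈ vars {notBoth t}) => hx
      refine forall_mem_vars_union.2 ⟨forall_mem_vars_notBoth.2 ?_,
        forall_mem_vars_union.2 ⟨forall_mem_vars_gtBelow.2 ?_, forall_mem_vars_ltBelow.2 ?_⟩⟩ <;>
      · simp only [List.mem_cons]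
        grind
  · have hav : Known m n (.cmp (k + 1)) (eqv (.pre (k + 1)) ∪ decided (k + 1)) := hpre.union hdec
    refine step_of_small (by simp) (((isSmall_eqv _).union (isSmall_decided _)).mono (by norm_num))
      hav ?_ ?_ C h
    · intro σ h1 h2
      have h3 := comparison_of_satisfies ht h1
      have h4 := prefix_of_satisfies ht h1
      simp only [satisfies_union, satisfies_eqv, satisfies_decided] at h2 ⊢
      have h5 := h3 false
      have h6 := h3 true
      have h7 := h4 false
      have h8 := h4 true
      clear h3 h4
      simp only [Bool.not_false, Bool.not_true] at h5 h6
      cases ha : val σ (expo false (k + 1)) <;> cases hb : val σ (expo true (k + 1)) <;> grind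
    · have : ∀ s, .wire s (.pre k) ∈ vars (chunk m n (.cmp (k + 1))) := by
        intro s
        cases s <;> simp [preGate, ht, -List.mem_map]
      refine forall_mem_vars_union.2 ⟨forall_mem_vars_eqv.2 ?_, forall_mem_vars_decided.2 ?_⟩ <;>
        grind
  · refine step_of_wide (by simp) [.wire false (.gtBit (k + 1)), .wire false (.pre (k + 1))]
      (by simp) (by simp) hgtb hgtb ?_ ?_ ?_
    · intro σ h1 h2
      have h3 := comparison_of_satisfies ht h1 false
      have h4 := prefix_of_satisfies ht h1 false
      simp only [satisfies_gtBelow, Nat.exists_lt_succ_right] at h2 h3 h4 ⊢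
      cases ha : val σ (expo false (k + 1)) <;> cases hb : val σ (expo true (k + 1)) <;> grind
    · have : .wire false (.pre k) ∈ vars (chunk m n (.cmp (k + 1))) := by
        simp [preGate, ht, -List.mem_map]
      have := forall_mem_vars_gtBelow.1 fun x (hx : x ∈ vars {gtBelow (k + 1)}) => hx
      refine forall_mem_vars_gtBelow.2 ?_
      grind
    · have := forall_mem_vars_gtBelow.1 fun x (hx : x ∈ vars {gtBelow k}) => hx
      refine forall_mem_vars_gtBelow.2 ?_
      simp only [List.mem_cons]
      grind
  · refine step_of_wide (by simp) [.wire false (.ltBit (k + 1)), .wire false (.pre (k + 1))]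
      (by simp) (by simp) hltb hltb ?_ ?_ ?_
    · intro σ h1 h2
      have h3 := comparison_of_satisfies ht h1 false
      have h4 := prefix_of_satisfies ht h1 false
      simp only [satisfies_ltBelow, Nat.exists_lt_succ_right] at h2 h3 h4 ⊢
      cases ha : val σ (expo false (k + 1)) <;> cases hb : val σ (expo true (k + 1)) <;> grind
    · have : .wire false (.pre k) ∈ vars (chunk m n (.cmp (k + 1))) := by
        simp [preGate, ht, -List.mem_map]
      have := forall_mem_vars_ltBelow.1 fun x (hx : x ∈ vars {ltBelow (k + 1)}) => hx
      refine forall_mem_vars_ltBelow.2 ?_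
      grind
    · have := forall_mem_vars_ltBelow.1 fun x (hx : x ∈ vars {ltBelow k}) => hx
      refine forall_mem_vars_ltBelow.2 ?_
      simp only [List.mem_cons]
      grind
  · refine step_of_small (by simp) ((isSmall_decided _).mono (by norm_num)) hdec ?_ ?_ C h
    · intro σ h1 h2
      have h3 := comparison_of_satisfies ht h1 false
      simp only [satisfies_decided, satisfies_sameExpo, Bool.not_false] at h2 h3 ⊢
      cases ha : val σ (expo false t) <;> cases hb : val σ (expo true t) <;> grind
    · refine forall_mem_vars_sameExpo.2 ?_
      grind

end CompareSteps

/-! ### The local refutation of the miter -/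

section ErrorSteps

variable {m n : ℕ}

lemma satisfies_errClause {σ : Var → Bool} {t r : ℕ} : Satisfies σ {errClause t r} ↔
    (∃ i < t, σ (.errM i) = true) ∨ ∃ i < r, σ (.errE i) = true := by
  rw [satisfies_singleton]
  simp [errClause, or_and_right, exists_or, val, lit]

lemma forall_mem_vars_errClause {t r : ℕ} {P : Var → Prop} : (∀ x ∈ vars {errClause t r}, P x) ↔
    (∀ i < t, P (.errM i)) ∧ ∀ i < r, P (.errE i) := by
  rw [vars_singleton]
  simp only [errClause, clauseVars, Finset.forall_mem_image, Finset.mem_union, or_imp, forall_and,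
    Finset.mem_range, lit]

lemma live_errE {u : Key} {i : ℕ} (hi : i < m) (hu : rank m n u ≤ time 18 0 0 (m - i)) :
    Live m n u (.errE i) :=
  live_of_mem (v := .errE i) hi hu (by simp [chunk, errGates, vars_union, mem_vars_xorGate, lit])

lemma live_errM {u : Key} {i : ℕ} (hi : i < n) (hu : rank m n u ≤ time 17 0 0 (n - i)) :
    Live m n u (.errM i) :=
  live_of_mem (v := .errM i) hi hu (by simp [chunk, errGates, vars_union, mem_vars_xorGate, lit])

/-- Each pair of outputs that has been seen to agree removes one literal from the clause that
asserts a disagreement. The pairs of mantissa bits are treated first. -/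
lemma step_errM {t : ℕ} (ht : t < n) : ∀ C ∈ facts m n (.errM t), Step m n (.errM t) C := by
  have hM : ∀ i < t + 1, Live m n (.errM t) (.errM i) := fun i hi =>
    live_errM (by omega) (by simp [rank]; omega)
  have hE : ∀ i < m, Live m n (.errM t) (.errE i) := fun i hi => live_errE hi (by simp [rank])
  have hprem : Known m n (.errM t) {errClause (t + 1) m} := by
    rcases Nat.lt_or_ge (t + 1) n with h | h
    · exact known_of_subset (t := .errM (t + 1)) h (by simp [rank]; omega) subset_rfl
        (forall_mem_vars_errClause.2 ⟨hM, hE⟩)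
    · obtain rfl : n = t + 1 := by omega
      exact known_of_subset (t := .big) trivial (by simp [rank]) (by
        rw [Finset.singleton_subset_iff]; simp [facts, chunk, errGates])
        (forall_mem_vars_errClause.2 ⟨hM, hE⟩)
  have hav : Known m n (.errM t) ({errClause (t + 1) m} ∪ eqv (.mFinal t)) :=
    hprem.union (known_eqv (t := .fShift t) ht (by simp [rank]) subset_rfl
      fun s => live_self (u := .errM t) ht (by
        cases s <;> simp [chunk, errGates, vars_union, mem_vars_xorGate]))
  intro C hC
  obtain rfl := Finset.mem_singleton.1 hC
  refine step_of_wide (by simp) [.errM t, .wire false (.mFinal t), .wire true (.mFinal t)] (by simp)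
    (((Finset.card_union_le _ _).trans (add_le_add (Finset.card_singleton _).le
        (isSmall_eqv _).1)).trans (by norm_num)) hav hav ?_ ?_ ?_
  · intro σ h1 h2
    simp only [satisfies_union, satisfies_errClause, satisfies_eqv, Nat.exists_lt_succ_right,
      chunk, errGates, satisfies_xorGate, val_W] at h1 h2 ⊢
    have h3 := h1.2
    rw [h2.2] at h3
    simp [val, lit] at h3
    grind
  · have := forall_mem_vars_errClause.1 fun x (hx : x ∈ vars {errClause (t + 1) m}) => hx
    refine forall_mem_vars_errClause.2 ?_
    simp only [vars_union, Finset.mem_union]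
    grind
  · have := forall_mem_vars_errClause.1 fun x (hx : x ∈ vars {errClause t m}) => hx
    refine forall_mem_vars_union.2 ⟨forall_mem_vars_errClause.2 ?_, forall_mem_vars_eqv.2 ?_⟩
    · simp only [List.mem_cons]
      grind
    · simp

lemma step_errE (hn : 1 ≤ n) {t : ℕ} (ht : t < m) :
    ∀ C ∈ facts m n (.errE t), Step m n (.errE t) C := by
  have hE : ∀ i < t + 1, Live m n (.errE t) (.errE i) := fun i hi =>
    live_errE (by omega) (by simp [rank]; omega)
  have hv : ∀ x ∈ vars {errClause 0 (t + 1)}, Live m n (.errE t) x :=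
    forall_mem_vars_errClause.2 ⟨by simp, hE⟩
  have hprem : Known m n (.errE t) {errClause 0 (t + 1)} := by
    rcases Nat.lt_or_ge (t + 1) m with h | h
    · exact known_of_subset (t := .errE (t + 1)) h (by simp [rank]; omega) subset_rfl hv
    · obtain rfl : m = t + 1 := by omega
      exact known_of_subset (t := .errM 0) hn (by simp [rank]) subset_rfl hv
  have hav : Known m n (.errE t) ({errClause 0 (t + 1)} ∪ eqv (.eFinal t)) :=
    hprem.union (known_eqv (t := .eFin t) ht (by simp [rank]) Finset.subset_union_left
      fun s => live_self (u := .errE t) ht (by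
        cases s <;> simp [chunk, errGates, vars_union, mem_vars_xorGate]))
  intro C hC
  obtain rfl := Finset.mem_singleton.1 hC
  refine step_of_wide (by simp) [.errE t, .wire false (.eFinal t), .wire true (.eFinal t)] (by simp)
    (((Finset.card_union_le _ _).trans (add_le_add (Finset.card_singleton _).le
        (isSmall_eqv _).1)).trans (by norm_num)) hav hav ?_ ?_ ?_
  · intro σ h1 h2
    simp only [satisfies_union, satisfies_errClause, satisfies_eqv, Nat.exists_lt_succ_right,
      chunk, errGates, satisfies_xorGate, val_W] at h1 h2 ⊢
    have h3 := h1.2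
    rw [h2.2] at h3
    simp [val, lit] at h3
    grind
  · have := forall_mem_vars_errClause.1 fun x (hx : x ∈ vars {errClause 0 (t + 1)}) => hx
    refine forall_mem_vars_errClause.2 ?_
    simp only [vars_union, Finset.mem_union]
    grind
  · have := forall_mem_vars_errClause.1 fun x (hx : x ∈ vars {errClause 0 t}) => hx
    refine forall_mem_vars_union.2 ⟨forall_mem_vars_errClause.2 ?_, forall_mem_vars_eqv.2 ?_⟩
    · simp only [List.mem_cons]
      grind
    · simp

end ErrorSteps

section MiterRefutation

variable {m n : ℕ}

lemma step_facts (hm : 1 ≤ m) (hn : 1 ≤ n) {k : Key} (hk : ValidKey m n k) :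
    ∀ C ∈ facts m n k, C ∈ chunk m n k ∨ Step m n k C := by
  intro C hC
  cases k with
  | big => exact Or.inl hC
  | cmp t =>
    rcases Nat.lt_or_ge t m with ht | ht
    · exact Or.inr (step_cmp hn ht C hC)
    · obtain rfl : t = m := le_antisymm hk ht
      exact Or.inr (step_cmp_top hm hn C hC)
  | borrow0 => exact Or.inr (step_borrow0 hm hn C hC)
  | eSel i => exact Or.inr (step_eSel hm hn hk C hC)
  | sub i => exact Or.inr (step_sub hn hk C hC)
  | mSel i => exact Or.inr (step_mSel hn C hC)
  | alignInit => exact Or.inr (step_alignInit hn C hC)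
  | lost0 j => exact Or.inr (step_lost0 hn C hC)
  | lost j i => exact Or.inr (step_lost hn hk C hC)
  | shift j i => exact Or.inr (step_shift hn hk C hC)
  | stick j => exact Or.inr (step_stick hn hk C hC)
  | carry0 => exact Or.inr (step_carry0 C hC)
  | add i => exact Or.inr (step_add hn hk C hC)
  | norm i => exact Or.inr (step_norm hk C hC)
  | normLow => exact Or.inr (step_normLow C hC)
  | eUpd i => exact Or.inr (step_eUpd hk C hC)
  | rndInit => exact Or.inr (step_rndInit hn C hC)
  | rndInc i => exact Or.inr (step_rndInc hk C hC)
  | fShift i => exact Or.inr (step_fShift hk C hC)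
  | eFin i => exact Or.inr (step_eFin hk C hC)
  | errM t => exact Or.inr (step_errM hk C hC)
  | errE t => exact Or.inr (step_errE hn hk C hC)

lemma card_facts_le (k : Key) : (facts m n k).card ≤ stepBound := by
  have he := fun w => (isSmall_eqv w).1
  have hz := fun w => ((isSmall_eqv w).union (isSmall_zeroE w)).1
  have ha := fun j i => (isSmall_alFact j i).1
  have hp : ∀ t, (preFacts t).card ≤ 82 := by
    rintro (_ | t)
    · simp [preFacts]
    · exact (Finset.card_union_le _ _).trans (add_le_add
        ((isSmall_eqv _).union (isSmall_decided _)).1 Finset.card_le_two)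
  have hs : ∀ t, (if t < m then sameExpo t else ∅).card ≤ 40 := by
    intro t
    split_ifs
    exacts [(isSmall_sameExpo t).1, by simp]
  have hr : ∀ t, (resultFacts t).card ≤ 5 := fun t => Finset.card_le_five
  have hu := fun F G : CNF Var => Finset.card_union_le F G
  rw [stepBound]
  cases k with
  | big => exact (card_chunk_le _).trans (by norm_num)
  | cmp t =>
    exact ((hu _ _).trans (add_le_add ((hu _ _).trans (add_le_add (hr t) (hp t))) (hs t))).trans
      (by norm_num)
  | borrow0 => exact ((hu _ _).trans (add_le_add (hz _) isSmall_excl.1)).trans (by norm_num)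
  | eSel i =>
    exact (((isSmall_eqv _).union (isSmall_eqv _)).union (isSmall_sameSel i)).1.trans (by norm_num)
  | sub i => exact ((hu _ _).trans (add_le_add (hz _) (hz _))).trans (by norm_num)
  | mSel i => exact (ha _ _).trans (by norm_num)
  | alignInit =>
    exact ((hu _ _).trans (add_le_add ((hu _ _).trans (add_le_add (ha _ _) (ha _ _)))
      (hz _))).trans (by norm_num)
  | lost0 j => exact (isSmall_condEqv _).1.trans (by norm_num)
  | lost j i => exact (isSmall_condEqv _).1.trans (by norm_num)
  | shift j i => exact (ha _ _).trans (by norm_num)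
  | stick j => exact (hz _).trans (by norm_num)
  | add i => exact ((hu _ _).trans (add_le_add (he _) (he _))).trans (by norm_num)
  | normLow => exact ((hu _ _).trans (add_le_add (he _) (he _))).trans (by norm_num)
  | eUpd i => exact ((hu _ _).trans (add_le_add (he _) (he _))).trans (by norm_num)
  | rndInc i => exact ((hu _ _).trans (add_le_add (he _) (he _))).trans (by norm_num)
  | eFin i => exact ((hu _ _).trans (add_le_add (he _) (he _))).trans (by norm_num)
  | carry0 | norm | rndInit | fShift => exact (he _).trans (by norm_num)
  | errM | errE => simp [facts]

/-- The two copies of the adder are traversed in parallel, and their outputs are seen to agree. -/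
theorem isLocalRefutation_commMiter (hm : 1 ≤ m) (hn : 1 ≤ n) :
    IsLocalRefutation (commMiter m n) (keys m n) (rank m n) (chunk m n) (facts m n) (.errE 0)
      stepBound stepBound where
  cover _ := mem_commMiter
  disjoint := chunk_disjoint
  rank_inj _ hu _ hv h := rank_inj (mem_keys.1 hu) (mem_keys.1 hv) h
  card_chunk u _ := (card_chunk_le u).trans (by norm_num [stepBound])
  card_facts u _ := card_facts_le u
  step u hu := step_facts hm hn (mem_keys.1 hu)
  last_mem := mem_keys.2 hm
  le_last u hu := by
    have := mem_keys.1 hu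
    cases u <;> simp [rank]
  empty_mem := by simp [facts, errClause]
  card_vars_last := (isSmall_chunk (by simp)).2.trans (by norm_num [stepBound])

/-- The stage of the barrel shifter to which a chunk belongs; later chunks count as stage `m`. -/
def level (m : ℕ) : Key → ℕ
  | .lost0 j | .lost j _ | .shift j _ | .stick j => j
  | _ => m

lemma exists_mem_clauseVars_alFact {j i : ℕ} {C : Clause Var} (hC : C ∈ alFact j i) :
    ∃ s, .wire s (alignBit j i) ∈ clauseVars C := by
  have he : ∀ w, C ∈ eqv w ∪ zeroE w → .wire false w ∈ clauseVars C := by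
    intro w h
    rcases Finset.mem_union.1 h with h | h <;>
      exact mem_clauseVars_of_mem_ofLists h (by simp [-List.mem_map])
  rcases i with _ | _ | i
  · exact ⟨_, he _ hC⟩
  · exact ⟨_, he _ hC⟩
  · rcases Finset.mem_union.1 hC with h | h
    · exact ⟨false, mem_clauseVars_of_mem_ofLists h (by simp [-List.mem_map])⟩
    · simp only [condInput, ofLists, List.mem_toFinset, List.map_cons, List.map_nil, List.mem_cons,
        List.not_mem_nil, or_false] at h
      rcases h with rfl | rfl | rfl | rfl
      exacts [⟨false, by simp [clauseVars]⟩, ⟨false, by simp [clauseVars]⟩,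
        ⟨true, by simp [clauseVars]⟩, ⟨true, by simp [clauseVars]⟩]

/-- A fact that is live at time `u` was derived early on, or in the current or the preceding stage
of the barrel shifter. -/
lemma rank_mem_timeBox_of_live {u k : Key} (hu : ValidKey m n u) (hk : ValidKey m n k)
    (hku : rank m n k ≤ rank m n u) {C : Clause Var} (hC : C ∈ facts m n k)
    (hlive : ∀ x ∈ clauseVars C, ∃ v ∈ keys m n, rank m n u < rank m n v ∧ x ∈ vars (chunk m n v)) :
    rank m n k ∈ timeBox {0, level m u - 1, level m u} (m + n + 2) := by
  have hdead : ∀ x ∈ clauseVars C, keyOf x = k → rank m n u < dead m k := by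
    rintro x hx rfl
    obtain ⟨v, hv, huv, hxv⟩ := hlive x hx
    exact huv.trans_le (rank_le_dead (mem_keys.1 hv) hxv)
  have hb := rank_mem_timeBox hk
  have hlev : ∀ j c d, rank m n k = time 7 j c d → c < 4 → j < m →
      rank m n u < (if j + 1 < m then time 7 (j + 1) 4 0 else time 100 0 0 0) →
      rank m n k ∈ timeBox {0, level m u - 1, level m u} (m + n + 2) := by
    intro j c d hr hc hj hd
    rw [hr, time_mem_timeBox] at hb ⊢
    rw [hr] at hku
    refine ⟨hb.1, ?_, hc, hb.2.2.2⟩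
    simp only [Finset.mem_insert, Finset.mem_singleton]
    split_ifs at hd with h <;> cases u <;> simp [rank, level, ValidKey] at hku hd hu ⊢ <;> omega
  cases k with
  | lost0 j =>
    exact hlev j 0 0 rfl (by norm_num) hk (hdead (.wire false (.lost j 0))
      (mem_clauseVars_of_mem_ofLists hC (by simp [-List.mem_map])) rfl)
  | lost j i =>
    exact hlev j 1 i rfl (by norm_num) hk.1 (hdead (.wire false (.lost j (i + 1)))
      (mem_clauseVars_of_mem_ofLists hC (by simp [-List.mem_map])) rfl)
  | shift j i =>
    obtain ⟨s, hs⟩ := exists_mem_clauseVars_alFact hC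
    exact hlev j 2 i rfl (by norm_num) hk.1 (hdead _ hs rfl)
  | stick j =>
    refine hlev j 3 0 rfl (by norm_num) hk (hdead (.wire false (.sticky (j + 1))) ?_ rfl)
    rcases Finset.mem_union.1 hC with h | h <;>
      exact mem_clauseVars_of_mem_ofLists h (by simp [-List.mem_map])
  | _ =>
    simp only [rank, time_mem_timeBox] at hb ⊢
    exact ⟨hb.1, by simp, hb.2.2⟩

/-- At any time the live facts stem from `O(m + n)` chunks: the stages of the barrel shifter have
`O(n)` chunks each, but only two stages matter. -/
lemma card_liveFacts_le {u : Key} (hu : u ∈ keys m n) :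
    (liveFacts (keys m n) (rank m n) (chunk m n) (facts m n) u).card ≤
      76 * 3 * (m + n + 2) * stepBound := by
  set box := timeBox {0, level m u - 1, level m u} (m + n + 2) with hbox
  have hsub : liveFacts (keys m n) (rank m n) (chunk m n) (facts m n) u ⊆
      ((keys m n).filter fun k => rank m n k ∈ box).biUnion (facts m n) := by
    intro C hC
    obtain ⟨⟨k, hk, hku, hCk⟩, hlive⟩ := mem_liveFacts.1 hC
    exact Finset.mem_biUnion.2 ⟨k, Finset.mem_filter.2 ⟨hk,
      rank_mem_timeBox_of_live (mem_keys.1 hu) (mem_keys.1 hk) hku hCk hlive⟩, hCk⟩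
  have hcard : ((keys m n).filter fun k => rank m n k ∈ box).card ≤ box.card :=
    Finset.card_le_card_of_injOn (rank m n) (fun k hk => (Finset.mem_filter.1 hk).2)
      fun k hk l hl h => rank_inj (mem_keys.1 (Finset.mem_filter.1 hk).1)
        (mem_keys.1 (Finset.mem_filter.1 hl).1) h
  calc _ ≤ _ := Finset.card_le_card hsub
    _ ≤ _ := Finset.card_biUnion_le_card_mul _ _ _ fun k _ => card_facts_le k
    _ ≤ _ := by
      refine Nat.mul_le_mul_right _ (hcard.trans ((card_timeBox _ _).trans ?_))
      exact Nat.mul_le_mul_right _ (Nat.mul_le_mul_left _ Finset.card_le_three)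

end MiterRefutation

/-! ### Pathwidth of the miter -/

section Routing

variable {U : Type*} {r : ℕ} {B : Fin r → Finset U}

/-- A path that starts in a bag up to `i` and ends in a bag from `i` on meets the bag `i`. The path
is given by its vertices `g 0, h 0, g 1, h 1, …, g ℓ`. -/
lemma exists_mem_bag (hB : ∀ v i j k, i ≤ j → j ≤ k → v ∈ B i → v ∈ B k → v ∈ B j) {ℓ : ℕ}
    {g h : ℕ → U} (hgh : ∀ j < ℓ, ∃ i, g j ∈ B i ∧ h j ∈ B i)
    (hhg : ∀ j < ℓ, ∃ i, h j ∈ B i ∧ g (j + 1) ∈ B i) {i a b : Fin r} (ha : a ≤ i) (hb : i ≤ b)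
    (h0 : g 0 ∈ B a) (hl : g ℓ ∈ B b) : ∃ j, g j ∈ B i ∨ j < ℓ ∧ h j ∈ B i := by
  by_contra! hno
  -- a vertex outside the bag `i` lies entirely on one side of it
  have hside : ∀ v, v ∉ B i → (∃ c < i, v ∈ B c) → ∀ c, v ∈ B c → c < i := by
    rintro v hv ⟨c, hc, hvc⟩ e he
    by_contra hei
    exact hv (hB v c i e hc.le (not_lt.1 hei) hvc he)
  have key : ∀ j ≤ ℓ, ∀ c, g j ∈ B c → c < i := by
    intro j
    induction j with
    | zero =>
      refine fun _ => hside _ (hno 0).1 ⟨a, lt_of_le_of_ne ha ?_, h0⟩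
      rintro rfl
      exact (hno 0).1 h0
    | succ j ih =>
      intro hj
      obtain ⟨c, hc1, hc2⟩ := hgh j hj
      obtain ⟨e, he1, he2⟩ := hhg j hj
      have h1 := ih (by omega) c hc1
      have h2 := hside _ ((hno j).2 hj) ⟨c, h1, hc2⟩ e he1
      exact hside _ (hno (j + 1)).1 ⟨e, h2, he2⟩
  exact absurd (key ℓ le_rfl b hl) (not_lt.2 hb)

/-- Sources and targets that are joined by paths of low congestion force a large bag: the path from
`x` to `y` has a label `e x y` below `D`, and paths with the same label are disjoint. At
least half of the sources occur up to the bag chosen in the proof, and at least half from it on,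
while each target occurs on one of the two sides. Paths that change sides meet the bag, and at most
`D` paths share a vertex. -/
lemma card_mul_card_le_of_routing
    (hB : ∀ v i j k, i ≤ j → j ≤ k → v ∈ B i → v ∈ B k → v ∈ B j) {b : ℕ}
    (hb : ∀ i, (B i).card ≤ b) {X Y : Finset ℕ} {ℓ D : ℕ} {g h : ℕ → ℕ → ℕ → U} {e : ℕ → ℕ → ℕ}
    (src tgt : ℕ → U) (hsrc : ∀ x ∈ X, ∀ y ∈ Y, g x y 0 = src x)
    (htgt : ∀ x ∈ X, ∀ y ∈ Y, g x y ℓ = tgt y)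
    (hcs : ∀ x ∈ X, ∃ i, src x ∈ B i) (hct : ∀ y ∈ Y, ∃ i, tgt y ∈ B i)
    (hgh : ∀ x ∈ X, ∀ y ∈ Y, ∀ j < ℓ, ∃ i, g x y j ∈ B i ∧ h x y j ∈ B i)
    (hhg : ∀ x ∈ X, ∀ y ∈ Y, ∀ j < ℓ, ∃ i, h x y j ∈ B i ∧ g x y (j + 1) ∈ B i)
    (he : ∀ x ∈ X, ∀ y ∈ Y, e x y < D)
    (hinj : ∀ x ∈ X, ∀ y ∈ Y, ∀ x' ∈ X, ∀ y' ∈ Y, e x y = e x' y' → ∀ v,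
      (∃ j, g x y j = v ∨ h x y j = v) → (∃ j, g x' y' j = v ∨ h x' y' j = v) →
      x = x' ∧ y = y') :
    X.card * Y.card ≤ 4 * (b * D) := by
  classical
  rcases X.eq_empty_or_nonempty with rfl | hX
  · simp
  let before : ℕ → Finset ℕ := fun k => X.filter fun x => ∃ a : Fin r, a.1 < k ∧ src x ∈ B a
  -- `k` is the first time at which half of the sources have been seen
  have hex : ∃ k, X.card ≤ 2 * (before k).card := by
    refine ⟨r, ?_⟩
    have : before r = X := Finset.filter_true_of_mem fun x hx => by
      obtain ⟨i, hi⟩ := hcs x hx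
      exact ⟨i, i.2, hi⟩
    rw [this]; omega
  obtain ⟨k, hk, hmin⟩ : ∃ k, X.card ≤ 2 * (before k).card ∧
      ∀ l < k, 2 * (before l).card < X.card :=
    ⟨Nat.find hex, Nat.find_spec hex, fun l hl => not_le.1 (Nat.find_min hex hl)⟩
  have hXpos := hX.card_pos
  have hk0 : 0 < k := by
    rcases Nat.eq_zero_or_pos k with rfl | h
    · have h0 : before 0 = ∅ := Finset.filter_eq_empty_iff.2 (by simp)
      rw [h0, Finset.card_empty] at hk
      omega
    · exact h
  have hkr : k - 1 < r := by
    by_contra hkr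
    have h1 : before (k - 1) = before k := by
      refine Finset.filter_congr fun x _ => ⟨?_, ?_⟩ <;> rintro ⟨a, -, h⟩ <;>
        exact ⟨a, by omega, h⟩
    have := hmin (k - 1) (by omega)
    rw [h1] at this
    omega
  let i : Fin r := ⟨k - 1, hkr⟩
  let XR := X.filter fun x => ∃ a, i ≤ a ∧ src x ∈ B a
  let YL := Y.filter fun y => ∃ a, a ≤ i ∧ tgt y ∈ B a
  let YR := Y.filter fun y => ∃ a, i ≤ a ∧ tgt y ∈ B a
  have hXR : X.card ≤ 2 * XR.card := by
    have h1 : X ⊆ before (k - 1) ∪ XR := by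
      intro x hx
      obtain ⟨a, ha⟩ := hcs x hx
      rw [Finset.mem_union]
      rcases lt_or_ge a i with hlt | hge
      · exact Or.inl (Finset.mem_filter.2 ⟨hx, a, hlt, ha⟩)
      · exact Or.inr (Finset.mem_filter.2 ⟨hx, a, hge, ha⟩)
    have h2 := (Finset.card_le_card h1).trans (Finset.card_union_le _ _)
    have h3 := hmin (k - 1) (by omega)
    omega
  have hY : Y.card ≤ YL.card + YR.card := by
    have h1 : Y ⊆ YL ∪ YR := by
      intro y hy
      obtain ⟨a, ha⟩ := hct y hy
      rw [Finset.mem_union]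
      rcases le_total a i with hle | hge
      · exact Or.inl (Finset.mem_filter.2 ⟨hy, a, hle, ha⟩)
      · exact Or.inr (Finset.mem_filter.2 ⟨hy, a, hge, ha⟩)
    exact (Finset.card_le_card h1).trans (Finset.card_union_le _ _)
  -- every path between the two sides meets the bag `i`
  have hcount : ∀ X' ⊆ X, ∀ Y' ⊆ Y,
      (∀ x ∈ X', ∀ y ∈ Y', ∃ j, g x y j ∈ B i ∨ j < ℓ ∧ h x y j ∈ B i) →
      X'.card * Y'.card ≤ b * D := by
    intro X' hX' Y' hY' hmeet
    have hmeet' : ∀ q ∈ X' ×ˢ Y', ∃ v ∈ B i, ∃ j, g q.1 q.2 j = v ∨ h q.1 q.2 j = v := by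
      intro q hq
      rw [Finset.mem_product] at hq
      obtain ⟨j, hj | ⟨-, hj⟩⟩ := hmeet q.1 hq.1 q.2 hq.2
      · exact ⟨_, hj, j, Or.inl rfl⟩
      · exact ⟨_, hj, j, Or.inr rfl⟩
    have : Nonempty U := ⟨src 0⟩
    choose! f hf hfj using hmeet'
    rw [← Finset.card_product]
    refine (Finset.card_le_card_of_injOn (t := B i ×ˢ Finset.range D)
      (fun q => (f q, e q.1 q.2)) ?_ ?_).trans ?_
    · intro q hq
      have hq' := Finset.mem_product.1 (Finset.mem_coe.1 hq)
      simp only [Finset.coe_product, Set.mem_prod, Finset.mem_coe, Finset.mem_range]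
      exact ⟨hf q hq, he _ (hX' hq'.1) _ (hY' hq'.2)⟩
    · intro q hq q' hq' heq
      have h1 := Finset.mem_product.1 (Finset.mem_coe.1 hq)
      have h2 := Finset.mem_product.1 (Finset.mem_coe.1 hq')
      simp only [Prod.mk.injEq] at heq
      have := hinj _ (hX' h1.1) _ (hY' h1.2) _ (hX' h2.1) _ (hY' h2.2) heq.2 _ (hfj q hq)
        (heq.1 ▸ hfj q' hq')
      exact Prod.ext this.1 this.2
    · rw [Finset.card_product, Finset.card_range]
      exact Nat.mul_le_mul_right _ (hb i)
  have hlr : (before k).card * YR.card ≤ b * D := by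
    refine hcount _ (Finset.filter_subset _ _) _ (Finset.filter_subset _ _) fun x hx y hy => ?_
    obtain ⟨hx, a, ha, hxa⟩ := Finset.mem_filter.1 hx
    obtain ⟨hy, c, hc, hyc⟩ := Finset.mem_filter.1 hy
    exact exists_mem_bag hB (hgh x hx y hy) (hhg x hx y hy) (i := i) (Nat.le_sub_one_of_lt ha) hc
      (by rwa [hsrc x hx y hy]) (by rwa [htgt x hx y hy])
  have hrl : XR.card * YL.card ≤ b * D := by
    refine hcount _ (Finset.filter_subset _ _) _ (Finset.filter_subset _ _) fun x hx y hy => ?_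
    obtain ⟨hx, a, ha, hxa⟩ := Finset.mem_filter.1 hx
    obtain ⟨hy, c, hc, hyc⟩ := Finset.mem_filter.1 hy
    -- the order of the bags is reversed
    obtain ⟨j, hj⟩ := exists_mem_bag (B := fun j => B j.rev) (r := r)
      (fun v i j k h1 h2 h3 h4 => hB v _ _ _ (Fin.rev_le_rev.2 h2) (Fin.rev_le_rev.2 h1) h4 h3)
      (g := g x y) (h := h x y) (ℓ := ℓ)
      (fun j hj => by obtain ⟨i, hi⟩ := hgh x hx y hy j hj; exact ⟨i.rev, by simpa using hi⟩)
      (fun j hj => by obtain ⟨i, hi⟩ := hhg x hx y hy j hj; exact ⟨i.rev, by simpa using hi⟩)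
      (i := i.rev) (a := a.rev) (b := c.rev) (Fin.rev_le_rev.2 ha) (Fin.rev_le_rev.2 hc)
      (by simpa [hsrc x hx y hy] using hxa) (by simpa [htgt x hx y hy] using hyc)
    exact ⟨j, by simpa using hj⟩
  nlinarith [Nat.mul_le_mul hk (le_refl YR.card), Nat.mul_le_mul hXR (le_refl YL.card),
    Nat.mul_le_mul (le_refl X.card) hY]

end Routing

/-- An optimal path decomposition of the incidence graph, with the vertices read as variables and
clauses. -/
lemma exists_bags {V : Type*} [DecidableEq V] (F : CNF V) :
    ∃ (r : ℕ) (B : Fin r → Finset (V ⊕ Clause V)),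
      (∀ v i j k, i ≤ j → j ≤ k → v ∈ B i → v ∈ B k → v ∈ B j) ∧
      (∀ C ∈ F, ∀ x ∈ clauseVars C, ∃ i, .inl x ∈ B i ∧ .inr C ∈ B i) ∧
      ∀ i, (B i).card ≤ pathwidth F + 1 := by
  classical
  have hne : {w : ℕ | ∃ (r : ℕ) (B : Fin r → Finset ({x // x ∈ vars F} ⊕ {C // C ∈ F})),
      IsPathDecomposition (incidenceGraph F) r B ∧ ∀ i, (B i).card ≤ w + 1}.Nonempty :=
    ⟨_, 1, fun _ => Finset.univ, ⟨fun v => ⟨0, by simp⟩, fun u v _ => ⟨0, by simp⟩, by simp⟩,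
      fun _ => Nat.le_succ _⟩
  obtain ⟨r, B, hB, hcard⟩ := Nat.sInf_mem hne
  let f : {x // x ∈ vars F} ⊕ {C // C ∈ F} → V ⊕ Clause V := Sum.map Subtype.val Subtype.val
  have hf : Function.Injective f :=
    Sum.map_injective.2 ⟨Subtype.val_injective, Subtype.val_injective⟩
  refine ⟨r, fun i => (B i).map ⟨f, hf⟩, ?_, ?_, fun i => ?_⟩
  · intro v i j k hij hjk hi hk
    obtain ⟨u, hu, rfl⟩ := Finset.mem_map.1 hi
    obtain ⟨u', hu', huu⟩ := Finset.mem_map.1 hk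
    obtain rfl : u' = u := hf huu
    exact Finset.mem_map_of_mem _ (hB.interval _ i j k hij hjk hu hu')
  · intro C hC x hx
    obtain ⟨⟨y, b⟩, hl, rfl⟩ := Finset.mem_image.1 hx
    obtain ⟨i, h1, h2⟩ := hB.edge (.inl ⟨y, clauseVars_subset_vars hC hx⟩) (.inr ⟨C, hC⟩) ⟨b, hl⟩
    exact ⟨i, Finset.mem_map.2 ⟨_, h1, rfl⟩, Finset.mem_map.2 ⟨_, h2, rfl⟩⟩
  · rw [Finset.card_map]
    exact hcard i

section Barrel

variable {m n : ℕ}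

/-- A clause that joins bit `q` of the word before stage `j` of the left barrel shifter to bit `p`
of the word after it, for `q = p` and for `q = p + 2 ^ j`. -/
def stageClause (j q p : ℕ) : Clause Var :=
  {(.wire false (.diff j), decide (q = p)), (.wire false (alignBit j q), false),
    (.wire false (alignBit (j + 1) p), true)}

lemma mem_clauseVars_stageClause {j q p : ℕ} {x : Var} : x ∈ clauseVars (stageClause j q p) ↔
    x = .wire false (.diff j) ∨ x = .wire false (alignBit j q) ∨
      x = .wire false (alignBit (j + 1) p) := by
  simp [clauseVars, stageClause]

lemma stageClause_mem_commMiter {j q p : ℕ} (hj : j < m) (hq : q < n + 2)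
    (hqp : q = p ∨ q = p + 2 ^ j) : stageClause j q p ∈ commMiter m n := by
  have h2 : 0 < 2 ^ j := Nat.two_pow_pos j
  refine mem_commMiter.2 ⟨.shift j p, mem_keys.2 ⟨hj, by omega⟩, ?_⟩
  simp only [chunk, sideGates, gates, Finset.mem_union]
  refine Or.inl (Or.inl ?_)
  rcases hqp with rfl | rfl
  · split_ifs
    · simp [muxGate, ofLists, stageClause, W, lit, neg]
    · simp [muxZeroGate, ofLists, stageClause, W, lit, neg]
  · rw [if_pos hq]
    simp [muxGate, ofLists, stageClause, W, lit, neg]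

lemma alignBit_inj {j j' i i' : ℕ} (h : alignBit j i = alignBit j' i') : j = j' ∧ i = i' := by
  rcases j with _ | j <;> rcases j' with _ | j' <;> rcases i with _ | _ | i <;>
    rcases i' with _ | _ | i' <;> simp_all [alignBit]

lemma alignBit_ne_diff {j i k : ℕ} : alignBit j i ≠ .diff k := by
  rcases j with _ | j <;> rcases i with _ | _ | i <;> simp [alignBit]

lemma stageClause_inj {j q p j' q' p' : ℕ} (h : stageClause j q p = stageClause j' q' p') :
    j = j' ∧ p = p' := by
  have h1 : Var.wire false (.diff j) ∈ clauseVars (stageClause j' q' p') := by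
    rw [← h, mem_clauseVars_stageClause]; exact Or.inl rfl
  have h2 : Var.wire false (alignBit (j + 1) p) ∈ clauseVars (stageClause j' q' p') := by
    rw [← h, mem_clauseVars_stageClause]; exact Or.inr (Or.inr rfl)
  simp only [mem_clauseVars_stageClause, Var.wire.injEq, true_and, alignBit_ne_diff,
    alignBit_ne_diff.symm, or_false, false_or, Wire.diff.injEq] at h1 h2
  subst h1
  refine ⟨rfl, ?_⟩
  rcases h2 with h2 | h2
  · exact absurd (alignBit_inj h2).1 (by omega)
  · exact (alignBit_inj h2).2

/-- The position, before stage `j` of the barrel shifter, of a bit that starts at position `x`, if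
the word is shifted by `d`. -/
def route (x d j : ℕ) : ℕ := x - d % 2 ^ j

lemma route_succ {x d : ℕ} (hd : d ≤ x) (j : ℕ) :
    route x d j = route x d (j + 1) ∨ route x d j = route x d (j + 1) + 2 ^ j := by
  have h1 : d % 2 ^ (j + 1) ≤ d := Nat.mod_le _ _
  have h2 := Nat.mod_pow_succ (x := d) (b := 2) (k := j)
  unfold route
  rcases Nat.mod_two_eq_zero_or_one (d / 2 ^ j) with h | h
  · left; rw [h2, h]; simp
  · right; rw [h] at h2; omega

lemma eq_of_route_eq {x x' d j : ℕ} (hd : d ≤ x) (hd' : d ≤ x') (h : route x d j = route x' d j) :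
    x = x' := by
  have h1 : d % 2 ^ j ≤ d := Nat.mod_le _ _
  unfold route at h
  omega

lemma one_le_pathwidth_commMiter (hm : 1 ≤ m) : 1 ≤ pathwidth (commMiter m n) := by
  obtain ⟨r, B, -, hedge, hcard⟩ := exists_bags (commMiter m n)
  obtain ⟨i, h1, h2⟩ := hedge (stageClause 0 0 0)
    (stageClause_mem_commMiter hm (by omega) (Or.inl rfl)) _
    (mem_clauseVars_stageClause.2 (Or.inl rfl))
  have := Finset.one_lt_card.2 ⟨_, h1, _, h2, by simp⟩
  have := hcard i
  omega

/-- The barrel shifter routes every bit of the upper half of a word of length `2 ^ (J + 1)` to every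
position in the lower half, and routes for the same shift distance are disjoint. -/
theorem two_pow_le_pathwidth_commMiter {J : ℕ} (hJ : J + 1 ≤ m) (hn : 2 ^ (J + 1) ≤ n) :
    2 ^ J ≤ 8 * (pathwidth (commMiter m n) + 1) := by
  obtain ⟨r, B, hB, hedge, hcard⟩ := exists_bags (commMiter m n)
  have hM : 2 ^ (J + 1) = 2 ^ J + 2 ^ J := by rw [pow_succ]; omega
  have hMpos : 0 < 2 ^ J := Nat.two_pow_pos J
  set M := 2 ^ J with hMdef
  let wireAt : ℕ → ℕ → Var ⊕ Clause Var := fun j p => .inl (.wire false (alignBit j p))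
  let g : ℕ → ℕ → ℕ → Var ⊕ Clause Var := fun x y j => wireAt j (route x (x - y) j)
  let h : ℕ → ℕ → ℕ → Var ⊕ Clause Var := fun x y j =>
    .inr (stageClause j (route x (x - y) j) (route x (x - y) (j + 1)))
  have hC : ∀ x ∈ Finset.Ico M (2 * M), ∀ y ∈ Finset.range M, ∀ j < J + 1,
      stageClause j (route x (x - y) j) (route x (x - y) (j + 1)) ∈ commMiter m n := by
    intro x hx y _ j hj
    rw [Finset.mem_Ico] at hx
    refine stageClause_mem_commMiter (by omega) ?_ (route_succ (Nat.sub_le _ _) j)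
    have : route x (x - y) j ≤ x := Nat.sub_le _ _
    omega
  have hgh : ∀ x ∈ Finset.Ico M (2 * M), ∀ y ∈ Finset.range M, ∀ j < J + 1,
      ∃ i, g x y j ∈ B i ∧ h x y j ∈ B i := fun x hx y hy j hj =>
    hedge _ (hC x hx y hy j hj) _ (mem_clauseVars_stageClause.2 (Or.inr (Or.inl rfl)))
  have hhg : ∀ x ∈ Finset.Ico M (2 * M), ∀ y ∈ Finset.range M, ∀ j < J + 1,
      ∃ i, h x y j ∈ B i ∧ g x y (j + 1) ∈ B i := fun x hx y hy j hj => by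
    obtain ⟨i, h1, h2⟩ := hedge _ (hC x hx y hy j hj) _
      (mem_clauseVars_stageClause.2 (Or.inr (Or.inr rfl)))
    exact ⟨i, h2, h1⟩
  have hsrc : ∀ x y, g x y 0 = wireAt 0 x := fun x y => by simp [g, route, Nat.mod_one]
  have htgt : ∀ x ∈ Finset.Ico M (2 * M), ∀ y ∈ Finset.range M,
      g x y (J + 1) = wireAt (J + 1) y := by
    intro x hx y hy
    rw [Finset.mem_Ico] at hx
    rw [Finset.mem_range] at hy
    have h1 : (x - y) % 2 ^ (J + 1) = x - y := Nat.mod_eq_of_lt (by omega)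
    have h2 : x - (x - y) = y := by omega
    simp only [g, route, h1, h2]
  -- the label of the route from `x` to `y` is the shift distance
  have key := card_mul_card_le_of_routing hB hcard (X := Finset.Ico M (2 * M)) (Y := Finset.range M)
    (ℓ := J + 1) (D := 2 * M) (g := g) (h := h) (e := fun x y => x - y) (wireAt 0) (wireAt (J + 1))
    (fun x _ y _ => hsrc x y) htgt
    (fun x hx => by
      obtain ⟨i, hi, -⟩ := hgh x hx 0 (Finset.mem_range.2 hMpos) 0 (Nat.succ_pos J)
      exact ⟨i, hsrc x 0 ▸ hi⟩)
    (fun y hy => by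
      have hx : M ∈ Finset.Ico M (2 * M) := Finset.mem_Ico.2 ⟨le_rfl, by omega⟩
      obtain ⟨i, -, hi⟩ := hhg M hx y hy J (Nat.lt_succ_self J)
      exact ⟨i, htgt M hx y hy ▸ hi⟩)
    hgh hhg
    (fun x hx y _ => by rw [Finset.mem_Ico] at hx; omega)
    (by
      intro x hx y hy x' hx' y' hy' hxy v hv hv'
      rw [Finset.mem_Ico] at hx hx'
      rw [Finset.mem_range] at hy hy'
      suffices x = x' from ⟨this, by omega⟩
      have hd : x - y ≤ x := Nat.sub_le _ _
      have hd' : x - y ≤ x' := hxy ▸ Nat.sub_le _ _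
      obtain ⟨j, hj⟩ := hv
      obtain ⟨j', hj'⟩ := hv'
      simp only [g, h, wireAt, ← hxy] at hj hj'
      rcases hj with rfl | rfl <;> rcases hj' with hj' | hj'
      · obtain ⟨rfl, h2⟩ := alignBit_inj (by simpa using hj')
        exact (eq_of_route_eq hd' hd h2).symm
      · simp at hj'
      · simp at hj'
      · obtain ⟨rfl, h2⟩ := stageClause_inj (by simpa using hj')
        exact (eq_of_route_eq hd' hd h2).symm)
  rw [Nat.card_Ico, Finset.card_range, show 2 * M - M = M by omega] at key
  refine Nat.le_of_mul_le_mul_right (c := M) ?_ hMpos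
  calc M * M ≤ _ := key
    _ = _ := by ring

/-- The pathwidth of the miter is even linear in the number of mantissa bits. -/
theorem le_pathwidth_commMiter (hm : 1 ≤ m) (hn : 1 ≤ n) (hnm : n ≤ 2 ^ m) :
    n ≤ 64 * pathwidth (commMiter m n) := by
  have h1 := one_le_pathwidth_commMiter (m := m) (n := n) hm
  have hlog : n < 2 ^ (Nat.log 2 n + 1) := Nat.lt_pow_succ_log_self (by norm_num) n
  have hlog' : 2 ^ Nat.log 2 n ≤ n := Nat.pow_log_le_self 2 (by omega)
  rcases h : Nat.log 2 n with _ | J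
  · rw [h] at hlog
    omega
  · rw [h] at hlog hlog'
    have hJ : J + 1 ≤ m := (Nat.pow_le_pow_iff_right (by norm_num)).1 (hlog'.trans hnm)
    have h2 := two_pow_le_pathwidth_commMiter hJ hlog'
    rw [pow_succ, pow_succ] at hlog
    omega

end Barrel

/-! ### Parameters of the proofdoors and refutations -/

section Bounds

variable {m n : ℕ}

/-- The error bits are variables of the miter. -/
lemma add_le_numVars_commMiter : m + n ≤ numVars (commMiter m n) := by
  let E := (Finset.range m).image Var.errE
  let M := (Finset.range n).image Var.errM
  have hE : E.card = m := by
    rw [Finset.card_image_of_injective _ fun i j h => Var.errE.inj h, Finset.card_range]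
  have hM : M.card = n := by
    rw [Finset.card_image_of_injective _ fun i j h => Var.errM.inj h, Finset.card_range]
  have hdisj : Disjoint E M := by
    rw [Finset.disjoint_left]
    intro x hx hx'
    obtain ⟨i, -, rfl⟩ := Finset.mem_image.1 hx
    obtain ⟨j, -, h⟩ := Finset.mem_image.1 hx'
    cases h
  have hmem : errClause n m ∈ commMiter m n :=
    mem_commMiter.2 ⟨.big, mem_keys.2 trivial, by simp [chunk, errGates]⟩
  have hsub : E ∪ M ⊆ vars (commMiter m n) := by
    have h := forall_mem_vars_errClause.1 fun x hx =>
      clauseVars_subset_vars hmem (by rwa [vars_singleton] at hx)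
    refine Finset.union_subset (fun x hx => ?_) fun x hx => ?_
    · obtain ⟨i, hi, rfl⟩ := Finset.mem_image.1 hx
      exact h.2 i (Finset.mem_range.1 hi)
    · obtain ⟨i, hi, rfl⟩ := Finset.mem_image.1 hx
      exact h.1 i (Finset.mem_range.1 hi)
  have := Finset.card_le_card hsub
  rw [Finset.card_union_of_disjoint hdisj, hE, hM] at this
  exact this

theorem admitsProofdoor_commMiter (hm : 1 ≤ m) (hn : 1 ≤ n) :
    AdmitsProofdoor (commMiter m n) (76 * 3 * (m + n + 2) * stepBound + 1) (stepBound + 1)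
      (stepBound + 4 ^ stepBound) :=
  (isLocalRefutation_commMiter hm hn).admitsProofdoor fun _ => card_liveFacts_le

/-- The constants of the proofdoors. -/
lemma exists_uniform_proofdoor : ∃ K : ℕ, ∀ m n : ℕ, 1 ≤ m → 1 ≤ n → ∃ c w s : ℕ,
    c ≤ K * (m + n) ∧ w ≤ K ∧ s ≤ K ∧ AdmitsProofdoor (commMiter m n) c w s := by
  refine ⟨76 * 6 * stepBound + 1 + stepBound + 4 ^ stepBound, fun m n hm hn =>
    ⟨_, _, _, ?_, ?_, ?_, admitsProofdoor_commMiter hm hn⟩⟩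
  -- the powers of `stepBound` are too large to be evaluated
  · generalize 4 ^ stepBound = k
    generalize stepBound = b
    nlinarith [Nat.zero_le (k * (m + n)), Nat.zero_le (b * (m + n)), Nat.mul_le_mul_left b hm]
  · generalize 4 ^ stepBound = k
    omega
  · generalize 4 ^ stepBound = k
    omega

/-- There are at least two variables, so that multiples of the logarithm absorb constants. -/
lemma admitSmallProofdoors_commMiter :
    AdmitSmallProofdoors (fun b : ℕ+ × ℕ+ => commMiter b.1 b.2) := by
  obtain ⟨K, hK⟩ := exists_uniform_proofdoor
  refine ⟨2 * K, fun b => ?_⟩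
  obtain ⟨c, w, s, hc, hw, hs, h⟩ := hK b.1 b.2 b.1.pos b.2.pos
  refine ⟨c, w, s, h, ?_⟩
  have hN : (b.1 : ℕ) + b.2 ≤ numVars (commMiter b.1 b.2) := add_le_numVars_commMiter
  have h2 : 2 ≤ (b.1 : ℕ) + b.2 := add_le_add (a := 1) (c := 1) b.1.pos b.2.pos
  have hNR : ((b.1 : ℕ) + b.2 : ℝ) ≤ numVars (commMiter b.1 b.2) := by exact_mod_cast hN
  have h2R : (2 : ℝ) ≤ numVars (commMiter b.1 b.2) := by exact_mod_cast h2.trans hN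
  have hKR : (0 : ℝ) ≤ K := Nat.cast_nonneg K
  have hlog : 1 / 2 ≤ Real.log (numVars (commMiter b.1 b.2)) :=
    le_trans (by linarith [Real.log_two_gt_d9]) (Real.log_le_log (by norm_num) h2R)
  have hcR : (c : ℝ) ≤ K * ((b.1 : ℕ) + b.2) := by exact_mod_cast hc
  have hwR : (w : ℝ) ≤ K := by exact_mod_cast hw
  have hsR : (s : ℝ) ≤ K := by exact_mod_cast hs
  refine ⟨?_, ?_, ?_⟩ <;> nlinarith

lemma exists_polynomial_refutation : ∃ P : Polynomial ℕ, ∀ m n : ℕ, 1 ≤ m → 1 ≤ n →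
    ∃ π : List (Clause Var), IsRefutation (commMiter m n) π ∧
      π.length ≤ P.eval (numVars (commMiter m n)) := by
  refine ⟨Polynomial.C (152 * stepBound * (2 + 2 ^ stepBound)) * (Polynomial.X + 2) ^ 2,
    fun m n hm hn => ?_⟩
  obtain ⟨π, hπ, hlen⟩ := (isLocalRefutation_commMiter hm hn).exists_isRefutation
  refine ⟨π, hπ, hlen.trans ?_⟩
  have hk := card_keys_le m n
  have hN : m + n ≤ numVars (commMiter m n) := add_le_numVars_commMiter
  simp only [Polynomial.eval_mul, Polynomial.eval_C, Polynomial.eval_pow, Polynomial.eval_add,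
    Polynomial.eval_X, Polynomial.eval_ofNat]
  have hb : 1 ≤ stepBound := by norm_num [stepBound]
  generalize numVars (commMiter m n) = N at hN ⊢
  generalize 2 ^ stepBound = e
  generalize stepBound = s at hb ⊢
  have h1 : (keys m n).card ≤ 76 * (N + 2) ^ 2 := hk.trans (by nlinarith)
  calc (keys m n).card * s + (keys m n).card * s * e + 1
      = (keys m n).card * (s * (1 + e)) + 1 := by ring
    _ ≤ 76 * (N + 2) ^ 2 * (s * (1 + e)) + s * (N + 2) ^ 2 :=
        add_le_add (Nat.mul_le_mul_right _ h1) (Nat.one_le_iff_ne_zero.2 (by positivity))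
    _ ≤ 152 * s * (2 + e) * (N + 2) ^ 2 := by
        have := Nat.zero_le (s * (N + 2) ^ 2)
        have := Nat.zero_le (s * e * (N + 2) ^ 2)
        nlinarith

lemma exists_le_pathwidth : ∃ κ : ℝ, 0 < κ ∧ ∀ m n : ℕ, 1 ≤ m → 1 ≤ n → n ≤ 2 ^ m →
    κ * n / Real.log (n + 1) ≤ pathwidth (commMiter m n) := by
  refine ⟨1 / 100, by norm_num, fun m n hm hn hnm => ?_⟩
  have h1 : (n : ℝ) ≤ 64 * pathwidth (commMiter m n) := by
    exact_mod_cast le_pathwidth_commMiter hm hn hnm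
  have h2 : (2 : ℝ) ≤ n + 1 := by
    have : (1 : ℝ) ≤ n := by exact_mod_cast hn
    linarith
  have hlog : 0.69 ≤ Real.log (n + 1) :=
    le_trans (by linarith [Real.log_two_gt_d9]) (Real.log_le_log (by norm_num) h2)
  have hp : (0 : ℝ) ≤ pathwidth (commMiter m n) := Nat.cast_nonneg _
  -- the constant is chosen such that `64 * (1 / 100) ≤ 0.69`
  rw [div_le_iff₀ (by linarith)]
  nlinarith

end Bounds

end FPMiter

theorem mainTheorem4 :
    FPMiter.AdmitSmallProofdoors (fun b : ℕ+ × ℕ+ => FPMiter.commMiter b.1 b.2) ∧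
    (∃ K : ℕ, ∀ m n : ℕ, 1 ≤ m → 1 ≤ n → ∃ c w s : ℕ,
      c ≤ K * (m + n) ∧ w ≤ K ∧ s ≤ K ∧
        FPMiter.AdmitsProofdoor (FPMiter.commMiter m n) c w s) ∧
    (∃ P : Polynomial ℕ, ∀ m n : ℕ, 1 ≤ m → 1 ≤ n → ∃ π : List (FPMiter.Clause FPMiter.Var),
      FPMiter.IsRefutation (FPMiter.commMiter m n) π ∧
        π.length ≤ P.eval (FPMiter.numVars (FPMiter.commMiter m n))) ∧
    (∃ κ : ℝ, 0 < κ ∧ ∀ m n : ℕ, 1 ≤ m → 1 ≤ n → n ≤ 2 ^ m →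
      κ * n / Real.log (n + 1) ≤ FPMiter.pathwidth (FPMiter.commMiter m n)) :=
  ⟨FPMiter.admitSmallProofdoors_commMiter, FPMiter.exists_uniform_proofdoor,
    FPMiter.exists_polynomial_refutation, FPMiter.exists_le_pathwidth⟩
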